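/- Let $G$ be a compact semisimple Lie group with Lie algebra $\mathfrak g$ and Killing form $B$, let $K\subset G$ be a closed subgroup with Lie algebra $\mathfrak k$, and let $\mathfrak g=\mathfrak k\oplus\mathfrak p$ be the $B$-orthogonal decomposition, so that $T_o(G/K)\equiv\mathfrak p$. Let $g_B$ be the standard metric on $M=G/K$, i.e. the $G$-invariant metric given by $-B|_{\mathfrak p\times\mathfrak p}$, and suppose that $g_B$ is Einstein, $\operatorname{Rc}(g_B)=\rho\, g_B$. Let $\mathcal{TT}^G$ be the space of $G$-invariant, divergence-free, traceless symmetric $2$-tensors on $(M,g_B)$, and assume $\mathcal{TT}^G\neq 0$ (i.e. $g_B$ is not, up to scaling, the only $G$-invariant metric). Denote by - $\lambda_{\mathfrak p}$ and $\lambda_{\mathfrak p}^{\max}$ the smallest and largest eigenvalues of the Lichnerowicz Laplacian $\Delta_L$ of $g_B$ on $\mathcal{TT}^G$; - $\lambda_\tau$ and $\lambda_\tau^{\max}$ the smallest and largest eigenvalues of the Casimir operator $\operatorname{Cas}_\tau=-\sum_i\tau(e_i)^2$ on the space $\operatorname{Sym}_0(\mathfrak g)$ of traceless $B$-symmetric endomorphisms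 of $\mathfrak g$, where $\tau(X)A=[\operatorname{ad}X,A]$ and $\{e_i\}$ is a $(-B)$-orthonormal basis of $\mathfrak g$; - $\mathcal M_1^G$ the space of $G$-invariant metrics on $M$ with the same volume as $g_B$, on which the scalar curvature $\operatorname{Sc}$ is a real-valued function. The metric $g_B$ is called $G$-stable if the second variation $\operatorname{Sc}''_{g_B}$ of $\operatorname{Sc}|_{\mathcal M_1^G}$ is negative definite on $\mathcal{TT}^G$, $G$-semistable if it is negative semidefinite there, $G$-unstable if it is not $G$-semistable, and $G$-neutrally stable if it is $G$-semistable and $\operatorname{Sc}''_{g_B}|_{\mathcal{TT}^G}$ has nonzero kernel. Then $\lambda_{\mathfrak p}$ and $\lambda_{\mathfrak p}^{\max}$ exist, and the following hold, where in (iii) and (iv) it is assumed that $\lambda_\tau>0$ (this is automatic if $\mathfrak g$ is simple). (i) If $\dim\mathfrak k<\dfrac{\dim\mathfrak g\,(\lambda_\tau-1)}{2\lambda_\tau^{\max}}$, then $2\rho<\lambda_{\mathfrak p}$ and $g_B$ is $G$-stable. (ii) If $\dim\mathfrak k=\dfrac{\dim\mathfrak g\,(\lambda_\tau-1)}{2\lambda_\tau^{\max}}$,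 then $2\rho\le\lambda_{\mathfrak p}$ and $g_B$ is $G$-semistable. (iii) If $\dim\mathfrak k>\dfrac{\dim\mathfrak g\,(\lambda_\tau^{\max}-1)}{2\lambda_\tau}$, then $\lambda_{\mathfrak p}^{\max}<2\rho$, and $g_B$ is $G$-unstable and a local minimum of $\operatorname{Sc}|_{\mathcal M_1^G}$. (iv) If $\dim\mathfrak k=\dfrac{\dim\mathfrak g\,(\lambda_\tau^{\max}-1)}{2\lambda_\tau}$, then $\lambda_{\mathfrak p}^{\max}\le 2\rho$. In particular, $g_B$ is $G$-unstable if $\lambda_{\mathfrak p}<\lambda_{\mathfrak p}^{\max}$; and if $\lambda_{\mathfrak p}=\lambda_{\mathfrak p}^{\max}$, then $g_B$ is either $G$-unstable and a local minimum of $\operatorname{Sc}|_{\mathcal M_1^G}$, or $G$-neutrally stable. -/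

import Mathlib

open scoped Manifold ContDiff

noncomputable section

/-! ## Inner products on a finite-dimensional real vector space -/

/-- An inner product on a real vector space, as a symmetric positive definite bilinear form. -/
structure InnerProd (V : Type*) [AddCommGroup V] [Module ℝ V] where
  form : V →ₗ[ℝ] V →ₗ[ℝ] ℝ
  symm : ∀ X Y, form X Y = form Y X
  pos : ∀ X, X ≠ 0 → 0 < form X X

namespace InnerProd

section Basic

variable {V : Type*} [AddCommGroup V] [Module ℝ V]

/-- The set of inner products carries the topology of pointwise convergence; when `V` is
finite-dimensional this is the topology induced by the vector space of bilinear forms. -/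
instance : TopologicalSpace (InnerProd V) :=
  TopologicalSpace.induced (fun h => fun (X Y : V) => h.form X Y) inferInstance

theorem form_injective (h : InnerProd V) : Function.Injective h.form := by
  rw [injective_iff_map_eq_zero]
  intro X hX
  by_contra hne
  have := h.pos X hne
  rw [hX] at this
  simp at this

/-- The inner product obtained by pulling back along an injective linear map. -/
def pullback (h : InnerProd V) (P : V →ₗ[ℝ] V) (hP : Function.Injective P) : InnerProd V where
  form := h.form.compl₁₂ P P
  symm X Y := h.symm (P X) (P Y)
  pos X hX := h.pos (P X) (fun h0 => hX (hP (by rw [h0, map_zero])))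

end Basic

section FiniteDim

variable {V : Type*} [AddCommGroup V] [Module ℝ V] [FiniteDimensional ℝ V]

/-- The musical isomorphism `V* ≃ V` : `h(sharp f, Y) = f Y`. -/
def sharp (h : InnerProd V) : Module.Dual ℝ V ≃ₗ[ℝ] V :=
  (LinearEquiv.ofInjectiveOfFinrankEq h.form h.form_injective
    Subspace.dual_finrank_eq.symm).symm

theorem form_sharp (h : InnerProd V) (f : Module.Dual ℝ V) (Y : V) :
    h.form (h.sharp f) Y = f Y := by
  have : h.form (h.sharp f) = f := (LinearEquiv.ofInjectiveOfFinrankEq h.form h.form_injective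
    Subspace.dual_finrank_eq.symm).apply_symm_apply f
  rw [this]

theorem exists_orthonormal (h : InnerProd V) :
    ∃ e : Module.Basis (Fin (Module.finrank ℝ V)) ℝ V,
      ∀ i j, h.form (e i) (e j) = if i = j then 1 else 0 := by
  obtain ⟨v, hv⟩ := LinearMap.BilinForm.exists_orthogonal_basis
    (B := h.form) ⟨fun X Y => h.symm X Y⟩
  have hp : ∀ i, 0 < h.form (v i) (v i) := fun i => h.pos _ (v.ne_zero i)
  refine ⟨v.isUnitSMul (w := fun i => (√(h.form (v i) (v i)))⁻¹)
    (fun i => (inv_ne_zero (Real.sqrt_pos.2 (hp i)).ne').isUnit), fun i j => ?_⟩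
  simp only [Module.Basis.isUnitSMul_apply, map_smul, LinearMap.smul_apply, smul_eq_mul]
  split_ifs with hij
  · subst hij
    have h1 := Real.mul_self_sqrt (hp i).le
    have h2 := (Real.sqrt_pos.2 (hp i)).ne'
    field_simp
    rw [sq, h1]
  · have : h.form (v i) (v j) = 0 := hv hij
    simp [this]

/-- An `h`-orthonormal basis. -/
def onb (h : InnerProd V) : Module.Basis (Fin (Module.finrank ℝ V)) ℝ V :=
  h.exists_orthonormal.choose

theorem onb_spec (h : InnerProd V) (i j : Fin (Module.finrank ℝ V)) :
    h.form (h.onb i) (h.onb j) = if i = j then 1 else 0 :=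
  h.exists_orthonormal.choose_spec i j

/-- The operator `exp A` on `V`, through the matrix of `A`. -/
def expOp (h : InnerProd V) (A : Module.End ℝ V) : Module.End ℝ V :=
  Matrix.toLin h.onb h.onb (NormedSpace.exp (LinearMap.toMatrix h.onb h.onb A))

theorem expOp_injective (h : InnerProd V) (A : Module.End ℝ V) :
    Function.Injective (h.expOp A) := by
  obtain ⟨u, hu⟩ := Matrix.isUnit_exp (LinearMap.toMatrix h.onb h.onb A)
  intro X Y hXY
  have hc : ∀ W, Matrix.toLin h.onb h.onb (↑u⁻¹ : Matrix _ _ ℝ) (h.expOp A W) = W := by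
    intro W
    rw [expOp, ← hu, ← LinearMap.comp_apply, ← Matrix.toLin_mul, Units.inv_mul, Matrix.toLin_one,
      LinearMap.id_apply]
  rw [← hc X, hXY, hc Y]

/-- The curve `t ↦ h(e^{tA/2} ·, e^{tA/2} ·)`, which is `t ↦ h(e^{tA} ·, ·)` for `h`-symmetric
`A`. It starts at `h` with velocity `h(A ·, ·)`; for traceless `A` its volume is constant. -/
def expCurve (h : InnerProd V) (A : Module.End ℝ V) (t : ℝ) : InnerProd V :=
  h.pullback (h.expOp ((t / 2) • A)) (h.expOp_injective _)

/-- `h'` has the same volume element as `h` : the operator `P` with `h' = h(P ·, ·)` has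
determinant one. -/
def SameVolume (h h' : InnerProd V) : Prop :=
  LinearMap.det (h.sharp.toLinearMap ∘ₗ h'.form) = 1

end FiniteDim

end InnerProd

/-! ## Reductive decompositions and the curvature of invariant metrics -/

/-- A reductive decomposition `𝔤 = 𝔨 ⊕ 𝔭` for a homogeneous space `G/K`, where `Φ` is the set
`Ad(K)` of operators on `𝔤`. The space `𝔭` is the tangent space of `G/K` at the base point. -/
structure ReductiveDecomp {𝔤 : Type*} [LieRing 𝔤] [LieAlgebra ℝ 𝔤] (𝔨 : LieSubalgebra ℝ 𝔤)
    (Φ : Set (𝔤 →ₗ[ℝ] 𝔤)) where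
  𝔭 : Submodule ℝ 𝔤
  isCompl : IsCompl 𝔨.toSubmodule 𝔭
  map_mem : ∀ φ ∈ Φ, ∀ X ∈ 𝔭, φ X ∈ 𝔭

namespace ReductiveDecomp

variable {𝔤 : Type*} [LieRing 𝔤] [LieAlgebra ℝ 𝔤] [FiniteDimensional ℝ 𝔤]
  {𝔨 : LieSubalgebra ℝ 𝔤} {Φ : Set (𝔤 →ₗ[ℝ] 𝔤)}

/-- The projection of `𝔤` onto `𝔭` along `𝔨`. -/
def projP (D : ReductiveDecomp 𝔨 Φ) : 𝔤 →ₗ[ℝ] D.𝔭 :=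
  Submodule.projectionOnto D.𝔭 𝔨.toSubmodule D.isCompl.symm

/-- The projection of `𝔤` onto `𝔨` along `𝔭`. -/
def projK (D : ReductiveDecomp 𝔨 Φ) : 𝔤 →ₗ[ℝ] 𝔨.toSubmodule :=
  Submodule.projectionOnto 𝔨.toSubmodule D.𝔭 D.isCompl

/-- The isotropy representation of `K` on `𝔭`. -/
def isotropy (D : ReductiveDecomp 𝔨 Φ) (φ : 𝔤 →ₗ[ℝ] 𝔤) (hφ : φ ∈ Φ) : Module.End ℝ D.𝔭 :=
  φ.restrict (D.map_mem φ hφ)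

/-- The bilinear map `(X, Y) ↦ [X, Y]_𝔭` on `𝔭`. -/
def brP (D : ReductiveDecomp 𝔨 Φ) : D.𝔭 →ₗ[ℝ] D.𝔭 →ₗ[ℝ] D.𝔭 :=
  LinearMap.mk₂ ℝ (fun X Y => D.projP ⁅(X : 𝔤), (Y : 𝔤)⁆)
    (by intros; simp [add_lie]) (by intros; simp [smul_lie])
    (by intros; simp [lie_add]) (by intros; simp [lie_smul])

/-- The trilinear map `(X, Y, Z) ↦ [[X, Y]_𝔨, Z]` on `𝔭`. -/
def brK (D : ReductiveDecomp 𝔨 Φ) (X Y : D.𝔭) : Module.End ℝ D.𝔭 :=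
  D.projP ∘ₗ LieAlgebra.ad ℝ 𝔤 (D.projK ⁅(X : 𝔤), (Y : 𝔤)⁆ : 𝔤) ∘ₗ D.𝔭.subtype

/-- `Ad(K)`-invariant inner products on `𝔭`, i.e. `G`-invariant Riemannian metrics on `G/K`. -/
def IsInvariant (D : ReductiveDecomp 𝔨 Φ) (h : InnerProd D.𝔭) : Prop :=
  ∀ φ, ∀ hφ : φ ∈ Φ, ∀ X Y, h.form (D.isotropy φ hφ X) (D.isotropy φ hφ Y) = h.form X Y

/-- The Levi-Civita connection of the invariant metric `h`, as the bilinear map `Λ` on `𝔭` which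
is given by the Koszul formula
`2 h(Λ(X)Y, Z) = h([X,Y]_𝔭, Z) - h([Y,Z]_𝔭, X) + h([Z,X]_𝔭, Y)`.
If `S` is an invariant tensor field on `G/K`, then `(∇_X S)_o = Λ(X) · S_o`. -/
def leviCivita (D : ReductiveDecomp 𝔨 Φ) (h : InnerProd D.𝔭) : D.𝔭 →ₗ[ℝ] Module.End ℝ D.𝔭 :=
  LinearMap.mk₂ ℝ (fun X Y => h.sharp ((1 / 2 : ℝ) •
      (h.form (D.brP X Y) - h.form X ∘ₗ D.brP Y - h.form Y ∘ₗ D.brP X)))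
    (by
      intro X X' Y
      rw [← map_add, ← smul_add]
      congr 2
      ext Z
      simp
      ring)
    (by
      intro c X Y
      rw [← map_smul, smul_comm]
      congr 2
      ext Z
      simp
      ring)
    (by
      intro X Y Y'
      rw [← map_add, ← smul_add]
      congr 2
      ext Z
      simp
      ring)
    (by
      intro c X Y
      rw [← map_smul, smul_comm]
      congr 2
      ext Z
      simp
      ring)

theorem koszul (D : ReductiveDecomp 𝔨 Φ) (h : InnerProd D.𝔭) (X Y Z : D.𝔭) :
    2 * h.form (D.leviCivita h X Y) Z =
      h.form (D.brP X Y) Z - h.form (D.brP Y Z) X + h.form (D.brP Z X) Y := by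
  have hs : D.brP Z X = -D.brP X Z := by
    simp only [brP, LinearMap.mk₂_apply, ← map_neg, lie_skew]
  simp only [leviCivita, LinearMap.mk₂_apply, InnerProd.form_sharp, LinearMap.smul_apply,
    LinearMap.sub_apply, LinearMap.comp_apply, hs, map_neg, LinearMap.neg_apply, smul_eq_mul]
  rw [h.symm X, h.symm Y]
  ring

/-- The connection `Λ` is metric. -/
theorem leviCivita_metric (D : ReductiveDecomp 𝔨 Φ) (h : InnerProd D.𝔭) (X Y Z : D.𝔭) :
    h.form (D.leviCivita h X Y) Z + h.form Y (D.leviCivita h X Z) = 0 := by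
  have hs : ∀ U W, D.brP U W = -D.brP W U := by
    intro U W
    simp only [brP, LinearMap.mk₂_apply, ← map_neg, lie_skew]
  have h1 := D.koszul h X Y Z
  have h2 := D.koszul h X Z Y
  rw [hs Z Y, hs Y X] at h2
  rw [hs Z X] at h1
  simp only [map_neg, LinearMap.neg_apply] at h1 h2
  rw [h.symm Y]
  linarith

/-- The connection `Λ` is torsion-free. -/
theorem leviCivita_torsion (D : ReductiveDecomp 𝔨 Φ) (h : InnerProd D.𝔭) (X Y : D.𝔭) :
    D.leviCivita h X Y - D.leviCivita h Y X = D.brP X Y := by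
  have hs : ∀ U W, D.brP U W = -D.brP W U := by
    intro U W
    simp only [brP, LinearMap.mk₂_apply, ← map_neg, lie_skew]
  apply h.form_injective
  ext Z
  have h1 := D.koszul h X Y Z
  have h2 := D.koszul h Y X Z
  rw [hs Y X, hs X Z] at h2
  rw [hs Y Z] at h1
  simp only [map_neg, map_sub, LinearMap.neg_apply, LinearMap.sub_apply] at h1 h2 ⊢
  linarith

/-- The Riemann curvature tensor at the base point,
`R(X,Y) = [Λ(X), Λ(Y)] - Λ([X,Y]_𝔭) - ad([X,Y]_𝔨)`. -/
def curvature (D : ReductiveDecomp 𝔨 Φ) (h : InnerProd D.𝔭) :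
    D.𝔭 →ₗ[ℝ] D.𝔭 →ₗ[ℝ] Module.End ℝ D.𝔭 :=
  LinearMap.mk₂ ℝ (fun X Y =>
      D.leviCivita h X * D.leviCivita h Y - D.leviCivita h Y * D.leviCivita h X
      - D.leviCivita h (D.brP X Y) - D.brK X Y)
    (by intros; ext Z; simp [brK, add_lie]; abel)
    (by intros; ext Z; simp [brK, smul_lie, smul_sub])
    (by intros; ext Z; simp [brK, lie_add]; abel)
    (by intros; ext Z; simp [brK, lie_smul, smul_sub])

/-- The Ricci tensor `Rc(Y,Z) = tr(X ↦ R(X,Y)Z)`. -/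
def ricci (D : ReductiveDecomp 𝔨 Φ) (h : InnerProd D.𝔭) : D.𝔭 →ₗ[ℝ] D.𝔭 →ₗ[ℝ] ℝ :=
  LinearMap.mk₂ ℝ (fun Y Z => LinearMap.trace ℝ D.𝔭 (((D.curvature h).flip Y).flip Z))
    (by
      intro Y Y' Z
      rw [← map_add]
      congr 1
      ext X
      simp)
    (by
      intro c Y Z
      rw [← map_smul]
      congr 1
      ext X
      simp)
    (by
      intro Y Z Z'
      rw [← map_add]
      congr 1
      ext X
      simp)
    (by
      intro c Y Z
      rw [← map_smul]
      congr 1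
      ext X
      simp)

/-- The Ricci operator: `h(Ric X, Y) = Rc(X, Y)`. -/
def ricciOp (D : ReductiveDecomp 𝔨 Φ) (h : InnerProd D.𝔭) : Module.End ℝ D.𝔭 :=
  h.sharp.toLinearMap ∘ₗ D.ricci h

/-- The scalar curvature (a constant function on `G/K`). -/
def scal (D : ReductiveDecomp 𝔨 Φ) (h : InnerProd D.𝔭) : ℝ :=
  LinearMap.trace ℝ D.𝔭 (D.ricciOp h)

/-- The metric `h` is Einstein with Einstein constant `ρ` : `Rc(h) = ρ h`. -/
def IsEinstein (D : ReductiveDecomp 𝔨 Φ) (h : InnerProd D.𝔭) (ρ : ℝ) : Prop :=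
  ∀ X Y, D.ricci h X Y = ρ * h.form X Y

/-! ### Invariant symmetric `2`-tensors, written `T = h(A ·, ·)` -/

/-- `Sym(𝔭)^K` : the `h`-symmetric operators on `𝔭` that commute with `Ad(K)`. -/
def symK (D : ReductiveDecomp 𝔨 Φ) (h : InnerProd D.𝔭) : Set (Module.End ℝ D.𝔭) :=
  {A | (∀ X Y, h.form (A X) Y = h.form X (A Y)) ∧
    ∀ φ, ∀ hφ : φ ∈ Φ, A ∘ₗ D.isotropy φ hφ = D.isotropy φ hφ ∘ₗ A}

/-- The covariant derivative `∇_X T` of the invariant tensor `T = h(A ·, ·)`, as an operator. -/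
def nabla (D : ReductiveDecomp 𝔨 Φ) (h : InnerProd D.𝔭) (X : D.𝔭) (A : Module.End ℝ D.𝔭) :
    Module.End ℝ D.𝔭 :=
  ⁅D.leviCivita h X, A⁆

/-- The second covariant derivative `∇²_{X,Y} T = ∇_X (∇_Y T) - ∇_{∇_X Y} T`. -/
def nabla₂ (D : ReductiveDecomp 𝔨 Φ) (h : InnerProd D.𝔭) (X Y : D.𝔭) (A : Module.End ℝ D.𝔭) :
    Module.End ℝ D.𝔭 :=
  D.nabla h X (D.nabla h Y A) - D.nabla h (D.leviCivita h X Y) A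

/-- The divergence (up to sign) of `T = h(A ·, ·)`, as a vector: `∑ (∇_{e_i} T)(e_i, ·)`. -/
def divergence (D : ReductiveDecomp 𝔨 Φ) (h : InnerProd D.𝔭) (A : Module.End ℝ D.𝔭) : D.𝔭 :=
  ∑ i, D.nabla h (h.onb i) A (h.onb i)

/-- The `G`-invariant TT-tensors: traceless and divergence-free. -/
def ttG (D : ReductiveDecomp 𝔨 Φ) (h : InnerProd D.𝔭) : Set (Module.End ℝ D.𝔭) :=
  {A | A ∈ D.symK h ∧ LinearMap.trace ℝ D.𝔭 A = 0 ∧ D.divergence h A = 0}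

/-- The curvature term `(R° T)(X,Y) = ∑ T(R(e_i, X)Y, e_i)`, as an operator:
`R° A = ∑ R(·, e_i) A e_i`. -/
def curvTerm (D : ReductiveDecomp 𝔨 Φ) (h : InnerProd D.𝔭) (A : Module.End ℝ D.𝔭) :
    Module.End ℝ D.𝔭 :=
  ∑ i, ((D.curvature h).flip (h.onb i)).flip (A (h.onb i))

/-- The Lichnerowicz Laplacian `Δ_L T = ∇*∇ T + Ric ∘ T + T ∘ Ric - 2 R° T` on invariant
symmetric `2`-tensors, as the operator `A ↦ L_𝔭 A`. -/
def lichnerowicz (D : ReductiveDecomp 𝔨 Φ) (h : InnerProd D.𝔭) (A : Module.End ℝ D.𝔭) :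
    Module.End ℝ D.𝔭 :=
  -(∑ i, D.nabla₂ h (h.onb i) (h.onb i) A) + D.ricciOp h ∘ₗ A + A ∘ₗ D.ricciOp h
    - (2 : ℝ) • D.curvTerm h A

/-- The eigenvalues of the Lichnerowicz Laplacian on the `G`-invariant TT-tensors. -/
def spec (D : ReductiveDecomp 𝔨 Φ) (h : InnerProd D.𝔭) : Set ℝ :=
  {μ | ∃ A ∈ D.ttG h, A ≠ 0 ∧ D.lichnerowicz h A = μ • A}

/-! ### Stability types -/

/-- `ℳ₁^G` : the `G`-invariant metrics with the same volume as `h`. -/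
def invMetrics₁ (D : ReductiveDecomp 𝔨 Φ) (h : InnerProd D.𝔭) : Set (InnerProd D.𝔭) :=
  {h' | D.IsInvariant h' ∧ h.SameVolume h'}

/-- The quadratic form of the second variation at an Einstein metric `h` of the scalar curvature
on the metrics of fixed volume, in the direction of the TT-tensor `h(A ·, ·)` : the second
derivative along the curve `h(e^{tA} ·, ·)`, which has constant volume. -/
def scalHess (D : ReductiveDecomp 𝔨 Φ) (h : InnerProd D.𝔭) (A : Module.End ℝ D.𝔭) : ℝ :=
  iteratedDeriv 2 (fun t => D.scal (h.expCurve A t)) 0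

/-- The second variation is negative definite on the `G`-invariant TT-tensors. -/
def IsGStable (D : ReductiveDecomp 𝔨 Φ) (h : InnerProd D.𝔭) : Prop :=
  ∀ A ∈ D.ttG h, A ≠ 0 → D.scalHess h A < 0

/-- The second variation is negative semidefinite on the `G`-invariant TT-tensors. -/
def IsGSemistable (D : ReductiveDecomp 𝔨 Φ) (h : InnerProd D.𝔭) : Prop :=
  ∀ A ∈ D.ttG h, D.scalHess h A ≤ 0

def IsGUnstable (D : ReductiveDecomp 𝔨 Φ) (h : InnerProd D.𝔭) : Prop :=
  ¬ D.IsGSemistable h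

/-- The second variation is nonpositive with nonzero kernel. -/
def IsGNeutrallyStable (D : ReductiveDecomp 𝔨 Φ) (h : InnerProd D.𝔭) : Prop :=
  D.IsGSemistable h ∧ ∃ A ∈ D.ttG h, A ≠ 0 ∧ D.scalHess h A = 0

/-- `h` is a local minimum of the scalar curvature on `ℳ₁^G`. -/
def IsScalLocalMin (D : ReductiveDecomp 𝔨 Φ) (h : InnerProd D.𝔭) : Prop :=
  IsLocalMinOn D.scal (D.invMetrics₁ h) h

end ReductiveDecomp

/-! ## The Casimir operator on `Sym(𝔤)` -/

section Casimir

variable {𝔤 : Type*} [LieRing 𝔤] [LieAlgebra ℝ 𝔤]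

/-- `Cas_τ = -∑ τ(e_i)²`, where `τ(X)A = [ad X, A]`. -/
def casimirTau {n : ℕ} (e : Module.Basis (Fin n) ℝ 𝔤) (A : Module.End ℝ 𝔤) : Module.End ℝ 𝔤 :=
  -∑ i, ⁅LieAlgebra.ad ℝ 𝔤 (e i), ⁅LieAlgebra.ad ℝ 𝔤 (e i), A⁆⁆

/-- `Sym₀(𝔤)` : the traceless operators that are symmetric for the Killing form. -/
def symZero (𝔤 : Type*) [LieRing 𝔤] [LieAlgebra ℝ 𝔤] : Set (Module.End ℝ 𝔤) :=
  {A | (∀ X Y, killingForm ℝ 𝔤 (A X) Y = killingForm ℝ 𝔤 X (A Y)) ∧ LinearMap.trace ℝ 𝔤 A = 0}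

/-- The eigenvalues of `Cas_τ` on `Sym₀(𝔤)`. -/
def casimirSpec {n : ℕ} (e : Module.Basis (Fin n) ℝ 𝔤) : Set ℝ :=
  {μ | ∃ A ∈ symZero 𝔤, A ≠ 0 ∧ casimirTau e A = μ • A}

end Casimir

/-! ## Lie groups -/

section LieGroups

variable {E : Type*} [NormedAddCommGroup E] [NormedSpace ℝ E] [FiniteDimensional ℝ E]
  {G : Type*} [TopologicalSpace G] [ChartedSpace E G] [Group G] [LieGroup 𝓘(ℝ, E) ∞ G]

/-- A smooth Lie group has the regularity that Mathlib asks for to form the Lie algebra. -/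
instance instLieGroupMinSmoothness : LieGroup 𝓘(ℝ, E) (minSmoothness ℝ 3) G :=
  LieGroup.of_le (n := ∞) (by
    rw [minSmoothness_of_isRCLikeNormedField]
    exact ENat.LEInfty.out)

instance instFiniteDimensionalGroupLieAlgebra :
    FiniteDimensional ℝ (GroupLieAlgebra 𝓘(ℝ, E) G) :=
  inferInstanceAs (FiniteDimensional ℝ E)

/-- The adjoint representation of a Lie group: the differential of conjugation at the identity. -/
def adjointRep (k : G) : GroupLieAlgebra 𝓘(ℝ, E) G →ₗ[ℝ] GroupLieAlgebra 𝓘(ℝ, E) G :=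
  (show E →L[ℝ] E from mfderiv 𝓘(ℝ, E) 𝓘(ℝ, E) (fun x : G => k * x * k⁻¹) 1).toLinearMap

/-- The set `Ad(K)`. -/
def adjointSet (K : Subgroup G) :
    Set (GroupLieAlgebra 𝓘(ℝ, E) G →ₗ[ℝ] GroupLieAlgebra 𝓘(ℝ, E) G) :=
  {φ | ∃ k ∈ K, φ = adjointRep k}

/-- The Lie algebra of a closed subgroup `K` of `G` : the set of initial velocities of the
one-parameter subgroups of `G` that lie in `K`. For closed `K` this set is already a Lie
subalgebra, so that taking the span adds nothing. -/
def subgroupLieAlgebra (K : Subgroup G) : LieSubalgebra ℝ (GroupLieAlgebra 𝓘(ℝ, E) G) :=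
  LieSubalgebra.lieSpan ℝ (GroupLieAlgebra 𝓘(ℝ, E) G)
    {X | ∃ γ : ℝ → G, ContMDiff 𝓘(ℝ, ℝ) 𝓘(ℝ, E) ∞ γ ∧ (∀ s t, γ (s + t) = γ s * γ t) ∧
      (∀ t, γ t ∈ K) ∧
      X = (show E from mfderiv 𝓘(ℝ, ℝ) 𝓘(ℝ, E) γ 0 (1 : ℝ))}

end LieGroups

end

/-! The standard metric is naturally reductive, so its Levi-Civita connection is half the
`𝔭`-bracket. If the metric is also Einstein, the Ricci and curvature terms of the Lichnerowicz
Laplacian combine, and on invariant tensors it becomes the Casimir-type operator `A ↦ -½ ∑ [ad_𝔭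
e_i, [ad_𝔭 e_i, A]]` (`lichnerowicz_eq`). This operator is compared with `Cas_τ` through block test
operators on `𝔤 = 𝔨 ⊕ 𝔭` that are a scalar on `𝔨` (`sum_adaptedBasis`). Write `m`, `M` for the
extreme eigenvalues of `Cas_τ`, and use the norm `|A|² = tr A²`. Extending a TT-tensor `A` by zero
on `𝔨` gives `⟨Cas_τ A, A⟩ = 2⟨Δ_L A, A⟩ + (4ρ - 1)|A|²`, so every eigenvalue `μ` of `Δ_L` satisfies
`m ≤ 2μ + 4ρ - 1 ≤ M` (`casimirP_bounds`). The operator equal to `dim 𝔭` on `𝔨` and `-dim 𝔨` on `𝔭`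
gives `m dim 𝔨 ≤ (4ρ - 1) dim 𝔤 ≤ M dim 𝔨` (`einstein_constant_bounds`). Eliminating `4ρ - 1`
between the two turns each condition on `dim 𝔨` into a comparison of the spectrum with `2ρ`. This
comparison decides the stability type. In an eigenbasis of `A` the scalar curvature along `h(e^{tA}
·, ·)` is an explicit sum of exponentials, with second derivative `ρ|A|² - ½⟨Δ_L A, A⟩`
(`scalHess_eq`). If all eigenvalues lie below `2ρ`, a Taylor estimate for the same exponentials
gives the local minimum (`isScalLocalMin`): near `gB`, every invariant metric of the same volume is
`gB(e^A ·, ·)` with `A` a TT-tensor. The Lie group enters only through the algebraic package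
`IsStandard`: `Ad(K)` acts by automorphisms, preserves the Killing form, and its commutant commutes
with `ad(𝔨)`. These facts follow from the second-order expansion of the multiplication in a chart at
the identity. -/

noncomputable section

/-! ### Orthonormal bases, symmetric operators and Rayleigh quotients. -/

namespace InnerProd

variable {V : Type*} [AddCommGroup V] [Module ℝ V]
  {ι κ : Type*} [Fintype ι] [DecidableEq ι] [Fintype κ] [DecidableEq κ]

/-- A basis is orthonormal for an inner product. -/
def IsOrthonormal (h : InnerProd V) (v : Module.Basis ι ℝ V) : Prop :=
  ∀ i j, h.form (v i) (v j) = if i = j then 1 else 0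

theorem onb_isOrthonormal [FiniteDimensional ℝ V] (h : InnerProd V) : h.IsOrthonormal h.onb :=
  h.onb_spec

namespace IsOrthonormal

variable {h : InnerProd V} {v : Module.Basis ι ℝ V} {w : Module.Basis κ ℝ V}

theorem repr_apply (hv : h.IsOrthonormal v) (X : V) (i : ι) : v.repr X i = h.form X (v i) := by
  have e : h.form X (v i) = h.form (∑ j, v.repr X j • v j) (v i) := by rw [v.sum_repr X]
  rw [e]
  simp only [map_sum, map_smul, LinearMap.sum_apply, LinearMap.smul_apply, hv _ i, smul_eq_mul,
    mul_ite, mul_one, mul_zero, Finset.sum_ite_eq', Finset.mem_univ, if_true]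

theorem sum_form_smul (hv : h.IsOrthonormal v) (X : V) : ∑ i, h.form X (v i) • v i = X := by
  conv_rhs => rw [← v.sum_repr X]
  simp [hv.repr_apply]

theorem form_eq_sum (hv : h.IsOrthonormal v) (X Y : V) :
    h.form X Y = ∑ i, h.form X (v i) * h.form Y (v i) := by
  conv_lhs => rw [← hv.sum_form_smul X]
  simp [map_sum, LinearMap.sum_apply, h.symm Y]

/-- The trace of a bilinear map does not depend on the orthonormal basis. This moves sums from the
fixed basis `onb` of the definitions to a basis adapted to the tensor at hand. -/
theorem sum_bilin_eq {M : Type*} [AddCommGroup M] [Module ℝ M] (hv : h.IsOrthonormal v)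
    (hw : h.IsOrthonormal w) (F : V →ₗ[ℝ] V →ₗ[ℝ] M) :
    ∑ i, F (v i) (v i) = ∑ j, F (w j) (w j) := by
  have h1 : ∀ i, F (v i) (v i) =
      ∑ j, ∑ k, (h.form (v i) (w j) * h.form (v i) (w k)) • F (w j) (w k) := by
    intro i
    conv_lhs => rw [← hw.sum_form_smul (v i)]
    simp only [map_sum, LinearMap.sum_apply, map_smul, LinearMap.smul_apply, smul_smul,
      Finset.smul_sum]
    rw [Finset.sum_comm]
    simp only [mul_comm]
  simp only [h1]
  rw [Finset.sum_comm]
  refine Finset.sum_congr rfl fun j _ => ?_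
  rw [Finset.sum_comm]
  simp only [← Finset.sum_smul]
  have h2 : ∀ k, ∑ i, h.form (v i) (w j) * h.form (v i) (w k) = if j = k then 1 else 0 := by
    intro k
    rw [← hw j k, hv.form_eq_sum]
    simp only [h.symm (w _) (v _)]
  simp [h2]

theorem trace_eq (hv : h.IsOrthonormal v) (T : Module.End ℝ V) :
    LinearMap.trace ℝ V T = ∑ i, h.form (T (v i)) (v i) := by
  rw [LinearMap.trace_eq_matrix_trace ℝ v, Matrix.trace]
  simp [LinearMap.toMatrix_apply, hv.repr_apply]

theorem ext (hv : h.IsOrthonormal v) {X Y : V} (hXY : ∀ i, h.form X (v i) = h.form Y (v i)) :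
    X = Y := by
  rw [← hv.sum_form_smul X, ← hv.sum_form_smul Y]
  simp [hXY]

omit [Fintype ι] in
theorem map (hv : h.IsOrthonormal v) (f : V ≃ₗ[ℝ] V)
    (hf : ∀ X Y, h.form (f X) (f Y) = h.form X Y) : h.IsOrthonormal (v.map f) := by
  intro i j
  simp [hf, hv i j]

omit [Fintype ι] in
theorem pos_coeff {p : ι → ℝ} {h' : InnerProd V}
    (hp : ∀ i j, h'.form (v i) (v j) = if i = j then p i else 0) (i : ι) : 0 < p i := by
  have := h'.pos (v i) (v.ne_zero i)
  rwa [hp, if_pos rfl] at this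

end IsOrthonormal

theorem form_self_nonneg (h : InnerProd V) (X : V) : 0 ≤ h.form X X := by
  by_cases hX : X = 0
  · simp [hX]
  · exact (h.pos X hX).le

theorem form_self_eq_zero (h : InnerProd V) {X : V} (hX : h.form X X = 0) : X = 0 := by
  by_contra hne
  exact (h.pos X hne).ne' hX

/-- The operator is symmetric for the inner product. -/
def IsSymm (h : InnerProd V) (A : Module.End ℝ V) : Prop :=
  ∀ X Y, h.form (A X) Y = h.form X (A Y)

theorem IsSymm.exists_eigenbasis [FiniteDimensional ℝ V] {h : InnerProd V} {A : Module.End ℝ V}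
    (hA : h.IsSymm A) : ∃ (v : Module.Basis (Fin (Module.finrank ℝ V)) ℝ V)
      (a : Fin (Module.finrank ℝ V) → ℝ), h.IsOrthonormal v ∧ ∀ i, A (v i) = a i • v i := by
  -- The form becomes a local inner product space structure, so that the spectral theorem for
  -- symmetric operators applies.
  let core : InnerProductSpace.Core ℝ V :=
    { inner := fun x y => h.form x y
      conj_inner_symm := fun x y => by simp [h.symm y x]
      re_inner_nonneg := fun x => by simpa using h.form_self_nonneg x
      definite := fun x hx => h.form_self_eq_zero hx
      add_left := fun x y z => by simp
      smul_left := fun x y r => by simp }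
  let _ : NormedAddCommGroup V := core.toNormedAddCommGroup
  let _ : InnerProductSpace ℝ V := InnerProductSpace.ofCore core.toCore
  have hs : A.IsSymmetric := fun X Y => hA X Y
  refine ⟨(hs.eigenvectorBasis rfl).toBasis, hs.eigenvalues rfl, fun i j => ?_, fun i => ?_⟩
  · have := orthonormal_iff_ite.1 (hs.eigenvectorBasis rfl).orthonormal i j
    rw [OrthonormalBasis.coe_toBasis]
    exact this
  · rw [OrthonormalBasis.coe_toBasis]
    exact hs.apply_eigenvectorBasis rfl i

/-- The trace form `(A, B) ↦ tr(AB)` on a space of symmetric operators. -/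
def traceProd [FiniteDimensional ℝ V] (h : InnerProd V) (W : Submodule ℝ (Module.End ℝ V))
    (hW : ∀ A ∈ W, h.IsSymm A) : InnerProd W where
  form := (LinearMap.mul ℝ (Module.End ℝ V)).compr₂ (LinearMap.trace ℝ V) |>.compl₁₂
    W.subtype W.subtype
  symm A B := LinearMap.trace_mul_comm ℝ (A : Module.End ℝ V) B
  pos A hA := by
    have hs := hW A A.2
    have e : LinearMap.trace ℝ V ((A : Module.End ℝ V) * A) =
        ∑ i, h.form ((A : Module.End ℝ V) (h.onb i)) ((A : Module.End ℝ V) (h.onb i)) := by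
      rw [h.onb_isOrthonormal.trace_eq]
      exact Finset.sum_congr rfl fun i _ => hs _ _
    refine lt_of_le_of_ne ?_ fun h0 => hA ?_
    · exact (Finset.sum_nonneg fun i _ => h.form_self_nonneg _).trans_eq e.symm
    · have h1 := e.symm.trans h0.symm
      rw [Finset.sum_eq_zero_iff_of_nonneg fun i _ => h.form_self_nonneg _] at h1
      apply Subtype.ext
      exact h.onb.ext fun i => by simpa using h.form_self_eq_zero (h1 i (Finset.mem_univ i))

theorem traceProd_apply [FiniteDimensional ℝ V] (h : InnerProd V)
    (W : Submodule ℝ (Module.End ℝ V)) (hW : ∀ A ∈ W, h.IsSymm A) (A B : W) :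
    (h.traceProd W hW).form A B = LinearMap.trace ℝ V ((A : Module.End ℝ V) * B) := rfl

section Spectrum

variable [FiniteDimensional ℝ V] {h : InnerProd V} {T : Module.End ℝ V}

theorem exists_least_greatest_eigenvalue [Nontrivial V] (hT : h.IsSymm T) :
    ∃ m M : ℝ, IsLeast {μ | ∃ X, X ≠ 0 ∧ T X = μ • X} m ∧
      IsGreatest {μ | ∃ X, X ≠ 0 ∧ T X = μ • X} M := by
  obtain ⟨v, a, hv, ha⟩ := hT.exists_eigenbasis
  have hset : {μ | ∃ X, X ≠ 0 ∧ T X = μ • X} = Set.range a := by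
    ext μ
    constructor
    · rintro ⟨X, hX, hTX⟩
      have : ∃ i, h.form X (v i) ≠ 0 := by
        by_contra! h0
        exact hX (hv.ext fun i => by simp [h0 i])
      obtain ⟨i, hi⟩ := this
      refine ⟨i, ?_⟩
      have h1 := hT X (v i)
      rw [hTX, ha, map_smul, map_smul, LinearMap.smul_apply, smul_eq_mul, smul_eq_mul] at h1
      exact (mul_right_cancel₀ hi h1).symm
    · rintro ⟨i, rfl⟩
      exact ⟨v i, v.ne_zero i, ha i⟩
  rw [hset]
  have : Nonempty (Fin (Module.finrank ℝ V)) := Fin.pos_iff_nonempty.1 Module.finrank_pos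
  have hf := Set.finite_range a
  have hne := Set.range_nonempty a
  obtain ⟨m, hm, hm'⟩ := hf.exists_minimal hne
  obtain ⟨M, hM, hM'⟩ := hf.exists_maximal hne
  refine ⟨m, M, ⟨hm, fun x hx => ?_⟩, ⟨hM, fun x hx => ?_⟩⟩
  · rcases le_total m x with h1 | h1
    · exact h1
    · exact hm' hx h1
  · rcases le_total x M with h1 | h1
    · exact h1
    · exact hM' hx h1

theorem form_apply_self_bounds (hT : h.IsSymm T) {m M : ℝ}
    (hm : m ∈ lowerBounds {μ | ∃ X, X ≠ 0 ∧ T X = μ • X})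
    (hM : M ∈ upperBounds {μ | ∃ X, X ≠ 0 ∧ T X = μ • X}) (X : V) :
    m * h.form X X ≤ h.form (T X) X ∧ h.form (T X) X ≤ M * h.form X X := by
  obtain ⟨v, a, hv, ha⟩ := hT.exists_eigenbasis
  have h1 : h.form (T X) X = ∑ i, a i * (h.form X (v i) * h.form X (v i)) := by
    rw [hv.form_eq_sum]
    refine Finset.sum_congr rfl fun i _ => ?_
    rw [hT, ha, map_smul, smul_eq_mul, mul_assoc]
  have h2 := hv.form_eq_sum X X
  rw [h1, h2, Finset.mul_sum, Finset.mul_sum]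
  constructor <;> refine Finset.sum_le_sum fun i _ => ?_
  · exact mul_le_mul_of_nonneg_right (hm ⟨v i, v.ne_zero i, ha i⟩) (mul_self_nonneg _)
  · exact mul_le_mul_of_nonneg_right (hM ⟨v i, v.ne_zero i, ha i⟩) (mul_self_nonneg _)

end Spectrum

/-! ### Double commutators with a skew operator. -/

section DoubleCommutator

variable {h : InnerProd V} {v : Module.Basis ι ℝ V}

/-- The operator is skew-symmetric for the inner product. -/
def IsSkew (h : InnerProd V) (A : Module.End ℝ V) : Prop :=
  ∀ X Y, h.form (A X) Y = -h.form X (A Y)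

theorem isSymm_lie {L S : Module.End ℝ V} (hL : h.IsSkew L) (hS : h.IsSymm S) :
    h.IsSymm ⁅L, S⁆ := by
  intro X Y
  simp only [Ring.lie_def, LinearMap.sub_apply, Module.End.mul_apply, map_sub]
  rw [hL, hS, hS, hL]
  ring

theorem IsOrthonormal.trace_diag_sq (hv : h.IsOrthonormal v) {S : Module.End ℝ V} {a : ι → ℝ}
    (hS : ∀ i, S (v i) = a i • v i) : LinearMap.trace ℝ V (S * S) = ∑ i, a i ^ 2 := by
  rw [hv.trace_eq]
  refine Finset.sum_congr rfl fun i _ => ?_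
  simp [hS, hv i i, sq]

theorem IsOrthonormal.trace_diag (hv : h.IsOrthonormal v) {S : Module.End ℝ V} {a : ι → ℝ}
    (hS : ∀ i, S (v i) = a i • v i) : LinearMap.trace ℝ V S = ∑ i, a i := by
  rw [hv.trace_eq]
  refine Finset.sum_congr rfl fun i _ => ?_
  simp [hS, hv i i]

theorem IsOrthonormal.isSymm_diag (hv : h.IsOrthonormal v) {S : Module.End ℝ V} {a : ι → ℝ}
    (hS : ∀ i, S (v i) = a i • v i) : h.IsSymm S := by
  intro X Y
  conv_lhs => rw [← hv.sum_form_smul X]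
  conv_rhs => rw [← hv.sum_form_smul Y]
  simp only [map_sum, map_smul, hS, LinearMap.sum_apply, LinearMap.smul_apply, smul_eq_mul]
  refine Finset.sum_congr rfl fun i _ => ?_
  rw [h.symm Y, h.symm X]
  ring

/-- Expand `L²S - 2LSL + SL²`: skewness moves one `L` to the other side, and the three terms carry
the eigenvalues `a i`, `a j`, `a k` respectively. -/
theorem IsOrthonormal.form_double_commutator (hv : h.IsOrthonormal v) {L S : Module.End ℝ V}
    {a : ι → ℝ} (hL : h.IsSkew L) (hS : ∀ i, S (v i) = a i • v i) (i k : ι) :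
    h.form (⁅L, ⁅L, S⁆⁆ (v i)) (v k) =
      ∑ j, (2 * a j - a i - a k) * (h.form (L (v i)) (v j) * h.form (L (v k)) (v j)) := by
  have hs := hv.isSymm_diag hS
  have h1 : h.form (L (L (v i))) (v k) =
      -∑ j, h.form (L (v i)) (v j) * h.form (L (v k)) (v j) := by
    rw [hL, hv.form_eq_sum]
  have h2 : h.form (L (S (L (v i)))) (v k) =
      -∑ j, a j * (h.form (L (v i)) (v j) * h.form (L (v k)) (v j)) := by
    rw [hL, hs, hv.form_eq_sum]
    congr 1
    refine Finset.sum_congr rfl fun j _ => ?_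
    rw [hs, hS, map_smul, smul_eq_mul]
    ring
  simp only [Ring.lie_def, LinearMap.sub_apply, Module.End.mul_apply, map_sub, hS, map_smul,
    LinearMap.smul_apply, smul_eq_mul]
  rw [hs, hS, map_smul, smul_eq_mul, h1, h2]
  simp only [sub_mul, Finset.sum_sub_distrib, ← Finset.mul_sum, mul_assoc]
  ring

theorem IsOrthonormal.trace_double_commutator (hv : h.IsOrthonormal v) {L S : Module.End ℝ V}
    {a : ι → ℝ} (hL : h.IsSkew L) (hS : ∀ i, S (v i) = a i • v i) :
    LinearMap.trace ℝ V (⁅L, ⁅L, S⁆⁆ * S) =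
      -∑ i, ∑ j, (a i - a j) ^ 2 * h.form (L (v i)) (v j) ^ 2 := by
  have h1 : LinearMap.trace ℝ V (⁅L, ⁅L, S⁆⁆ * S) = ∑ i, ∑ j,
      (2 * a i * a j - 2 * a i ^ 2) * h.form (L (v i)) (v j) ^ 2 := by
    rw [hv.trace_eq]
    refine Finset.sum_congr rfl fun i _ => ?_
    rw [Module.End.mul_apply, hS, map_smul, map_smul, LinearMap.smul_apply,
      hv.form_double_commutator hL hS, smul_eq_mul, Finset.mul_sum]
    exact Finset.sum_congr rfl fun j _ => by ring
  -- The squared matrix entries of a skew operator are symmetric in `i`, `j`, so averaging with the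
  -- swapped sum completes the square `(a i - a j) ^ 2`.
  have h2 : ∑ i, ∑ j, (2 * a i * a j - 2 * a i ^ 2) * h.form (L (v i)) (v j) ^ 2 =
      ∑ i, ∑ j, (2 * a i * a j - 2 * a j ^ 2) * h.form (L (v i)) (v j) ^ 2 := by
    rw [Finset.sum_comm]
    refine Finset.sum_congr rfl fun i _ => Finset.sum_congr rfl fun j _ => ?_
    rw [hL, h.symm]
    ring
  have h3 : ∑ i, ∑ j, (2 * a i * a j - 2 * a i ^ 2) * h.form (L (v i)) (v j) ^ 2 +
      ∑ i, ∑ j, (2 * a i * a j - 2 * a j ^ 2) * h.form (L (v i)) (v j) ^ 2 =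
      -2 * ∑ i, ∑ j, (a i - a j) ^ 2 * h.form (L (v i)) (v j) ^ 2 := by
    simp only [Finset.mul_sum, ← Finset.sum_add_distrib]
    exact Finset.sum_congr rfl fun i _ => Finset.sum_congr rfl fun j _ => by ring
  linarith

theorem trace_double_commutator_comm (L A B : Module.End ℝ V) :
    LinearMap.trace ℝ V (⁅L, ⁅L, A⁆⁆ * B) = LinearMap.trace ℝ V (A * ⁅L, ⁅L, B⁆⁆) := by
  have e : ∀ X Y : Module.End ℝ V,
      LinearMap.trace ℝ V (⁅L, X⁆ * Y) = -LinearMap.trace ℝ V (X * ⁅L, Y⁆) := by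
    intro X Y
    have : LinearMap.trace ℝ V (L * X * Y) = LinearMap.trace ℝ V (X * (Y * L)) := by
      rw [mul_assoc, LinearMap.trace_mul_comm, mul_assoc]
    simp only [Ring.lie_def, sub_mul, mul_sub, map_sub, this]
    rw [mul_assoc]
    ring
  rw [e, e, neg_neg]

omit [DecidableEq ι] in
theorem trace_sum_double_commutator_comm (b : ι → Module.End ℝ V) (c : ℝ) (A B : Module.End ℝ V) :
    LinearMap.trace ℝ V (-(c • ∑ i, ⁅b i, ⁅b i, A⁆⁆) * B) =
      LinearMap.trace ℝ V (A * -(c • ∑ i, ⁅b i, ⁅b i, B⁆⁆)) := by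
  simp only [neg_mul, mul_neg, smul_mul_assoc, mul_smul_comm, Finset.sum_mul,
    Finset.mul_sum, map_neg, map_sum, map_smul, trace_double_commutator_comm]

omit [DecidableEq ι] in
theorem trace_sum_double_commutator (b : ι → Module.End ℝ V) (c : ℝ) (A : Module.End ℝ V) :
    LinearMap.trace ℝ V (-(c • ∑ i, ⁅b i, ⁅b i, A⁆⁆)) = 0 := by
  simp [Ring.lie_def, LinearMap.trace_mul_comm ℝ (b _)]

omit [DecidableEq ι] in
-- Conjugation by `f` sends the family `b` to `b'`, and `hs` says that both families give the same
-- sum. With `b i = ad_𝔭 v_i` and `f` in `Ad(K)`, this is the invariance of the Casimir operator.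
theorem sum_double_commutator_comm {b b' : ι → Module.End ℝ V} {f A : Module.End ℝ V}
    (hb : ∀ i, f * b i = b' i * f) (hA : A * f = f * A)
    (hs : ∑ i, ⁅b i, ⁅b i, A⁆⁆ = ∑ i, ⁅b' i, ⁅b' i, A⁆⁆) (c : ℝ) :
    -(c • ∑ i, ⁅b i, ⁅b i, A⁆⁆) * f = f * -(c • ∑ i, ⁅b i, ⁅b i, A⁆⁆) := by
  have hL : ∀ i B C, f * B = C * f → f * ⁅b i, B⁆ = ⁅b' i, C⁆ * f := by
    intro i B C hBC
    rw [Ring.lie_def, Ring.lie_def, mul_sub, sub_mul, ← mul_assoc, hb, mul_assoc, hBC, ← mul_assoc,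
      ← mul_assoc, hBC, mul_assoc C, hb, ← mul_assoc]
  simp only [mul_neg, neg_mul, mul_smul_comm, smul_mul_assoc]
  congr 2
  conv_lhs => rw [hs]
  rw [Finset.sum_mul, Finset.mul_sum]
  exact Finset.sum_congr rfl fun i _ => (hL _ _ _ (hL _ _ _ hA.symm)).symm

end DoubleCommutator

section Exponential

variable [FiniteDimensional ℝ V]

omit [FiniteDimensional ℝ V] in
theorem toMatrix_eq_diagonal {v : Module.Basis ι ℝ V} {S : Module.End ℝ V} {a : ι → ℝ}
    (hS : ∀ i, S (v i) = a i • v i) : LinearMap.toMatrix v v S = Matrix.diagonal a := by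
  ext i j
  rw [LinearMap.toMatrix_apply, hS]
  simp [Finsupp.single_apply, Matrix.diagonal_apply, eq_comm]
  aesop

omit [FiniteDimensional ℝ V] in
theorem det_eq_prod_of_diag {v : Module.Basis ι ℝ V} {S : Module.End ℝ V} {a : ι → ℝ}
    (hS : ∀ i, S (v i) = a i • v i) : LinearMap.det S = ∏ i, a i := by
  rw [← LinearMap.det_toMatrix v, toMatrix_eq_diagonal hS, Matrix.det_diagonal]

/-- `expOp` is defined through the matrix in the basis `onb`. The exponential commutes with
conjugation, hence with the change to an eigenbasis, where the matrix is diagonal. -/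
theorem expOp_apply_of_diag (h : InnerProd V)
    {v : Module.Basis (Fin (Module.finrank ℝ V)) ℝ V} {S : Module.End ℝ V}
    {a : Fin (Module.finrank ℝ V) → ℝ} (hS : ∀ i, S (v i) = a i • v i)
    (i : Fin (Module.finrank ℝ V)) :
    h.expOp S (v i) = Real.exp (a i) • v i := by
  set U := h.onb.toMatrix v with hU
  set U' := v.toMatrix h.onb with hU'
  have h1 : U * U' = 1 := Module.Basis.toMatrix_mul_toMatrix_flip _ _
  have hu : IsUnit U := (Matrix.isUnit_iff_isUnit_det _).2 (Matrix.isUnit_det_of_right_inverse h1)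
  have hinv : U⁻¹ = U' := Matrix.inv_eq_right_inv h1
  have h2 : LinearMap.toMatrix h.onb h.onb S = U * LinearMap.toMatrix v v S * U⁻¹ := by
    rw [hinv, basis_toMatrix_mul_linearMap_toMatrix_mul_basis_toMatrix]
  have h3 : LinearMap.toMatrix h.onb h.onb (h.expOp S) =
      U * Matrix.diagonal (fun i => Real.exp (a i)) * U⁻¹ := by
    rw [expOp, LinearMap.toMatrix_toLin, h2, Matrix.exp_conj _ _ hu, toMatrix_eq_diagonal hS,
      Matrix.exp_diagonal]
    congr 3
    ext i
    rw [Pi.coe_exp, Real.exp_eq_exp_ℝ]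
  have h4 : LinearMap.toMatrix v v (h.expOp S) = Matrix.diagonal (fun i => Real.exp (a i)) := by
    rw [← basis_toMatrix_mul_linearMap_toMatrix_mul_basis_toMatrix v h.onb v h.onb, h3, hinv]
    have h5 : U' * U = 1 := Module.Basis.toMatrix_mul_toMatrix_flip _ _
    rw [← hU, ← hU', ← mul_assoc, ← mul_assoc, h5, one_mul, mul_assoc, h5, mul_one]
  have h6 := Matrix.toLin_toMatrix v v (h.expOp S)
  rw [← h6, h4, Matrix.toLin_self]
  simp [Matrix.diagonal_apply]

end Exponential

end InnerProd

/-! ### Geometry of the standard metric. -/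

namespace ReductiveDecomp

variable {𝔤 : Type*} [LieRing 𝔤] [LieAlgebra ℝ 𝔤] [FiniteDimensional ℝ 𝔤]
  {𝔨 : LieSubalgebra ℝ 𝔤} {Φ : Set (𝔤 →ₗ[ℝ] 𝔤)}

/-- The infinitesimal data of a compact homogeneous space `G/K` with its standard metric: the
Killing form is negative definite, the decomposition is orthogonal, `gB` is minus the Killing
form, `Ad(K)` acts by isometric automorphisms, and an operator that commutes with `Ad(K)`
commutes with `ad(𝔨)`. -/
structure IsStandard (D : ReductiveDecomp 𝔨 Φ) (gB : InnerProd D.𝔭) : Prop where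
  killing_neg : ∀ X : 𝔤, X ≠ 0 → killingForm ℝ 𝔤 X X < 0
  orth : ∀ Z ∈ 𝔨, ∀ X ∈ D.𝔭, killingForm ℝ 𝔤 Z X = 0
  form_eq : ∀ X Y : D.𝔭, gB.form X Y = -killingForm ℝ 𝔤 X Y
  map_lie : ∀ φ ∈ Φ, ∀ X Y : 𝔤, φ ⁅X, Y⁆ = ⁅φ X, φ Y⁆
  map_killing : ∀ φ ∈ Φ, ∀ X Y : 𝔤, killingForm ℝ 𝔤 (φ X) (φ Y) = killingForm ℝ 𝔤 X Y
  ad_comm : ∀ A : Module.End ℝ D.𝔭,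
    (∀ φ, ∀ hφ : φ ∈ Φ, A ∘ₗ D.isotropy φ hφ = D.isotropy φ hφ ∘ₗ A) →
    ∀ Z ∈ 𝔨, ∀ X : D.𝔭, A (D.projP ⁅Z, (X : 𝔤)⁆) = D.projP ⁅Z, (A X : 𝔤)⁆

section Projections

variable (D : ReductiveDecomp 𝔨 Φ)

omit [FiniteDimensional ℝ 𝔤] in
theorem projK_add_projP (X : 𝔤) : (D.projK X : 𝔤) + (D.projP X : 𝔤) = X :=
  Submodule.projection_add_projection_eq_self D.isCompl X

omit [FiniteDimensional ℝ 𝔤] in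
theorem projP_coe (X : D.𝔭) : D.projP (X : 𝔤) = X :=
  Submodule.projectionOnto_apply_left _ X

omit [FiniteDimensional ℝ 𝔤] in
theorem projP_of_mem_k {X : 𝔤} (hX : X ∈ 𝔨) : D.projP X = 0 :=
  (Submodule.projectionOnto_apply_eq_zero_iff D.isCompl.symm).2 hX

omit [FiniteDimensional ℝ 𝔤] in
theorem brP_apply (X Y : D.𝔭) : D.brP X Y = D.projP ⁅(X : 𝔤), (Y : 𝔤)⁆ := rfl

omit [FiniteDimensional ℝ 𝔤] in
theorem brP_skew (X Y : D.𝔭) : D.brP X Y = -D.brP Y X := by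
  simp only [brP_apply, ← map_neg, lie_skew]

end Projections

namespace IsStandard

variable {D : ReductiveDecomp 𝔨 Φ} {gB : InnerProd D.𝔭} (H : D.IsStandard gB)

include H

include H in
/-- Minus the Killing form. -/
def negKilling : InnerProd 𝔤 where
  form := -killingForm ℝ 𝔤
  symm X Y := by
    simp only [LinearMap.neg_apply]
    rw [LieModule.traceForm_comm]
  pos X hX := by
    simp only [LinearMap.neg_apply]
    linarith [H.killing_neg X hX]

omit [FiniteDimensional ℝ 𝔤] in
theorem negKilling_apply (X Y : 𝔤) : H.negKilling.form X Y = -killingForm ℝ 𝔤 X Y := rfl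

omit [FiniteDimensional ℝ 𝔤] in
theorem lie_left (X Y Z : 𝔤) : H.negKilling.form ⁅X, Y⁆ Z = H.negKilling.form X ⁅Y, Z⁆ := by
  rw [negKilling_apply, negKilling_apply, LieModule.traceForm_apply_lie_apply]

omit [FiniteDimensional ℝ 𝔤] in
theorem lie_skew_form (X Y Z : 𝔤) : H.negKilling.form ⁅X, Y⁆ Z = -H.negKilling.form Y ⁅X, Z⁆ := by
  rw [negKilling_apply, negKilling_apply, LieModule.traceForm_apply_lie_apply']

omit [FiniteDimensional ℝ 𝔤] in
theorem form_coe (X Y : D.𝔭) : gB.form X Y = H.negKilling.form (X : 𝔤) Y := H.form_eq X Y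

omit [FiniteDimensional ℝ 𝔤] in
theorem form_k_p {Z X : 𝔤} (hZ : Z ∈ 𝔨) (hX : X ∈ D.𝔭) : H.negKilling.form Z X = 0 := by
  rw [negKilling_apply, H.orth Z hZ X hX, neg_zero]

omit [FiniteDimensional ℝ 𝔤] in
theorem form_p_k {Z X : 𝔤} (hZ : Z ∈ 𝔨) (hX : X ∈ D.𝔭) : H.negKilling.form X Z = 0 := by
  rw [H.negKilling.symm, H.form_k_p hZ hX]

omit [FiniteDimensional ℝ 𝔤] in
theorem form_projP (X : 𝔤) (Y : D.𝔭) : gB.form (D.projP X) Y = H.negKilling.form X Y := by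
  rw [H.form_coe]
  conv_rhs => rw [← D.projK_add_projP X]
  rw [map_add, LinearMap.add_apply, H.form_k_p (D.projK X).2 Y.2, zero_add]

omit [FiniteDimensional ℝ 𝔤] in
theorem form_projK_left (X Y : 𝔤) (hY : Y ∈ 𝔨) :
    H.negKilling.form (D.projK X : 𝔤) Y = H.negKilling.form X Y := by
  conv_rhs => rw [← D.projK_add_projP X]
  rw [map_add, LinearMap.add_apply, H.form_p_k hY (D.projP X).2, add_zero]

theorem form_split (X Y : 𝔤) : H.negKilling.form X Y =
    H.negKilling.form (D.projK X : 𝔤) (D.projK Y : 𝔤) + gB.form (D.projP X) (D.projP Y) := by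
  rw [H.form_projP, H.form_projK_left _ _ (D.projK Y).2, ← map_add, D.projK_add_projP]

theorem mem_p_of_forall {X : 𝔤} (hX : ∀ Z ∈ 𝔨, H.negKilling.form X Z = 0) : X ∈ D.𝔭 := by
  have h1 : (D.projK X : 𝔤) = 0 := by
    apply H.negKilling.form_self_eq_zero
    rw [H.form_projK_left _ _ (D.projK X).2, hX _ (D.projK X).2]
  have := D.projK_add_projP X
  rw [h1, zero_add] at this
  rw [← this]
  exact (D.projP X).2

omit [FiniteDimensional ℝ 𝔤] in
theorem mem_k_of_forall {X : 𝔤} (hX : ∀ Y ∈ D.𝔭, H.negKilling.form X Y = 0) : X ∈ 𝔨 := by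
  have h1 : D.projP X = 0 := by
    apply gB.form_self_eq_zero
    rw [H.form_projP, hX _ (D.projP X).2]
  have := D.projK_add_projP X
  rw [h1, Submodule.coe_zero, add_zero] at this
  rw [← this]
  exact (D.projK X).2

theorem lie_k_p {Z X : 𝔤} (hZ : Z ∈ 𝔨) (hX : X ∈ D.𝔭) : ⁅Z, X⁆ ∈ D.𝔭 := by
  apply H.mem_p_of_forall
  intro W hW
  rw [lie_skew_form]
  rw [H.form_p_k (𝔨.lie_mem hZ hW) hX, neg_zero]

theorem lie_p_k {Z X : 𝔤} (hZ : Z ∈ 𝔨) (hX : X ∈ D.𝔭) : ⁅X, Z⁆ ∈ D.𝔭 := by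
  rw [← lie_skew]
  exact D.𝔭.neg_mem (H.lie_k_p hZ hX)

omit [FiniteDimensional ℝ 𝔤] in
-- This is natural reductivity: the ad-invariance of the Killing form, projected to `𝔭`.
theorem brP_isSkew (X : D.𝔭) : gB.IsSkew (D.brP X) := by
  intro Y Z
  rw [gB.symm Y, brP_apply, brP_apply, H.form_projP, H.form_projP, H.lie_skew_form,
    H.negKilling.symm]

omit [FiniteDimensional ℝ 𝔤] in
theorem form_brP_cyclic (X Y Z : D.𝔭) : gB.form (D.brP X Y) Z = gB.form X (D.brP Y Z) := by
  rw [gB.symm X, brP_apply, brP_apply, H.form_projP, H.form_projP, H.lie_left, H.negKilling.symm]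

/-- The inner product of `[X, Y]_𝔨` and `[Z, W]_𝔨`. -/
def formK (X Y Z W : D.𝔭) : ℝ :=
  H.negKilling.form (D.projK ⁅(X : 𝔤), (Y : 𝔤)⁆ : 𝔤) (D.projK ⁅(Z : 𝔤), (W : 𝔤)⁆ : 𝔤)

omit [FiniteDimensional ℝ 𝔤] in
theorem formK_skew_right (X Y Z W : D.𝔭) : H.formK X Y Z W = -H.formK X Y W Z := by
  rw [formK, formK, ← lie_skew (Z : 𝔤) (W : 𝔤), map_neg, Submodule.coe_neg, map_neg]

omit [FiniteDimensional ℝ 𝔤] in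
theorem formK_skew_left (X Y Z W : D.𝔭) : H.formK X Y Z W = -H.formK Y X Z W := by
  rw [formK, formK, ← lie_skew (X : 𝔤) (Y : 𝔤), map_neg, Submodule.coe_neg, map_neg,
    LinearMap.neg_apply]

theorem form_brK (X Y Z W : D.𝔭) : gB.form (D.brK X Y Z) W = H.formK X Y Z W := by
  have e : D.brK X Y Z = D.projP ⁅(D.projK ⁅(X : 𝔤), (Y : 𝔤)⁆ : 𝔤), (Z : 𝔤)⁆ := rfl
  rw [e, H.form_projP, H.lie_left, formK, H.negKilling.symm, H.negKilling.symm _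
    (D.projK ⁅(Z : 𝔤), (W : 𝔤)⁆ : 𝔤), H.form_projK_left _ _ (D.projK _).2]

/-- By the cyclic symmetry of `gB.form (D.brP X Y) Z`, the last two terms of the Koszul formula
cancel. -/
theorem leviCivita_eq (X Y : D.𝔭) : D.leviCivita gB X Y = (1 / 2 : ℝ) • D.brP X Y := by
  apply gB.form_injective
  ext Z
  have h1 := D.koszul gB X Y Z
  have h2 : gB.form (D.brP Y Z) X = gB.form (D.brP X Y) Z := by
    rw [H.form_brP_cyclic X, gB.symm]
  have h3 : gB.form (D.brP Z X) Y = gB.form (D.brP X Y) Z := by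
    rw [H.form_brP_cyclic Z, gB.symm]
  rw [h2, h3] at h1
  rw [map_smul, LinearMap.smul_apply, smul_eq_mul]
  linarith

theorem leviCivita_eq' (X : D.𝔭) : D.leviCivita gB X = (1 / 2 : ℝ) • D.brP X :=
  LinearMap.ext fun Y => H.leviCivita_eq X Y

theorem curvature_form (X Y Z W : D.𝔭) : gB.form (D.curvature gB X Y Z) W =
    -(1 / 4 : ℝ) * gB.form (D.brP Y Z) (D.brP X W) + (1 / 4 : ℝ) * gB.form (D.brP X Z) (D.brP Y W)
      - (1 / 2 : ℝ) * gB.form (D.brP X Y) (D.brP Z W) - H.formK X Y Z W := by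
  have e : D.curvature gB X Y Z =
      (1 / 4 : ℝ) • D.brP X (D.brP Y Z) - (1 / 4 : ℝ) • D.brP Y (D.brP X Z)
      - (1 / 2 : ℝ) • D.brP (D.brP X Y) Z - D.brK X Y Z := by
    simp only [curvature, LinearMap.mk₂_apply, H.leviCivita_eq', LinearMap.sub_apply,
      Module.End.mul_apply, LinearMap.smul_apply, map_smul, smul_smul]
    norm_num
  rw [e]
  simp only [map_sub, map_smul, LinearMap.sub_apply, LinearMap.smul_apply, smul_eq_mul]
  rw [H.brP_isSkew X (D.brP Y Z), H.brP_isSkew Y (D.brP X Z), H.form_brP_cyclic (D.brP X Y),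
    H.form_brK]
  ring

section Coordinates

variable {ι : Type*} [Fintype ι] [DecidableEq ι] {v : Module.Basis ι ℝ D.𝔭}

theorem ricci_eq (hv : gB.IsOrthonormal v) (Y Z : D.𝔭) : D.ricci gB Y Z =
    (1 / 4 : ℝ) * ∑ i, gB.form (D.brP Y (v i)) (D.brP Z (v i)) + ∑ i, H.formK Y (v i) Z (v i) := by
  have e : D.ricci gB Y Z =
    LinearMap.trace ℝ D.𝔭 (((D.curvature gB).flip Y).flip Z) := rfl
  rw [e, hv.trace_eq, Finset.mul_sum, ← Finset.sum_add_distrib]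
  refine Finset.sum_congr rfl fun i _ => ?_
  rw [LinearMap.flip_apply, LinearMap.flip_apply, H.curvature_form, D.brP_skew (v i) (v i),
    D.brP_skew (v i) Z, D.brP_skew (v i) Y, H.formK_skew_left]
  have h0 : D.brP (v i) (v i) = 0 := by
    rw [brP_apply, lie_self, map_zero]
  simp only [h0, map_neg, LinearMap.neg_apply, neg_zero, map_zero]
  rw [gB.symm (D.brP Z (v i))]
  ring

end Coordinates

/-- An orthonormal basis of the isotropy algebra. -/
def onbK : Module.Basis (Fin (Module.finrank ℝ 𝔨)) ℝ 𝔨.toSubmodule :=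
  InnerProd.onb (V := 𝔨.toSubmodule)
    { form := H.negKilling.form.compl₁₂ 𝔨.toSubmodule.subtype 𝔨.toSubmodule.subtype
      symm := fun X Y => H.negKilling.symm X Y
      pos := fun X hX => H.negKilling.pos X fun h0 => hX (Subtype.ext h0) }

theorem onbK_spec (a b : Fin (Module.finrank ℝ 𝔨)) :
    H.negKilling.form (H.onbK a : 𝔤) (H.onbK b : 𝔤) = if a = b then 1 else 0 :=
  InnerProd.onb_spec (V := 𝔨.toSubmodule)
    { form := H.negKilling.form.compl₁₂ 𝔨.toSubmodule.subtype 𝔨.toSubmodule.subtype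
      symm := fun X Y => H.negKilling.symm X Y
      pos := fun X hX => H.negKilling.pos X fun h0 => hX (Subtype.ext h0) } a b

section Adapted

variable {ι : Type*} [Fintype ι] [DecidableEq ι] (v : Module.Basis ι ℝ D.𝔭)

/-- The basis of `𝔤` that is formed by a basis of `𝔭` and an orthonormal basis of `𝔨`. -/
def adaptedBasis : Module.Basis (Fin (Module.finrank ℝ 𝔨) ⊕ ι) ℝ 𝔤 :=
  (H.onbK.prod v).map (Submodule.prodEquivOfIsCompl _ _ D.isCompl)

omit [Fintype ι] [DecidableEq ι] in
theorem adaptedBasis_inl (a : Fin (Module.finrank ℝ 𝔨)) :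
    H.adaptedBasis v (Sum.inl a) = (H.onbK a : 𝔤) := by
  simp [adaptedBasis]

omit [Fintype ι] [DecidableEq ι] in
theorem adaptedBasis_inr (i : ι) : H.adaptedBasis v (Sum.inr i) = (v i : 𝔤) := by
  simp [adaptedBasis]

variable {v}

omit [Fintype ι] in
theorem adaptedBasis_isOrthonormal (hv : gB.IsOrthonormal v) :
    H.negKilling.IsOrthonormal (H.adaptedBasis v) := by
  rintro (a | i) (b | j)
  · rw [adaptedBasis_inl, adaptedBasis_inl, onbK_spec]
    simp
  · rw [adaptedBasis_inl, adaptedBasis_inr, H.form_k_p (H.onbK a).2 (v j).2]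
    simp
  · rw [adaptedBasis_inl, adaptedBasis_inr, H.form_p_k (H.onbK b).2 (v i).2]
    simp
  · rw [adaptedBasis_inr, adaptedBasis_inr, ← H.form_coe, hv]
    simp

/-- This is Parseval's identity in `𝔨`. It exchanges a sum over a basis of `𝔨` for `𝔨`-components of
brackets. -/
theorem sum_onbK_formK (X Y Z W : D.𝔭) :
    ∑ a, H.negKilling.form ⁅(X : 𝔤), (Y : 𝔤)⁆ (H.onbK a) *
      H.negKilling.form ⁅(Z : 𝔤), (W : 𝔤)⁆ (H.onbK a) = H.formK X Y Z W := by
  have hv := H.adaptedBasis_isOrthonormal gB.onb_isOrthonormal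
  rw [formK, hv.form_eq_sum, Fintype.sum_sum_type]
  simp only [adaptedBasis_inl, adaptedBasis_inr, H.form_projK_left _ _ (H.onbK _).2,
    H.form_k_p (D.projK _).2 (gB.onb _).2]
  simp

/-- Expand `-tr(ad X ad Y)` in an adapted basis. The basis vectors of `𝔨` contribute the same sum as
the `𝔨`-components of `[X, v_i]`, whence the factor 2. -/
theorem form_eq_sum_brackets (hv : gB.IsOrthonormal v) (X Y : D.𝔭) :
    gB.form X Y = ∑ i, gB.form (D.brP X (v i)) (D.brP Y (v i)) +
      2 * ∑ i, H.formK X (v i) Y (v i) := by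
  have hf := H.adaptedBasis_isOrthonormal hv
  have h1 : gB.form X Y = ∑ x, H.negKilling.form ⁅(X : 𝔤), H.adaptedBasis v x⁆
      ⁅(Y : 𝔤), H.adaptedBasis v x⁆ := by
    rw [H.form_eq, LieModule.traceForm_apply_apply, hf.trace_eq, ← Finset.sum_neg_distrib]
    refine Finset.sum_congr rfl fun x _ => ?_
    simp only [LinearMap.comp_apply, LieModule.toEnd_apply_apply]
    rw [H.lie_skew_form, neg_neg, H.negKilling.symm]
  rw [h1, Fintype.sum_sum_type]
  simp only [adaptedBasis_inl, adaptedBasis_inr]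
  have h2 : ∑ a, H.negKilling.form ⁅(X : 𝔤), (H.onbK a : 𝔤)⁆ ⁅(Y : 𝔤), (H.onbK a : 𝔤)⁆ =
      ∑ i, H.formK X (v i) Y (v i) := by
    have : ∀ a, H.negKilling.form ⁅(X : 𝔤), (H.onbK a : 𝔤)⁆ ⁅(Y : 𝔤), (H.onbK a : 𝔤)⁆ =
        ∑ i, H.negKilling.form ⁅(X : 𝔤), (v i : 𝔤)⁆ (H.onbK a) *
          H.negKilling.form ⁅(Y : 𝔤), (v i : 𝔤)⁆ (H.onbK a) := by
      intro a
      rw [hf.form_eq_sum, Fintype.sum_sum_type]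
      simp only [adaptedBasis_inl, adaptedBasis_inr]
      rw [Finset.sum_eq_zero, zero_add]
      · refine Finset.sum_congr rfl fun i _ => ?_
        rw [H.lie_skew_form (X : 𝔤), H.lie_skew_form (Y : 𝔤), H.negKilling.symm (H.onbK a : 𝔤),
          H.negKilling.symm (H.onbK a : 𝔤)]
        ring
      · intro b _
        rw [H.form_p_k (H.onbK b).2 (H.lie_p_k (H.onbK a).2 X.2), zero_mul]
    simp only [this]
    rw [Finset.sum_comm]
    exact Finset.sum_congr rfl fun i _ => H.sum_onbK_formK _ _ _ _
  rw [h2]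
  simp only [H.form_split ⁅(X : 𝔤), (v _ : 𝔤)⁆, Finset.sum_add_distrib]
  have h3 : ∀ i, H.negKilling.form (D.projK ⁅(X : 𝔤), (v i : 𝔤)⁆ : 𝔤)
    (D.projK ⁅(Y : 𝔤), (v i : 𝔤)⁆ : 𝔤) = H.formK X (v i) Y (v i) := fun i => rfl
  simp only [h3, brP_apply]
  ring

variable {ρ : ℝ} (hρ : D.IsEinstein gB ρ)

include hρ

/-- Let `s` and `t` be the multiples of `gB` carried by the `𝔭`-sum and the `𝔨`-sum. The Einstein
equation reads `s / 4 + t = ρ` and the Killing form gives `s + 2 * t = 1`, so `t = 2ρ - 1/2` here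
and `s = 2 - 4ρ` in `sum_brP_of_einstein`. -/
theorem sum_formK_of_einstein (hv : gB.IsOrthonormal v) (X Y : D.𝔭) :
    ∑ i, H.formK X (v i) Y (v i) = (2 * ρ - 1 / 2) * gB.form X Y := by
  have h1 := hρ X Y
  rw [H.ricci_eq hv] at h1
  have h2 := H.form_eq_sum_brackets hv X Y
  linarith

theorem sum_brP_of_einstein (hv : gB.IsOrthonormal v) (X Y : D.𝔭) :
    ∑ i, gB.form (D.brP X (v i)) (D.brP Y (v i)) = (2 - 4 * ρ) * gB.form X Y := by
  have h1 := hρ X Y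
  rw [H.ricci_eq hv] at h1
  have h2 := H.form_eq_sum_brackets hv X Y
  linarith

end Adapted

end IsStandard

end ReductiveDecomp

/-! ### The Lichnerowicz Laplacian as a Casimir operator. -/

namespace ReductiveDecomp

variable {𝔤 : Type*} [LieRing 𝔤] [LieAlgebra ℝ 𝔤] [FiniteDimensional ℝ 𝔤]
  {𝔨 : LieSubalgebra ℝ 𝔤} {Φ : Set (𝔤 →ₗ[ℝ] 𝔤)}

namespace IsStandard

variable {D : ReductiveDecomp 𝔨 Φ} {gB : InnerProd D.𝔭} (H : D.IsStandard gB)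

/-- The operator `-½ ∑ [ad_𝔭 e_i, [ad_𝔭 e_i, A]]`. -/
def casimirP (D : ReductiveDecomp 𝔨 Φ) (gB : InnerProd D.𝔭) :
    Module.End ℝ D.𝔭 →ₗ[ℝ] Module.End ℝ D.𝔭 where
  toFun A := -((1 / 2 : ℝ) • ∑ i, ⁅D.brP (gB.onb i), ⁅D.brP (gB.onb i), A⁆⁆)
  map_add' A B := by
    simp only [Ring.lie_def, mul_add, add_mul, add_sub_add_comm, Finset.sum_add_distrib, smul_add,
      neg_add]
  map_smul' c A := by
    simp only [Ring.lie_def, mul_smul_comm, smul_mul_assoc, ← smul_sub, ← Finset.smul_sum,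
      RingHom.id_apply, smul_neg]
    rw [smul_comm]

theorem casimirP_apply (A : Module.End ℝ D.𝔭) : casimirP D gB A =
    -((1 / 2 : ℝ) • ∑ i, ⁅D.brP (gB.onb i), ⁅D.brP (gB.onb i), A⁆⁆) := rfl

section Basis

variable {ι : Type*} [Fintype ι] [DecidableEq ι] {v : Module.Basis ι ℝ D.𝔭}

theorem sum_double_commutator_eq (hv : gB.IsOrthonormal v) (A : Module.End ℝ D.𝔭) :
    ∑ i, ⁅D.brP (gB.onb i), ⁅D.brP (gB.onb i), A⁆⁆ = ∑ i, ⁅D.brP (v i), ⁅D.brP (v i), A⁆⁆ :=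
  gB.onb_isOrthonormal.sum_bilin_eq hv (LinearMap.mk₂ ℝ
    (fun X Y => ⁅D.brP X, ⁅D.brP Y, A⁆⁆)
    (by intros; simp only [Ring.lie_def, map_add, mul_add, add_mul, mul_sub, sub_mul]; abel)
    (by intros; simp only [Ring.lie_def, map_smul, mul_sub, sub_mul, mul_smul_comm, smul_mul_assoc,
      smul_sub])
    (by intros; simp only [Ring.lie_def, map_add, mul_add, add_mul, mul_sub, sub_mul]; abel)
    (by intros; simp only [Ring.lie_def, map_smul, mul_sub, sub_mul, mul_smul_comm, smul_mul_assoc,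
      smul_sub]))

theorem curvTerm_eq (hv : gB.IsOrthonormal v) (A : Module.End ℝ D.𝔭) :
    D.curvTerm gB A = ∑ i, ((D.curvature gB).flip (v i)).flip (A (v i)) :=
  gB.onb_isOrthonormal.sum_bilin_eq hv (LinearMap.mk₂ ℝ
    (fun X Y => ((D.curvature gB).flip X).flip (A Y))
    (by intros; ext; simp) (by intros; ext; simp) (by intros; ext; simp) (by intros; ext; simp))

include H

/-- Pair with `Z ∈ 𝔨`: ad-invariance turns the claim into symmetry of `A` together with its
commutation with `ad Z`. In an eigenbasis, the `𝔨`-part of `[v_i, v_j]` can then be nonzero only if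
`a_i = a_j`. -/
theorem projK_lie_symm {A : Module.End ℝ D.𝔭} (hA : A ∈ D.symK gB) (X Y : D.𝔭) :
    (D.projK ⁅(X : 𝔤), (A Y : 𝔤)⁆ : 𝔤) = D.projK ⁅(A X : 𝔤), (Y : 𝔤)⁆ := by
  apply H.negKilling.form_injective
  apply LinearMap.ext
  intro W
  have key : ∀ Z ∈ 𝔨, H.negKilling.form ⁅(X : 𝔤), (A Y : 𝔤)⁆ Z =
      H.negKilling.form ⁅(A X : 𝔤), (Y : 𝔤)⁆ Z := by
    intro Z hZ
    have h1 := H.ad_comm A hA.2 Z hZ Y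
    have h2 := hA.1 X (D.projP ⁅Z, (Y : 𝔤)⁆)
    rw [h1, gB.symm X, gB.symm (A X), H.form_projP, H.form_projP, ← lie_skew Z (A Y : 𝔤),
      ← lie_skew Z (Y : 𝔤), map_neg, map_neg, LinearMap.neg_apply, LinearMap.neg_apply, neg_inj] at h2
    rw [H.lie_left, H.lie_left, H.negKilling.symm, H.negKilling.symm (A X : 𝔤)]
    exact h2.symm
  conv_lhs => rw [← D.projK_add_projP W]
  conv_rhs => rw [← D.projK_add_projP W]
  rw [map_add, map_add, H.form_k_p (D.projK _).2 (D.projP W).2,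
    H.form_k_p (D.projK _).2 (D.projP W).2, H.form_projK_left _ _ (D.projK W).2,
    H.form_projK_left _ _ (D.projK W).2, key _ (D.projK W).2]

variable {ρ : ℝ} (hρ : D.IsEinstein gB ρ)

include hρ in
theorem ricciOp_eq : D.ricciOp gB = ρ • (1 : Module.End ℝ D.𝔭) := by
  apply LinearMap.ext
  intro X
  apply gB.form_injective
  ext Y
  rw [ricciOp, LinearMap.comp_apply, LinearEquiv.coe_coe, InnerProd.form_sharp, hρ]
  simp

include hρ in
theorem curvTerm_form (hv : gB.IsOrthonormal v) {A : Module.End ℝ D.𝔭} (hA : A ∈ D.symK gB)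
    {a : ι → ℝ} (ha : ∀ i, A (v i) = a i • v i) (k l : ι) :
    gB.form (D.curvTerm gB A (v k)) (v l) =
      (1 / 4 : ℝ) * ∑ i, ∑ j, a j * (gB.form (D.brP (v i) (v k)) (v j) *
        gB.form (D.brP (v i) (v l)) (v j)) + a k * ((2 * ρ - 1 / 2) * gB.form (v k) (v l)) := by
  have h1 : gB.form (D.curvTerm gB A (v k)) (v l) = ∑ i, a i *
      ((1 / 4 : ℝ) * gB.form (D.brP (v k) (v i)) (D.brP (v l) (v i)) +
        H.formK (v k) (v i) (v l) (v i)) := by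
    rw [curvTerm_eq hv, LinearMap.sum_apply, map_sum, LinearMap.sum_apply]
    refine Finset.sum_congr rfl fun i _ => ?_
    rw [LinearMap.flip_apply, LinearMap.flip_apply, ha, map_smul, map_smul, LinearMap.smul_apply,
      smul_eq_mul, H.curvature_form, D.brP_skew (v i) (v l), H.formK_skew_right]
    have h0 : D.brP (v i) (v i) = 0 := by
      rw [brP_apply, lie_self, map_zero]
    simp only [h0, map_zero, map_neg, LinearMap.zero_apply]
    ring
  -- Eigenvalues may be exchanged in the `𝔨`-part. Hence `a k` leaves the sum over `i`, which the
  -- Einstein condition then evaluates.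
  have h2 : ∀ i, a i * H.formK (v k) (v i) (v l) (v i) =
      a k * H.formK (v k) (v i) (v l) (v i) := by
    intro i
    have h3 := H.projK_lie_symm hA (v k) (v i)
    rw [ha, ha] at h3
    simp only [Submodule.coe_smul, lie_smul, smul_lie, map_smul] at h3
    have h5 := congrArg (fun W => H.negKilling.form W (D.projK ⁅(v l : 𝔤), (v i : 𝔤)⁆ : 𝔤)) h3
    simpa [formK] using h5
  rw [h1]
  simp only [mul_add, Finset.sum_add_distrib, h2, ← Finset.mul_sum]
  rw [H.sum_formK_of_einstein hρ hv]
  congr 1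
  have h4 : ∀ i, a i * ((1 / 4 : ℝ) * gB.form (D.brP (v k) (v i)) (D.brP (v l) (v i))) =
      (1 / 4 : ℝ) * ∑ j, a i * (gB.form (D.brP (v j) (v k)) (v i) *
        gB.form (D.brP (v j) (v l)) (v i)) := by
    intro i
    rw [hv.form_eq_sum, ← Finset.mul_sum]
    have : ∀ m j, gB.form (D.brP (v m) (v i)) (v j) = gB.form (D.brP (v j) (v m)) (v i) := by
      intro m j
      rw [H.form_brP_cyclic (v j), gB.symm]
    simp only [this]
    ring
  simp only [h4, ← Finset.mul_sum]
  rw [Finset.sum_comm]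
  simp only [Finset.mul_sum]

include hρ in
/-- For the standard Einstein metric the Lichnerowicz Laplacian is a Casimir operator. -/
theorem lichnerowicz_eq {A : Module.End ℝ D.𝔭} (hA : A ∈ D.symK gB) :
    D.lichnerowicz gB A = casimirP D gB A := by
  obtain ⟨v, a, hv, ha⟩ := InnerProd.IsSymm.exists_eigenbasis (h := gB) hA.1
  -- The correction term drops out because `∇_{e_i} e_i = ½[e_i, e_i]_𝔭 = 0`.
  have hn : ∀ i, D.nabla₂ gB (gB.onb i) (gB.onb i) A =
      (1 / 4 : ℝ) • ⁅D.brP (gB.onb i), ⁅D.brP (gB.onb i), A⁆⁆ := by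
    intro i
    have h0 : D.brP (gB.onb i) (gB.onb i) = 0 := by
      rw [brP_apply, lie_self, map_zero]
    rw [nabla₂, nabla, nabla, nabla, H.leviCivita_eq, h0, smul_zero, map_zero, H.leviCivita_eq']
    simp only [Ring.lie_def, mul_sub, sub_mul, mul_smul_comm, smul_mul_assoc, zero_mul, mul_zero]
    module
  -- In the Laplacian, `-2ρA` from here cancels the two Ricci terms. The `-1/4` from the curvature
  -- joins the `-1/4` of the rough Laplacian to give the coefficient `-1/2`.
  have hc : D.curvTerm gB A = ρ • A +
      (1 / 8 : ℝ) • ∑ i, ⁅D.brP (gB.onb i), ⁅D.brP (gB.onb i), A⁆⁆ := by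
    refine v.ext fun k => hv.ext fun l => ?_
    rw [H.curvTerm_form hρ hv hA ha, sum_double_commutator_eq hv]
    simp only [LinearMap.add_apply, LinearMap.smul_apply, map_add, map_smul, smul_eq_mul,
      LinearMap.sum_apply, map_sum, ha]
    simp only [hv.form_double_commutator (H.brP_isSkew _) ha]
    have h1 : ∑ i, ∑ j, (2 * a j - a k - a l) * (gB.form (D.brP (v i) (v k)) (v j) *
        gB.form (D.brP (v i) (v l)) (v j)) =
        2 * ∑ i, ∑ j, a j * (gB.form (D.brP (v i) (v k)) (v j) *
        gB.form (D.brP (v i) (v l)) (v j)) -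
        (a k + a l) * ((2 - 4 * ρ) * gB.form (v k) (v l)) := by
      rw [← H.sum_brP_of_einstein hρ hv, Finset.mul_sum, Finset.mul_sum,
        ← Finset.sum_sub_distrib]
      refine Finset.sum_congr rfl fun i _ => ?_
      rw [D.brP_skew (v k), D.brP_skew (v l)]
      simp only [map_neg, LinearMap.neg_apply, neg_neg]
      rw [hv.form_eq_sum (D.brP (v i) (v k)), Finset.mul_sum, Finset.mul_sum,
        ← Finset.sum_sub_distrib]
      exact Finset.sum_congr rfl fun j _ => by ring
    rw [h1, hv k l]
    split_ifs with hkl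
    · subst hkl
      ring
    · ring
  rw [lichnerowicz, hc, H.ricciOp_eq hρ, casimirP_apply]
  simp only [hn, ← Finset.smul_sum]
  have e1 : (ρ • (1 : Module.End ℝ D.𝔭)) ∘ₗ A = ρ • A := by ext; simp
  have e2 : A ∘ₗ (ρ • (1 : Module.End ℝ D.𝔭)) = ρ • A := by ext; simp
  rw [e1, e2]
  module

end Basis

end IsStandard

end ReductiveDecomp

/-! ### The Casimir operator on traceless symmetric operators of the Lie algebra. -/

section Casimir

variable {𝔤 : Type*} [LieRing 𝔤] [LieAlgebra ℝ 𝔤] [FiniteDimensional ℝ 𝔤]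

/-- `Sym₀(𝔤)` as a subspace. -/
def symZeroSubmodule (𝔤 : Type*) [LieRing 𝔤] [LieAlgebra ℝ 𝔤] : Submodule ℝ (Module.End ℝ 𝔤) where
  carrier := symZero 𝔤
  add_mem' := by
    rintro A B ⟨hA, hA'⟩ ⟨hB, hB'⟩
    refine ⟨fun X Y => ?_, by rw [map_add, hA', hB', add_zero]⟩
    simp only [LinearMap.add_apply, map_add, hA X Y, hB X Y]
  zero_mem' := ⟨fun X Y => by simp, by simp⟩
  smul_mem' := by
    rintro c A ⟨hA, hA'⟩
    refine ⟨fun X Y => ?_, by rw [map_smul, hA', smul_zero]⟩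
    simp only [LinearMap.smul_apply, map_smul, hA X Y]

/-- `Cas_τ` as a linear map. -/
def casimirTauHom {n : ℕ} (e : Module.Basis (Fin n) ℝ 𝔤) :
    Module.End ℝ 𝔤 →ₗ[ℝ] Module.End ℝ 𝔤 where
  toFun := casimirTau e
  map_add' A B := by
    simp only [casimirTau, Ring.lie_def, mul_add, add_mul, add_sub_add_comm,
      Finset.sum_add_distrib, neg_add]
  map_smul' c A := by
    simp only [casimirTau, Ring.lie_def, mul_smul_comm, smul_mul_assoc, ← smul_sub,
      ← Finset.smul_sum, RingHom.id_apply, smul_neg]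

omit [FiniteDimensional ℝ 𝔤] in
theorem trace_ring_lie (A B : Module.End ℝ 𝔤) : LinearMap.trace ℝ 𝔤 ⁅A, B⁆ = 0 := by
  rw [Ring.lie_def, map_sub, LinearMap.trace_mul_comm, sub_self]

variable {Q : InnerProd 𝔤} (hQ : ∀ X Y, Q.form X Y = -killingForm ℝ 𝔤 X Y)

include hQ

omit [FiniteDimensional ℝ 𝔤] in
theorem killing_ad_isSkew (X : 𝔤) : Q.IsSkew (LieAlgebra.ad ℝ 𝔤 X) := fun Y Z => by
  rw [hQ, hQ, LieAlgebra.ad_apply, LieAlgebra.ad_apply, LieModule.traceForm_apply_lie_apply']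

omit [FiniteDimensional ℝ 𝔤] in
theorem mem_symZero_iff {A : Module.End ℝ 𝔤} :
    A ∈ symZero 𝔤 ↔ Q.IsSymm A ∧ LinearMap.trace ℝ 𝔤 A = 0 := by
  have : (∀ X Y, killingForm ℝ 𝔤 (A X) Y = killingForm ℝ 𝔤 X (A Y)) ↔ Q.IsSymm A :=
    forall₂_congr fun X Y => by rw [hQ, hQ, neg_inj]
  exact and_congr_left' this

omit [FiniteDimensional ℝ 𝔤] in
theorem casimirTau_mem_symZero {n : ℕ} (e : Module.Basis (Fin n) ℝ 𝔤) {A : Module.End ℝ 𝔤}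
    (hA : A ∈ symZero 𝔤) : casimirTau e A ∈ symZero 𝔤 := by
  rw [casimirTau]
  refine (symZeroSubmodule 𝔤).neg_mem ((symZeroSubmodule 𝔤).sum_mem fun i _ => ?_)
  refine (mem_symZero_iff hQ).2 ⟨?_, trace_ring_lie _ _⟩
  exact InnerProd.isSymm_lie (killing_ad_isSkew hQ _)
    (InnerProd.isSymm_lie (killing_ad_isSkew hQ _) ((mem_symZero_iff hQ).1 hA).1)

omit [FiniteDimensional ℝ 𝔤] in
theorem trace_casimirTau {n : ℕ} {e : Module.Basis (Fin n) ℝ 𝔤} (he : Q.IsOrthonormal e)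
    {κ : Type*} [Fintype κ] [DecidableEq κ] {f : Module.Basis κ ℝ 𝔤} (hf : Q.IsOrthonormal f)
    {S : Module.End ℝ 𝔤} {a : κ → ℝ} (hS : ∀ x, S (f x) = a x • f x) :
    LinearMap.trace ℝ 𝔤 (casimirTau e S * S) =
      ∑ x, ∑ y, ∑ w, (a y - a w) ^ 2 * Q.form ⁅f x, f y⁆ (f w) ^ 2 := by
  have h1 : ∑ i, ⁅LieAlgebra.ad ℝ 𝔤 (e i), ⁅LieAlgebra.ad ℝ 𝔤 (e i), S⁆⁆ =
      ∑ x, ⁅LieAlgebra.ad ℝ 𝔤 (f x), ⁅LieAlgebra.ad ℝ 𝔤 (f x), S⁆⁆ :=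
    he.sum_bilin_eq hf (LinearMap.mk₂ ℝ
      (fun X Y => ⁅LieAlgebra.ad ℝ 𝔤 X, ⁅LieAlgebra.ad ℝ 𝔤 Y, S⁆⁆)
      (by intros; simp only [Ring.lie_def, map_add, mul_add, add_mul, mul_sub, sub_mul]; abel)
      (by intros; simp only [Ring.lie_def, map_smul, mul_smul_comm, smul_mul_assoc, smul_sub])
      (by intros; simp only [Ring.lie_def, map_add, mul_add, add_mul, mul_sub, sub_mul]; abel)
      (by intros; simp only [Ring.lie_def, map_smul, mul_sub, sub_mul, mul_smul_comm,
            smul_mul_assoc, smul_sub]))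
  rw [casimirTau, h1, neg_mul, map_neg, Finset.sum_mul, map_sum, ← Finset.sum_neg_distrib]
  refine Finset.sum_congr rfl fun x _ => ?_
  rw [hf.trace_double_commutator (killing_ad_isSkew hQ _) hS, neg_neg]
  rfl

/-- `Cas_τ` is symmetric for the trace form on `Sym₀(𝔤)`, so its Rayleigh quotients lie between the
extreme eigenvalues. The theorem records this for test operators diagonal in an orthonormal basis,
in terms of structure constants. -/
theorem casimirTau_bounds {n : ℕ} {e : Module.Basis (Fin n) ℝ 𝔤} (he : Q.IsOrthonormal e)
    {m M : ℝ} (hm : IsLeast (casimirSpec e) m) (hM : IsGreatest (casimirSpec e) M)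
    {κ : Type*} [Fintype κ] [DecidableEq κ] {f : Module.Basis κ ℝ 𝔤} (hf : Q.IsOrthonormal f)
    {a : κ → ℝ} (ha : ∑ x, a x = 0) :
    m * ∑ x, a x ^ 2 ≤ ∑ x, ∑ y, ∑ w, (a y - a w) ^ 2 * Q.form ⁅f x, f y⁆ (f w) ^ 2 ∧
      ∑ x, ∑ y, ∑ w, (a y - a w) ^ 2 * Q.form ⁅f x, f y⁆ (f w) ^ 2 ≤ M * ∑ x, a x ^ 2 := by
  set S : Module.End ℝ 𝔤 := f.constr ℝ (fun x => a x • f x) with hSdef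
  have hS : ∀ x, S (f x) = a x • f x := fun x => by simp [hSdef]
  have hSm : S ∈ symZeroSubmodule 𝔤 :=
    (mem_symZero_iff hQ).2 ⟨hf.isSymm_diag hS, (hf.trace_diag hS).trans ha⟩
  have hW : ∀ A ∈ symZeroSubmodule 𝔤, Q.IsSymm A := fun A hA => ((mem_symZero_iff hQ).1 hA).1
  set T : Module.End ℝ (symZeroSubmodule 𝔤) :=
    (casimirTauHom e).restrict fun A hA => casimirTau_mem_symZero hQ e hA with hT
  have hTs : (Q.traceProd _ hW).IsSymm T := by
    intro A B
    simp only [InnerProd.traceProd_apply]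
    have : LinearMap.trace ℝ 𝔤 (casimirTau e A * B) = LinearMap.trace ℝ 𝔤 (A * casimirTau e B) := by
      simp only [casimirTau, neg_mul, mul_neg, Finset.sum_mul, Finset.mul_sum, map_neg, map_sum,
        InnerProd.trace_double_commutator_comm]
    exact this
  have hset : {μ | ∃ X : symZeroSubmodule 𝔤, X ≠ 0 ∧ T X = μ • X} = casimirSpec e := by
    ext μ
    constructor
    · rintro ⟨X, hX, hTX⟩
      exact ⟨X, X.2, fun h0 => hX (Subtype.ext h0), congrArg Subtype.val hTX⟩
    · rintro ⟨A, hA, hA0, hAμ⟩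
      exact ⟨⟨A, hA⟩, fun h0 => hA0 (congrArg Subtype.val h0), Subtype.ext hAμ⟩
  have hb := InnerProd.form_apply_self_bounds hTs (m := m) (M := M) (by rw [hset]; exact hm.2)
    (by rw [hset]; exact hM.2) ⟨S, hSm⟩
  have e1 : (Q.traceProd _ hW).form ⟨S, hSm⟩ ⟨S, hSm⟩ = ∑ x, a x ^ 2 := hf.trace_diag_sq hS
  have e2 : (Q.traceProd _ hW).form (T ⟨S, hSm⟩) ⟨S, hSm⟩ = _ := trace_casimirTau hQ he hf hS
  rwa [e1, e2] at hb

/-- The Casimir quadratic form is a sum of squares. If `M ≤ 0`, it vanishes on a suitable test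
operator, which forces a basis vector to be central and contradicts nondegeneracy of the Killing
form. The result makes the denominators `2 * M` positive. -/
theorem casimirTau_greatest_pos [Nontrivial 𝔤] {n : ℕ} {e : Module.Basis (Fin n) ℝ 𝔤}
    (he : Q.IsOrthonormal e) {m M : ℝ} (hm : IsLeast (casimirSpec e) m)
    (hM : IsGreatest (casimirSpec e) M) : 0 < M := by
  by_contra! hM0
  have hf := Q.onb_isOrthonormal
  set f := Q.onb
  have hn : 0 < Module.finrank ℝ 𝔤 := Module.finrank_pos
  set o : Fin (Module.finrank ℝ 𝔤) := ⟨0, hn⟩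
  -- The test operator is the projection onto the line of `f o` minus its trace part, so `a o - a w
  -- = 1` for every `w ≠ o`.
  set a : Fin (Module.finrank ℝ 𝔤) → ℝ :=
    fun x => (if x = o then 1 else 0) - 1 / (Module.finrank ℝ 𝔤 : ℝ) with ha
  have hn' : (Module.finrank ℝ 𝔤 : ℝ) ≠ 0 := by exact_mod_cast hn.ne'
  have ha0 : ∑ x, a x = 0 := by
    simp [ha, hn']
  have hb := (casimirTau_bounds hQ he hm hM hf ha0).2
  have hnn : M * ∑ x, a x ^ 2 ≤ 0 :=
    mul_nonpos_of_nonpos_of_nonneg hM0 (Finset.sum_nonneg fun x _ => sq_nonneg _)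
  have hterm : ∀ x y w, 0 ≤ (a y - a w) ^ 2 * Q.form ⁅f x, f y⁆ (f w) ^ 2 := fun x y w =>
    mul_nonneg (sq_nonneg _) (sq_nonneg _)
  have hzero : ∑ x, ∑ y, ∑ w, (a y - a w) ^ 2 * Q.form ⁅f x, f y⁆ (f w) ^ 2 = 0 :=
    le_antisymm (hb.trans hnn) (Finset.sum_nonneg fun x _ => Finset.sum_nonneg fun y _ =>
      Finset.sum_nonneg fun w _ => hterm x y w)
  have hC : ∀ x w, Q.form ⁅f x, f o⁆ (f w) = 0 := by
    intro x w
    rw [Finset.sum_eq_zero_iff_of_nonneg fun x _ => Finset.sum_nonneg fun y _ =>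
      Finset.sum_nonneg fun w _ => hterm x y w] at hzero
    have h1 := hzero x (Finset.mem_univ x)
    rw [Finset.sum_eq_zero_iff_of_nonneg fun y _ => Finset.sum_nonneg fun w _ =>
      hterm x y w] at h1
    have h2 := h1 o (Finset.mem_univ o)
    rw [Finset.sum_eq_zero_iff_of_nonneg fun w _ => hterm x o w] at h2
    have h3 := h2 w (Finset.mem_univ w)
    by_cases hw : w = o
    · have h4 := killing_ad_isSkew hQ (f x) (f o) (f o)
      simp only [LieAlgebra.ad_apply] at h4
      rw [Q.symm (f o)] at h4
      rw [hw]
      linarith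
    · have : a o - a w = 1 := by simp [ha, hw]
      rw [this] at h3
      simpa using h3
  have had : ∀ x, ⁅f x, f o⁆ = 0 := fun x => hf.ext fun w => by simp [hC x w]
  have had' : LieAlgebra.ad ℝ 𝔤 (f o) = 0 := by
    refine f.ext fun x => ?_
    rw [LieAlgebra.ad_apply, ← lie_skew, had, neg_zero, LinearMap.zero_apply]
  have h1 : Q.form (f o) (f o) = 1 := by simp [hf o o]
  rw [hQ, LieModule.traceForm_apply_apply] at h1
  have h2 : LieModule.toEnd ℝ 𝔤 𝔤 (f o) = 0 := had'
  rw [h2] at h1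
  simp at h1

end Casimir

/-! ### Invariant TT-tensors and the existence of extreme eigenvalues. -/

namespace ReductiveDecomp

variable {𝔤 : Type*} [LieRing 𝔤] [LieAlgebra ℝ 𝔤] [FiniteDimensional ℝ 𝔤]
  {𝔨 : LieSubalgebra ℝ 𝔤} {Φ : Set (𝔤 →ₗ[ℝ] 𝔤)}

namespace IsStandard

variable {D : ReductiveDecomp 𝔨 Φ} {gB : InnerProd D.𝔭} (H : D.IsStandard gB)

include H

section Isotropy

variable {φ : 𝔤 →ₗ[ℝ] 𝔤} (hφ : φ ∈ Φ)

omit [FiniteDimensional ℝ 𝔤] in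
theorem isotropy_form (X Y : D.𝔭) :
    gB.form (D.isotropy φ hφ X) (D.isotropy φ hφ Y) = gB.form X Y := by
  rw [H.form_eq, H.form_eq]
  congr 1
  exact H.map_killing φ hφ X Y

omit [FiniteDimensional ℝ 𝔤] in
theorem isotropy_injective : Function.Injective (D.isotropy φ hφ) := by
  rw [injective_iff_map_eq_zero]
  intro X hX
  apply gB.form_self_eq_zero
  rw [← H.isotropy_form hφ, hX, map_zero]

include hφ in
-- `φ` preserves the Killing form and maps `𝔭` onto itself, while `𝔨` is the orthogonal complement
-- of `𝔭`.
theorem map_mem_k {Z : 𝔤} (hZ : Z ∈ 𝔨) : φ Z ∈ 𝔨 := by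
  apply H.mem_k_of_forall
  intro Y hY
  obtain ⟨X, hX⟩ := (LinearMap.injective_iff_surjective.1 (H.isotropy_injective hφ)) ⟨Y, hY⟩
  have : φ (X : 𝔤) = Y := congrArg Subtype.val hX
  rw [← this, H.negKilling_apply, H.map_killing φ hφ, H.orth Z hZ X X.2, neg_zero]

theorem isotropy_projP (X : 𝔤) : D.isotropy φ hφ (D.projP X) = D.projP (φ X) := by
  conv_rhs => rw [← D.projK_add_projP X]
  rw [map_add, map_add, D.projP_of_mem_k (H.map_mem_k hφ (D.projK X).2), zero_add]
  exact (D.projP_coe (D.isotropy φ hφ (D.projP X))).symm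

theorem isotropy_brP (X Y : D.𝔭) : D.isotropy φ hφ (D.brP X Y) =
    D.brP (D.isotropy φ hφ X) (D.isotropy φ hφ Y) := by
  rw [brP_apply, H.isotropy_projP hφ, H.map_lie φ hφ]
  rfl

/-- The isotropy operator is an isometry compatible with the bracket. It carries one orthonormal
basis to another, and the double commutator sum is the same for both. -/
theorem casimirP_comm_isotropy {A : Module.End ℝ D.𝔭}
    (hA : A ∘ₗ D.isotropy φ hφ = D.isotropy φ hφ ∘ₗ A) :
    casimirP D gB A ∘ₗ D.isotropy φ hφ = D.isotropy φ hφ ∘ₗ casimirP D gB A := by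
  set f : Module.End ℝ D.𝔭 := D.isotropy φ hφ with hf
  have hb : ∀ X, f * D.brP X = D.brP (f X) * f := fun X =>
    LinearMap.ext fun Y => H.isotropy_brP hφ X Y
  have hA' : A * f = f * A := hA
  set F := LinearEquiv.ofInjectiveEndo f (H.isotropy_injective hφ)
  have hF : ∀ X, F X = f X := fun X => rfl
  have hv : gB.IsOrthonormal (gB.onb.map F) :=
    gB.onb_isOrthonormal.map F fun X Y => H.isotropy_form hφ X Y
  exact InnerProd.sum_double_commutator_comm (b := fun i => D.brP (gB.onb i))
    (b' := fun i => D.brP (gB.onb.map F i)) (fun i => by simpa [hF] using hb (gB.onb i)) hA'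
    (sum_double_commutator_eq hv A) _

end Isotropy

/-- In an eigenbasis each summand is `½[v_i, a_i v_i]_𝔭 = 0`. Thus invariant traceless tensors are
automatically TT. -/
theorem divergence_eq_zero {A : Module.End ℝ D.𝔭} (hA : gB.IsSymm A) : D.divergence gB A = 0 := by
  obtain ⟨v, a, hv, ha⟩ := hA.exists_eigenbasis
  have h0 : ∀ X, D.brP X X = 0 := fun X => by rw [brP_apply, lie_self, map_zero]
  have h1 : ∑ i, D.brP (gB.onb i) (A (gB.onb i)) = ∑ i, D.brP (v i) (A (v i)) :=
    gB.onb_isOrthonormal.sum_bilin_eq hv (D.brP.compl₁₂ LinearMap.id A)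
  have h2 : ∀ i, D.nabla gB (gB.onb i) A (gB.onb i) =
      (1 / 2 : ℝ) • D.brP (gB.onb i) (A (gB.onb i)) := by
    intro i
    rw [nabla, Ring.lie_def, H.leviCivita_eq']
    simp [h0]
  rw [divergence]
  simp only [h2, ← Finset.smul_sum, h1, ha, map_smul, h0, smul_zero, Finset.sum_const_zero]

theorem mem_ttG_iff {A : Module.End ℝ D.𝔭} :
    A ∈ D.ttG gB ↔ A ∈ D.symK gB ∧ LinearMap.trace ℝ D.𝔭 A = 0 :=
  ⟨fun h => ⟨h.1, h.2.1⟩, fun h => ⟨h.1, h.2, H.divergence_eq_zero h.1.1⟩⟩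

theorem casimirP_mem_ttG {A : Module.End ℝ D.𝔭} (hA : A ∈ D.ttG gB) :
    casimirP D gB A ∈ D.ttG gB := by
  refine H.mem_ttG_iff.2 ⟨⟨?_, fun φ hφ => H.casimirP_comm_isotropy hφ (hA.1.2 φ hφ)⟩, ?_⟩
  · have h1 : ∀ i, gB.IsSymm ⁅D.brP (gB.onb i), ⁅D.brP (gB.onb i), A⁆⁆ := fun i =>
      InnerProd.isSymm_lie (H.brP_isSkew _) (InnerProd.isSymm_lie (H.brP_isSkew _) hA.1.1)
    intro X Y
    simp only [casimirP_apply, LinearMap.neg_apply, LinearMap.smul_apply, LinearMap.sum_apply,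
      map_neg, map_smul, map_sum, h1 _ X Y]
  · exact InnerProd.trace_sum_double_commutator (fun i => D.brP (gB.onb i)) _ A

/-- The TT-tensors form a finite-dimensional space preserved by `casimirP`, which is symmetric there
for the trace form. Its extreme eigenvalues bound the Rayleigh quotient. -/
theorem exists_spec_bounds {ρ : ℝ} (hρ : D.IsEinstein gB ρ) (hTT : ∃ A ∈ D.ttG gB, A ≠ 0) :
    ∃ m M : ℝ, IsLeast (D.spec gB) m ∧ IsGreatest (D.spec gB) M ∧ ∀ A ∈ D.ttG gB,
      m * LinearMap.trace ℝ D.𝔭 (A * A) ≤ LinearMap.trace ℝ D.𝔭 (casimirP D gB A * A) ∧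
      LinearMap.trace ℝ D.𝔭 (casimirP D gB A * A) ≤ M * LinearMap.trace ℝ D.𝔭 (A * A) := by
  let W : Submodule ℝ (Module.End ℝ D.𝔭) :=
    { carrier := D.ttG gB
      add_mem' := by
        intro A B hA hB
        refine H.mem_ttG_iff.2 ⟨⟨fun X Y => ?_, fun φ hφ => ?_⟩, ?_⟩
        · simp only [LinearMap.add_apply, map_add, hA.1.1 X Y, hB.1.1 X Y]
        · rw [LinearMap.add_comp, LinearMap.comp_add, hA.1.2 φ hφ, hB.1.2 φ hφ]
        · rw [map_add, hA.2.1, hB.2.1, add_zero]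
      zero_mem' := H.mem_ttG_iff.2 ⟨⟨fun X Y => by simp, fun φ hφ => by simp⟩, by simp⟩
      smul_mem' := by
        intro c A hA
        refine H.mem_ttG_iff.2 ⟨⟨fun X Y => ?_, fun φ hφ => ?_⟩, ?_⟩
        · simp only [LinearMap.smul_apply, map_smul, hA.1.1 X Y]
        · rw [LinearMap.smul_comp, LinearMap.comp_smul, hA.1.2 φ hφ]
        · rw [map_smul, hA.2.1, smul_zero] }
  have hW : ∀ A ∈ W, gB.IsSymm A := fun A hA => hA.1.1
  set T : Module.End ℝ W := (casimirP D gB).restrict fun A hA => H.casimirP_mem_ttG hA with hT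
  have hTs : (gB.traceProd W hW).IsSymm T := by
    intro A B
    exact InnerProd.trace_sum_double_commutator_comm (fun i => D.brP (gB.onb i)) _ (A : Module.End ℝ D.𝔭) B
  have hset : {μ | ∃ X : W, X ≠ 0 ∧ T X = μ • X} = D.spec gB := by
    ext μ
    constructor
    · rintro ⟨X, hX, hTX⟩
      refine ⟨X, X.2, fun h0 => hX (Subtype.ext h0), ?_⟩
      rw [H.lichnerowicz_eq hρ X.2.1]
      exact congrArg Subtype.val hTX
    · rintro ⟨A, hA, hA0, hAμ⟩
      rw [H.lichnerowicz_eq hρ hA.1] at hAμ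
      exact ⟨⟨A, hA⟩, fun h0 => hA0 (congrArg Subtype.val h0), Subtype.ext hAμ⟩
  have : Nontrivial W := by
    obtain ⟨A, hA, hA0⟩ := hTT
    exact ⟨⟨A, hA⟩, 0, fun h0 => hA0 (congrArg Subtype.val h0)⟩
  obtain ⟨m, M, hm, hM⟩ := InnerProd.exists_least_greatest_eigenvalue hTs
  refine ⟨m, M, hset ▸ hm, hset ▸ hM, fun A hA => ?_⟩
  exact InnerProd.form_apply_self_bounds hTs hm.2 hM.2 ⟨A, hA⟩

end IsStandard

end ReductiveDecomp

theorem InnerProd.trace_neg_smul_sum_mul {V ι : Type*} [AddCommGroup V] [Module ℝ V] [Fintype ι]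
    (c : ℝ) (T : ι → Module.End ℝ V) (A : Module.End ℝ V) :
    LinearMap.trace ℝ V (-(c • ∑ i, T i) * A) = c * -∑ i, LinearMap.trace ℝ V (T i * A) := by
  rw [neg_mul, smul_mul_assoc, Finset.sum_mul, map_neg, map_smul, map_sum, smul_eq_mul, mul_neg]

/-! ### Comparison of the two Casimir operators by block test operators. -/

namespace ReductiveDecomp

variable {𝔤 : Type*} [LieRing 𝔤] [LieAlgebra ℝ 𝔤] [FiniteDimensional ℝ 𝔤]
  {𝔨 : LieSubalgebra ℝ 𝔤} {Φ : Set (𝔤 →ₗ[ℝ] 𝔤)}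

namespace IsStandard

variable {D : ReductiveDecomp 𝔨 Φ} {gB : InnerProd D.𝔭} (H : D.IsStandard gB)
  {ι : Type*} [Fintype ι] [DecidableEq ι] {v : Module.Basis ι ℝ D.𝔭}

/-- The sum `∑ (a_j - a_k)² ⟨[v_i, v_j]_𝔭, v_k⟩²`. -/
def bracketGap (gB : InnerProd D.𝔭) (v : Module.Basis ι ℝ D.𝔭) (a : ι → ℝ) : ℝ :=
  ∑ i, ∑ j, ∑ k, (a j - a k) ^ 2 * gB.form (D.brP (v i) (v j)) (v k) ^ 2

include H

theorem trace_casimirP (hv : gB.IsOrthonormal v) {A : Module.End ℝ D.𝔭} {a : ι → ℝ}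
    (ha : ∀ i, A (v i) = a i • v i) :
    LinearMap.trace ℝ D.𝔭 (casimirP D gB A * A) = (1 / 2 : ℝ) * bracketGap gB v a := by
  rw [casimirP_apply, sum_double_commutator_eq hv, InnerProd.trace_neg_smul_sum_mul, bracketGap]
  simp only [hv.trace_double_commutator (H.brP_isSkew _) ha]
  rw [← Finset.sum_neg_distrib]
  congr 1
  refine Finset.sum_congr rfl fun i _ => ?_
  ring

omit [Fintype ι] [DecidableEq ι] [FiniteDimensional ℝ 𝔤] in
theorem ad_comm_diag {A : Module.End ℝ D.𝔭} (hA : A ∈ D.symK gB) {a : ι → ℝ}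
    (ha : ∀ i, A (v i) = a i • v i) {Z : 𝔤} (hZ : Z ∈ 𝔨) (i j : ι) :
    (a i - a j) * H.negKilling.form ⁅Z, (v i : 𝔤)⁆ (v j) = 0 := by
  have h1 := H.ad_comm A hA.2 Z hZ (v i)
  have h2 := hA.1 (D.projP ⁅Z, (v i : 𝔤)⁆) (v j)
  rw [h1, ha, ha, map_smul, H.form_projP, H.form_projP] at h2
  simp only [Submodule.coe_smul, lie_smul, map_smul, LinearMap.smul_apply, smul_eq_mul] at h2
  linarith

/-- Split each index into its `𝔨`- and `𝔭`-part. Blocks with two or three indices in `𝔨` vanish,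
either because `[𝔨, 𝔨] ⊆ 𝔨` and `[𝔨, 𝔭] ⊆ 𝔭` or because the eigenvalues agree. The block with only
`x` in `𝔨` vanishes by `hcomm`. The purely `𝔭` block is `bracketGap`. -/
theorem sum_adaptedBasis (hv : gB.IsOrthonormal v) {ρ : ℝ} (hρ : D.IsEinstein gB ρ) {a : ι → ℝ}
    (hcomm : ∀ Z ∈ 𝔨, ∀ i j, (a i - a j) * H.negKilling.form ⁅Z, (v i : 𝔤)⁆ (v j) = 0) (β : ℝ)
    {α : Fin (Module.finrank ℝ 𝔨) ⊕ ι → ℝ} (hα : α = Sum.elim (fun _ => β) a) :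
    ∑ x, ∑ y, ∑ w, (α y - α w) ^ 2 * H.negKilling.form
      ⁅H.adaptedBasis v x, H.adaptedBasis v y⁆ (H.adaptedBasis v w) ^ 2 =
    bracketGap gB v a + (4 * ρ - 1) * ∑ i, (β - a i) ^ 2 := by
  subst hα
  have h0 : ∀ c i j, (a i - a j) ^ 2 *
      H.negKilling.form ⁅(H.onbK c : 𝔤), (v i : 𝔤)⁆ (v j) ^ 2 = 0 := by
    intro c i j
    rw [← mul_pow, hcomm _ (H.onbK c).2, zero_pow two_ne_zero]
  have h1 : ∀ c d i, H.negKilling.form ⁅(H.onbK c : 𝔤), (H.onbK d : 𝔤)⁆ (v i) = 0 :=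
    fun c d i => H.form_k_p (𝔨.lie_mem (H.onbK c).2 (H.onbK d).2) (v i).2
  have h2 : ∀ c d i, H.negKilling.form ⁅(H.onbK c : 𝔤), (v i : 𝔤)⁆ (H.onbK d) = 0 :=
    fun c d i => H.form_p_k (H.onbK d).2 (H.lie_k_p (H.onbK c).2 (v i).2)
  have h3 : ∀ i c j, H.negKilling.form ⁅(v i : 𝔤), (H.onbK c : 𝔤)⁆ (v j) =
      -H.negKilling.form ⁅(v i : 𝔤), (v j : 𝔤)⁆ (H.onbK c) := by
    intro i c j
    rw [H.lie_skew_form, H.negKilling.symm]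
  have h4 : ∀ j, ∑ i, ∑ c, H.negKilling.form ⁅(v i : 𝔤), (v j : 𝔤)⁆ (H.onbK c) ^ 2 =
      2 * ρ - 1 / 2 := by
    intro j
    have h5 := H.sum_formK_of_einstein hρ hv (v j) (v j)
    rw [hv j j, if_pos rfl, mul_one] at h5
    rw [← h5]
    refine Finset.sum_congr rfl fun i _ => ?_
    rw [← H.sum_onbK_formK]
    refine Finset.sum_congr rfl fun c _ => ?_
    rw [← lie_skew (v j : 𝔤) (v i : 𝔤), map_neg, LinearMap.neg_apply]
    ring
  simp only [Fintype.sum_sum_type, Sum.elim_inl, Sum.elim_inr, adaptedBasis_inl,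
    adaptedBasis_inr, h0, h1, h2, h3, sub_self, ne_eq, OfNat.ofNat_ne_zero, not_false_eq_true,
    zero_pow, mul_zero, zero_mul, Finset.sum_const_zero, add_zero, zero_add, neg_sq]
  -- This block and the one in `h7` have exactly one of `y`, `w` in `𝔨` and `x` in `𝔭`. Each gives
  -- `2ρ - 1/2`, together `4ρ - 1`.
  have h6 : ∑ i, ∑ c, ∑ j, (β - a j) ^ 2 *
      H.negKilling.form ⁅(v i : 𝔤), (v j : 𝔤)⁆ (H.onbK c) ^ 2 =
      (2 * ρ - 1 / 2) * ∑ i, (β - a i) ^ 2 := by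
    have : ∀ i, ∑ c, ∑ j, (β - a j) ^ 2 *
        H.negKilling.form ⁅(v i : 𝔤), (v j : 𝔤)⁆ (H.onbK c) ^ 2 =
        ∑ j, (β - a j) ^ 2 * ∑ c, H.negKilling.form ⁅(v i : 𝔤), (v j : 𝔤)⁆ (H.onbK c) ^ 2 := by
      intro i
      rw [Finset.sum_comm]
      simp only [Finset.mul_sum]
    simp only [this]
    rw [Finset.sum_comm]
    simp only [← Finset.mul_sum, h4]
    rw [← Finset.sum_mul, mul_comm]
  have h7 : ∑ i, ∑ j, ∑ c, (a j - β) ^ 2 *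
      H.negKilling.form ⁅(v i : 𝔤), (v j : 𝔤)⁆ (H.onbK c) ^ 2 =
      (2 * ρ - 1 / 2) * ∑ i, (β - a i) ^ 2 := by
    rw [← h6]
    refine Finset.sum_congr rfl fun i _ => ?_
    rw [Finset.sum_comm]
    exact Finset.sum_congr rfl fun c _ => Finset.sum_congr rfl fun j _ => by ring
  have h8 : ∀ i j k, H.negKilling.form ⁅(v i : 𝔤), (v j : 𝔤)⁆ (v k) =
      gB.form (D.brP (v i) (v j)) (v k) := fun i j k => by rw [brP_apply, H.form_projP]
  simp only [Finset.sum_add_distrib]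
  rw [h6, h7]
  simp only [h8]
  rw [bracketGap]
  ring

section Casimir

variable {n : ℕ} {e : Module.Basis (Fin n) ℝ 𝔤} (he : H.negKilling.IsOrthonormal e)
  {m M ρ : ℝ} (hm : IsLeast (casimirSpec e) m) (hM : IsGreatest (casimirSpec e) M)
  (hρ : D.IsEinstein gB ρ)

include he hm hM hρ

/-- The test operator is `A` extended by zero on `𝔨`, which stays traceless. -/
theorem casimirP_bounds {A : Module.End ℝ D.𝔭} (hA : A ∈ D.ttG gB) :
    m * LinearMap.trace ℝ D.𝔭 (A * A) ≤ 2 * LinearMap.trace ℝ D.𝔭 (casimirP D gB A * A) +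
        (4 * ρ - 1) * LinearMap.trace ℝ D.𝔭 (A * A) ∧
      2 * LinearMap.trace ℝ D.𝔭 (casimirP D gB A * A) +
        (4 * ρ - 1) * LinearMap.trace ℝ D.𝔭 (A * A) ≤ M * LinearMap.trace ℝ D.𝔭 (A * A) := by
  obtain ⟨v, a, hv, ha⟩ := InnerProd.IsSymm.exists_eigenbasis (h := gB) hA.1.1
  have h0 : ∑ x, Sum.elim (fun _ : Fin (Module.finrank ℝ 𝔨) => (0 : ℝ)) a x = 0 := by
    have := hv.trace_diag ha
    rw [hA.2.1] at this
    simp [Fintype.sum_sum_type, ← this]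
  have hb := casimirTau_bounds (fun X Y => H.negKilling_apply X Y) he hm hM
    (H.adaptedBasis_isOrthonormal hv) h0
  rw [H.sum_adaptedBasis hv hρ (fun Z hZ i j => H.ad_comm_diag hA.1 ha hZ i j) 0 rfl] at hb
  rw [H.trace_casimirP hv ha, hv.trace_diag_sq ha]
  simp only [Fintype.sum_sum_type, Sum.elim_inl, Sum.elim_inr, zero_sub, neg_sq, ne_eq,
    OfNat.ofNat_ne_zero, not_false_eq_true, zero_pow, Finset.sum_const_zero, zero_add] at hb
  constructor <;> linarith [hb.1, hb.2]

/-- The test operator is `dim 𝔭` on `𝔨` and `-dim 𝔨` on `𝔭`, the traceless combination of the two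
projections. Its `bracketGap` is zero, so only the term with `4ρ - 1` survives. -/
theorem einstein_constant_bounds [Nontrivial D.𝔭] :
    m * Module.finrank ℝ 𝔨 ≤ (4 * ρ - 1) * Module.finrank ℝ 𝔤 ∧
      (4 * ρ - 1) * Module.finrank ℝ 𝔤 ≤ M * Module.finrank ℝ 𝔨 := by
  have hv := gB.onb_isOrthonormal
  obtain ⟨p, hp⟩ : ∃ p : ℝ, p = (Module.finrank ℝ D.𝔭 : ℕ) := ⟨_, rfl⟩
  obtain ⟨k, hk⟩ : ∃ k : ℝ, k = (Module.finrank ℝ 𝔨 : ℕ) := ⟨_, rfl⟩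
  have hp0 : 0 < p := by
    rw [hp]
    exact_mod_cast Module.finrank_pos
  have hk0 : 0 ≤ k := hk ▸ Nat.cast_nonneg _
  have hn : (Module.finrank ℝ 𝔤 : ℝ) = k + p := by
    have := Submodule.finrank_add_eq_of_isCompl D.isCompl
    rw [hk, hp, ← this]
    push_cast
    rfl
  set a : Fin (Module.finrank ℝ D.𝔭) → ℝ := fun _ => -k with ha
  have h0 : ∑ x, Sum.elim (fun _ : Fin (Module.finrank ℝ 𝔨) => p) a x = 0 := by
    simp [Fintype.sum_sum_type, ha, ← hp, ← hk]
    ring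
  have hb := casimirTau_bounds (fun X Y => H.negKilling_apply X Y) he hm hM
    (H.adaptedBasis_isOrthonormal hv) h0
  rw [H.sum_adaptedBasis hv hρ (fun Z hZ i j => by simp [ha]) p rfl] at hb
  have hg : bracketGap gB gB.onb a = 0 := by simp [bracketGap, ha]
  rw [hg] at hb
  simp only [Fintype.sum_sum_type, Sum.elim_inl, Sum.elim_inr, ha, Finset.sum_const,
    Finset.card_univ, Fintype.card_fin, nsmul_eq_mul] at hb
  rw [← hp, ← hk] at hb
  rw [hn, ← hk]
  have hpn : 0 < p * (k + p) := mul_pos hp0 (by linarith)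
  constructor
  · refine le_of_mul_le_mul_right ?_ hpn
    calc _ = m * (k * p ^ 2 + p * (-k) ^ 2) := by ring
      _ ≤ _ := hb.1
      _ = _ := by ring
  · refine le_of_mul_le_mul_right ?_ hpn
    calc _ = 0 + (4 * ρ - 1) * (p * (p - -k) ^ 2) := by ring
      _ ≤ _ := hb.2
      _ = _ := by ring

end Casimir

/-! ### Scalar curvature of invariant metrics. -/

section ScalarCurvature

omit [DecidableEq ι] H in
theorem sum_cyclic (f : ι → ι → ι → ℝ) :
    ∑ i, ∑ j, ∑ k, f j k i = ∑ i, ∑ j, ∑ k, f i j k := by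
  rw [Finset.sum_comm]
  refine Finset.sum_congr rfl fun i _ => ?_
  rw [Finset.sum_comm]

theorem trace_brP (X : D.𝔭) : LinearMap.trace ℝ D.𝔭 (D.brP X) = 0 := by
  rw [gB.onb_isOrthonormal.trace_eq]
  refine Finset.sum_eq_zero fun i _ => ?_
  have := H.brP_isSkew X (gB.onb i) (gB.onb i)
  rw [gB.symm (gB.onb i)] at this
  linarith

variable {h : InnerProd D.𝔭} {x : Module.Basis ι ℝ D.𝔭} (hx : h.IsOrthonormal x)

include hx

/-- The components of this vector are, by Koszul, the traces of `ad_𝔭`. They vanish because `ad_𝔭`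
is skew for `gB`, whatever the metric `h`. -/
theorem sum_leviCivita_diag : ∑ j, D.leviCivita h (x j) (x j) = 0 := by
  refine hx.ext fun k => ?_
  have h1 : ∀ j, h.form (D.leviCivita h (x j) (x j)) (x k) = h.form (D.brP (x k) (x j)) (x j) := by
    intro j
    have h2 := D.koszul h (x j) (x j) (x k)
    have h3 : D.brP (x j) (x j) = 0 := by rw [brP_apply, lie_self, map_zero]
    rw [h3, D.brP_skew (x j) (x k), map_neg, map_zero] at h2
    simp only [LinearMap.neg_apply, LinearMap.zero_apply] at h2
    linarith
  rw [map_sum, LinearMap.sum_apply, map_zero, LinearMap.zero_apply]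
  simp only [h1]
  rw [← hx.trace_eq, H.trace_brP]

/-- `form_eq_sum_brackets` is a statement about traces, so it may be evaluated in an `h`-orthonormal
basis instead of a `gB`-orthonormal one. -/
theorem form_self_eq_sum (X : D.𝔭) : gB.form X X =
    -∑ j, h.form (D.brP X (D.brP X (x j))) (x j) + 2 * ∑ j, h.form (D.brK X (x j) X) (x j) := by
  have hv := gB.onb_isOrthonormal
  set T : Module.End ℝ D.𝔭 := D.projP ∘ₗ (-LieAlgebra.ad ℝ 𝔤 (X : 𝔤)) ∘ₗ 𝔨.toSubmodule.subtype ∘ₗ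
    D.projK ∘ₗ LieAlgebra.ad ℝ 𝔤 (X : 𝔤) ∘ₗ D.𝔭.subtype with hT
  have hTx : ∀ Y, T Y = D.brK X Y X := by
    intro Y
    have : D.brK X Y X = D.projP ⁅(D.projK ⁅(X : 𝔤), (Y : 𝔤)⁆ : 𝔤), (X : 𝔤)⁆ := rfl
    rw [this, ← lie_skew]
    rfl
  have h1 : ∑ j, h.form (D.brK X (x j) X) (x j) =
      ∑ i, H.formK X (gB.onb i) X (gB.onb i) := by
    have : LinearMap.trace ℝ D.𝔭 T = ∑ i, H.formK X (gB.onb i) X (gB.onb i) := by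
      rw [hv.trace_eq]
      exact Finset.sum_congr rfl fun i _ => by rw [hTx, H.form_brK]
    rw [← this, hx.trace_eq]
    exact Finset.sum_congr rfl fun i _ => by rw [hTx]
  have h2 : ∑ j, h.form (D.brP X (D.brP X (x j))) (x j) =
      -∑ i, gB.form (D.brP X (gB.onb i)) (D.brP X (gB.onb i)) := by
    have h3 := hx.trace_eq (D.brP X * D.brP X)
    have h4 := hv.trace_eq (D.brP X * D.brP X)
    simp only [Module.End.mul_apply] at h3 h4
    rw [← h3, h4, ← Finset.sum_neg_distrib]
    exact Finset.sum_congr rfl fun i _ => H.brP_isSkew X _ _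
  rw [h1, h2, neg_neg]
  exact H.form_eq_sum_brackets hv X X

omit H in
theorem scal_eq_sum_curvature : D.scal h = ∑ i, ∑ j, h.form (D.curvature h (x i) (x j) (x j)) (x i) := by
  have e : ∀ Y Z, D.ricci h Y Z = LinearMap.trace ℝ D.𝔭 (((D.curvature h).flip Y).flip Z) :=
    fun Y Z => rfl
  rw [scal, hx.trace_eq, Finset.sum_comm]
  refine Finset.sum_congr rfl fun j _ => ?_
  rw [ricciOp, LinearMap.comp_apply, LinearEquiv.coe_coe, InnerProd.form_sharp, e, hx.trace_eq]
  rfl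

/-- The scalar curvature of an invariant metric. -/
theorem scal_eq (hinv : ∀ Z ∈ 𝔨, ∀ X Y : D.𝔭,
      h.form (D.projP ⁅Z, (X : 𝔤)⁆) Y = -h.form X (D.projP ⁅Z, (Y : 𝔤)⁆)) :
    D.scal h = (1 / 2 : ℝ) * ∑ i, gB.form (x i) (x i) -
      (1 / 4 : ℝ) * ∑ i, ∑ j, h.form (D.brP (x i) (x j)) (D.brP (x i) (x j)) := by
  set c : ι → ι → ι → ℝ := fun i j k => h.form (D.brP (x i) (x j)) (x k) with hc
  have hskew : ∀ i j k, c j i k = -c i j k := by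
    intro i j k
    simp only [hc]
    rw [D.brP_skew (x j), map_neg, LinearMap.neg_apply]
  have hL : ∀ i j k, h.form (D.leviCivita h (x i) (x j)) (x k) =
      (1 / 2) * (c i j k - c j k i + c k i j) := by
    intro i j k
    have := D.koszul h (x i) (x j) (x k)
    simp only [hc]
    linarith
  set K : ι → ι → ℝ := fun i j => h.form (D.brK (x i) (x j) (x i)) (x j) with hK
  have hR : ∀ i j, h.form (D.curvature h (x i) (x j) (x j)) (x i) =
      h.form (D.leviCivita h (x i) (D.leviCivita h (x j) (x j))) (x i) +
      (∑ k, (1 / 4) * (c i j k - c j k i + c k i j) * (-c i j k - c j k i + c k i j) -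
        ∑ k, (1 / 2) * c i j k * (c i j k - c j k i - c k i j)) + K i j := by
    intro i j
    have e : D.curvature h (x i) (x j) (x j) = D.leviCivita h (x i) (D.leviCivita h (x j) (x j)) -
      D.leviCivita h (x j) (D.leviCivita h (x i) (x j)) -
      D.leviCivita h (D.brP (x i) (x j)) (x j) - D.brK (x i) (x j) (x j) := rfl
    have e1 : h.form (D.leviCivita h (x j) (D.leviCivita h (x i) (x j))) (x i) =
        -∑ k, (1 / 4) * (c i j k - c j k i + c k i j) * (-c i j k - c j k i + c k i j) := by
      have := D.leviCivita_metric h (x j) (D.leviCivita h (x i) (x j)) (x i)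
      rw [hx.form_eq_sum (D.leviCivita h (x i) (x j))] at this
      rw [eq_neg_of_add_eq_zero_left this, neg_inj]
      refine Finset.sum_congr rfl fun k _ => ?_
      rw [hL, hL, hskew i j k, hskew k i j, hskew j k i]
      ring
    have e2 : h.form (D.leviCivita h (D.brP (x i) (x j)) (x j)) (x i) =
        ∑ k, (1 / 2) * c i j k * (c i j k - c j k i - c k i j) := by
      conv_lhs => rw [← hx.sum_form_smul (D.brP (x i) (x j))]
      simp only [map_sum, map_smul, LinearMap.sum_apply, LinearMap.smul_apply, smul_eq_mul]
      refine Finset.sum_congr rfl fun k _ => ?_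
      rw [hL, hskew i j k, hskew k i j, hskew j k i]
      simp only [hc]
      ring
    have e3 : h.form (D.brK (x i) (x j) (x j)) (x i) = -K i j := by
      rw [h.symm]
      have := hinv (D.projK ⁅(x i : 𝔤), (x j : 𝔤)⁆ : 𝔤) (D.projK _).2 (x i) (x j)
      change h.form (x i) (D.projP ⁅(D.projK ⁅(x i : 𝔤), (x j : 𝔤)⁆ : 𝔤), (x j : 𝔤)⁆) =
        -h.form (D.projP ⁅(D.projK ⁅(x i : 𝔤), (x j : 𝔤)⁆ : 𝔤), (x i : 𝔤)⁆) (x j)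
      linarith
    rw [e, map_sub, map_sub, map_sub, LinearMap.sub_apply, LinearMap.sub_apply,
      LinearMap.sub_apply, e1, e2, e3]
    ring
  have hB : ∀ i, gB.form (x i) (x i) = ∑ j, ∑ k, c i j k * c k i j + 2 * ∑ j, K i j := by
    intro i
    rw [H.form_self_eq_sum hx]
    congr 1
    rw [← Finset.sum_neg_distrib]
    refine Finset.sum_congr rfl fun j _ => ?_
    have : h.form (D.brP (x i) (D.brP (x i) (x j))) (x j) = ∑ k, c i j k * c i k j := by
      conv_lhs => rw [← hx.sum_form_smul (D.brP (x i) (x j))]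
      simp only [map_sum, map_smul, LinearMap.sum_apply, LinearMap.smul_apply, smul_eq_mul, hc]
    rw [this, ← Finset.sum_neg_distrib]
    refine Finset.sum_congr rfl fun k _ => ?_
    rw [hskew k i j]
    ring
  have h1 : ∑ i, ∑ j, h.form (D.leviCivita h (x i) (D.leviCivita h (x j) (x j))) (x i) = 0 := by
    refine Finset.sum_eq_zero fun i _ => ?_
    rw [← LinearMap.sum_apply, ← map_sum, ← map_sum, H.sum_leviCivita_diag hx]
    simp
  rw [scal_eq_sum_curvature hx]
  have hQ : ∀ i j, h.form (D.brP (x i) (x j)) (D.brP (x i) (x j)) = ∑ k, c i j k ^ 2 := by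
    intro i j
    rw [hx.form_eq_sum]
    exact Finset.sum_congr rfl fun k _ => (sq _).symm
  simp only [hR, hB, hQ]
  simp only [Finset.sum_add_distrib]
  rw [h1]
  -- All quadratic sums in the structure constants `c` agree up to cyclic relabelling with `∑ c i j
  -- k ^ 2` or `∑ c i j k * c k i j`. The mixed sums cancel against those in `hB`.
  have s1 := sum_cyclic fun i j k => c i j k ^ 2
  have s2 := sum_cyclic fun i j k => c k i j ^ 2
  have s3 := sum_cyclic fun i j k => c i j k * c k i j
  have s4 := sum_cyclic fun i j k => c k i j * c j k i
  have e4 : ∑ i, ∑ j, (∑ k, (1 / 4) * (c i j k - c j k i + c k i j) *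
      (-c i j k - c j k i + c k i j) - ∑ k, (1 / 2) * c i j k * (c i j k - c j k i - c k i j)) =
      (1 / 4) * (∑ i, ∑ j, ∑ k, c j k i ^ 2 + ∑ i, ∑ j, ∑ k, c k i j ^ 2
        - 2 * ∑ i, ∑ j, ∑ k, c k i j * c j k i - ∑ i, ∑ j, ∑ k, c i j k ^ 2) -
      (1 / 2) * (∑ i, ∑ j, ∑ k, c i j k ^ 2 - ∑ i, ∑ j, ∑ k, c j k i * c i j k -
        ∑ i, ∑ j, ∑ k, c i j k * c k i j) := by
    simp only [Finset.mul_sum, ← Finset.sum_add_distrib, ← Finset.sum_sub_distrib]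
    exact Finset.sum_congr rfl fun i _ => Finset.sum_congr rfl fun j _ =>
      Finset.sum_congr rfl fun k _ => by ring
  rw [e4]
  simp only [← Finset.mul_sum]
  linarith

omit hx in
/-- The scalar curvature of an invariant metric that is diagonal in a `gB`-orthonormal basis. -/
theorem scal_diag (hv : gB.IsOrthonormal v) {p : ι → ℝ}
    (hp : ∀ i j, h.form (v i) (v j) = if i = j then p i else 0)
    (hinv : ∀ Z ∈ 𝔨, ∀ X Y : D.𝔭,
      h.form (D.projP ⁅Z, (X : 𝔤)⁆) Y = -h.form X (D.projP ⁅Z, (Y : 𝔤)⁆)) :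
    D.scal h = (1 / 2 : ℝ) * ∑ i, (p i)⁻¹ - (1 / 4 : ℝ) * ∑ i, ∑ j, ∑ k,
      gB.form (D.brP (v i) (v j)) (v k) ^ 2 * (p k * (p i)⁻¹ * (p j)⁻¹) := by
  have hp0 : ∀ i, 0 < p i := fun i => by
    have := h.pos (v i) (v.ne_zero i)
    rwa [hp, if_pos rfl] at this
  -- Rescaling by `p i ^ (-1/2)` makes the `gB`-orthonormal basis orthonormal for `h`.
  set s : ι → ℝ := fun i => (√(p i))⁻¹ with hs
  have hs0 : ∀ i, s i ≠ 0 := fun i => inv_ne_zero (Real.sqrt_pos.2 (hp0 i)).ne'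
  have hss : ∀ i, s i * s i = (p i)⁻¹ := fun i => by
    rw [hs, ← mul_inv, Real.mul_self_sqrt (hp0 i).le]
  set x : Module.Basis ι ℝ D.𝔭 := v.isUnitSMul (w := s) fun i => (hs0 i).isUnit with hxdef
  have hxv : ∀ i, x i = s i • v i := fun i => Module.Basis.isUnitSMul_apply _ i
  have hx : h.IsOrthonormal x := by
    intro i j
    rw [hxv, hxv, map_smul, map_smul, LinearMap.smul_apply, smul_eq_mul, smul_eq_mul, hp]
    split_ifs with hij
    · subst hij
      rw [← mul_assoc, hss, inv_mul_cancel₀ (hp0 i).ne']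
    · simp
  have hform : ∀ X, h.form X X = ∑ k, p k * gB.form X (v k) ^ 2 := by
    intro X
    rw [hx.form_eq_sum]
    refine Finset.sum_congr rfl fun k _ => ?_
    have h1 : h.form X (v k) = p k * gB.form X (v k) := by
      conv_lhs => rw [← hv.sum_form_smul X]
      simp only [map_sum, map_smul, LinearMap.sum_apply, LinearMap.smul_apply, smul_eq_mul, hp,
        mul_ite, mul_zero, Finset.sum_ite_eq', Finset.mem_univ, if_true]
      ring
    rw [hxv, map_smul, smul_eq_mul, h1]
    calc _ = (s k * s k) * p k * (p k * gB.form X (v k) ^ 2) := by ring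
      _ = _ := by rw [hss, inv_mul_cancel₀ (hp0 k).ne', one_mul]
  rw [H.scal_eq hx hinv]
  congr 2
  · refine Finset.sum_congr rfl fun i _ => ?_
    rw [hxv, map_smul, map_smul, LinearMap.smul_apply, hv i i, if_pos rfl, smul_eq_mul,
      smul_eq_mul, mul_one, hss]
  · refine Finset.sum_congr rfl fun i _ => Finset.sum_congr rfl fun j _ => ?_
    rw [hxv, hxv]
    simp only [map_smul, LinearMap.smul_apply, smul_eq_mul]
    rw [hform, Finset.mul_sum, Finset.mul_sum, Finset.mul_sum, Finset.mul_sum]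
    refine Finset.sum_congr rfl fun k _ => ?_
    rw [← hss i, ← hss j]
    ring

end ScalarCurvature

end IsStandard

end ReductiveDecomp

/-! ### A function of exponentials -/

section DiagScal

variable {ι : Type*} [Fintype ι] (w : ι → ι → ι → ℝ) (a : ι → ℝ)

/-- The scalar curvature of a diagonal metric with entries `exp (a i)`, where `w` are the squared
structure constants. -/
def diagScal : ℝ :=
  (1 / 2) * ∑ i, Real.exp (-a i) - (1 / 4) * ∑ i, ∑ j, ∑ k, w i j k * Real.exp (a k - a i - a j)

/-- The second derivative at zero of `diagScal`. -/
def diagHess : ℝ :=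
  (1 / 2) * ∑ i, a i ^ 2 - (1 / 4) * ∑ i, ∑ j, ∑ k, w i j k * (a k - a i - a j) ^ 2

theorem iteratedDeriv_two_eq {f f' : ℝ → ℝ} {c x : ℝ} (h : ∀ t, HasDerivAt f (f' t) t)
    (h' : HasDerivAt f' c x) : iteratedDeriv 2 f x = c := by
  rw [iteratedDeriv_succ, iteratedDeriv_one, funext fun t => (h t).deriv, h'.deriv]

theorem iteratedDeriv_diagScal :
    iteratedDeriv 2 (fun t => diagScal w (fun i => t * a i)) 0 = diagHess w a := by
  have key : ∀ (b t : ℝ), HasDerivAt (fun t => Real.exp (t * b)) (b * Real.exp (t * b)) t := by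
    intro b t
    have := ((hasDerivAt_id t).mul_const b).exp
    simpa [mul_comm] using this
  have hf : (fun t => diagScal w (fun i => t * a i)) = fun t =>
      (1 / 2) * ∑ i, Real.exp (t * -a i) -
        (1 / 4) * ∑ i, ∑ j, ∑ k, w i j k * Real.exp (t * (a k - a i - a j)) := by
    funext t
    simp only [diagScal, mul_neg, mul_sub]
  rw [hf]
  refine iteratedDeriv_two_eq (f' := fun t => (1 / 2) * ∑ i, -a i * Real.exp (t * -a i) -
    (1 / 4) * ∑ i, ∑ j, ∑ k, w i j k * ((a k - a i - a j) * Real.exp (t * (a k - a i - a j))))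
    (fun t => ?_) ?_
  · refine HasDerivAt.sub (HasDerivAt.const_mul _ (HasDerivAt.fun_sum fun i _ => key _ t))
      (HasDerivAt.const_mul _ (HasDerivAt.fun_sum fun i _ => HasDerivAt.fun_sum fun j _ =>
        HasDerivAt.fun_sum fun k _ => (key _ t).const_mul _))
  · have h := HasDerivAt.sub
      (HasDerivAt.const_mul (1 / 2 : ℝ) (HasDerivAt.fun_sum (u := Finset.univ)
        fun i _ => (key (-a i) 0).const_mul (-a i)))
      (HasDerivAt.const_mul (1 / 4 : ℝ) (HasDerivAt.fun_sum (u := Finset.univ)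
        fun i _ => HasDerivAt.fun_sum (u := Finset.univ) fun j _ =>
        HasDerivAt.fun_sum (u := Finset.univ) fun k _ =>
          ((key (a k - a i - a j) 0).const_mul (a k - a i - a j)).const_mul (w i j k)))
    refine h.congr_deriv ?_
    simp [diagHess, sq]

variable {w a}

/-- The summand is antisymmetric in `j`, `k`. This removes the mixed term of the Hessian and, with
`b = 1`, part of the linear term of the Taylor expansion. -/
theorem sum_mul_sub_eq_zero (hw : ∀ i j k, w i j k = w i k j) (b : ι → ℝ) :
    ∑ i, ∑ j, ∑ k, w i j k * (b i * (a k - a j)) = 0 := by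
  refine Finset.sum_eq_zero fun i _ => ?_
  have h : ∑ j, ∑ k, w i j k * (b i * (a k - a j)) =
      -∑ j, ∑ k, w i j k * (b i * (a k - a j)) := by
    conv_lhs => rw [Finset.sum_comm]
    simp only [← Finset.sum_neg_distrib]
    refine Finset.sum_congr rfl fun j _ => Finset.sum_congr rfl fun k _ => ?_
    rw [hw i k j]
    ring
  linarith

variable {C : ℝ}

theorem sum_mul_of_sum_eq (hC : ∀ i, ∑ j, ∑ k, w i j k = C) (b : ι → ℝ) :
    ∑ i, ∑ j, ∑ k, w i j k * b i = C * ∑ i, b i := by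
  simp only [← Finset.sum_mul, hC, Finset.mul_sum]

/-- Expand `(a k - a i - a j) ^ 2` as `a i ^ 2 - 2 * a i * (a k - a j) + (a j - a k) ^ 2`; the mixed
term sums to zero. For the Einstein value `C = 2 - 4ρ` the first coefficient is `ρ`. -/
theorem diagHess_eq (hw : ∀ i j k, w i j k = w i k j) (hC : ∀ i, ∑ j, ∑ k, w i j k = C) :
    diagHess w a = (1 / 2 - C / 4) * ∑ i, a i ^ 2 -
      (1 / 4) * ∑ i, ∑ j, ∑ k, (a j - a k) ^ 2 * w i j k := by
  have h1 := sum_mul_of_sum_eq hC fun i => a i ^ 2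
  have h2 := sum_mul_sub_eq_zero (a := a) hw a
  have h3 : ∑ i, ∑ j, ∑ k, w i j k * (a k - a i - a j) ^ 2 =
      ∑ i, ∑ j, ∑ k, w i j k * a i ^ 2 - 2 * ∑ i, ∑ j, ∑ k, w i j k * (a i * (a k - a j)) +
        ∑ i, ∑ j, ∑ k, (a j - a k) ^ 2 * w i j k := by
    simp only [Finset.mul_sum, ← Finset.sum_add_distrib, ← Finset.sum_sub_distrib]
    exact Finset.sum_congr rfl fun i _ => Finset.sum_congr rfl fun j _ =>
      Finset.sum_congr rfl fun k _ => by ring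
  rw [diagHess, h3, h1, h2]
  ring

theorem abs_exp_sub_quadratic_le {x ε : ℝ} (hε : ε ≤ 1) (hx : |x| ≤ ε) :
    |Real.exp x - (1 + x + x ^ 2 / 2)| ≤ ε * x ^ 2 := by
  have h := Real.exp_bound (hx.trans hε) (n := 3) (by norm_num)
  simp only [Finset.sum_range_succ, Finset.sum_range_zero, Nat.factorial] at h
  norm_num at h
  refine h.trans ?_
  have h1 : |x| ^ 3 ≤ ε * x ^ 2 := by
    rw [pow_succ', sq_abs]
    exact mul_le_mul_of_nonneg_right hx (sq_nonneg x)
  have h2 : 0 ≤ |x| ^ 3 := by positivity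
  linarith

/-- A quantitative Taylor estimate: the linear terms vanish since `∑ a i = 0`. The exponents `a k -
a i - a j` are at most `3 * ε`, so the cubic error perturbs the weighted squares by `3 * ε`.
Factoring out `diagHess` leaves the defect `ε / 2 + 3 * ε / 2 = 2 * ε` in front of `∑ a i ^ 2`. -/
theorem diagScal_sub_ge (hw0 : ∀ i j k, 0 ≤ w i j k) (hw : ∀ i j k, w i j k = w i k j)
    (hC : ∀ i, ∑ j, ∑ k, w i j k = C) (ha : ∑ i, a i = 0) {ε : ℝ} (hε : 3 * ε ≤ 1)
    (haε : ∀ i, |a i| ≤ ε) :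
    (1 / 2 + 3 * ε) * diagHess w a - 2 * ε * ∑ i, a i ^ 2 ≤ diagScal w a - diagScal w 0 := by
  have h1 : ∑ i, (1 - a i + a i ^ 2 / 2 - ε * a i ^ 2) ≤ ∑ i, Real.exp (-a i) := by
    refine Finset.sum_le_sum fun i _ => ?_
    have := neg_le_of_abs_le (abs_exp_sub_quadratic_le (x := -a i) (by linarith)
      (by rw [abs_neg]; exact haε i))
    rw [neg_sq] at this
    linarith
  have h2 : ∑ i, ∑ j, ∑ k, w i j k * Real.exp (a k - a i - a j) ≤
      ∑ i, ∑ j, ∑ k, (w i j k + (w i j k * (1 * (a k - a j)) - w i j k * a i) +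
        (1 / 2 + 3 * ε) * (w i j k * (a k - a i - a j) ^ 2)) := by
    refine Finset.sum_le_sum fun i _ => Finset.sum_le_sum fun j _ =>
      Finset.sum_le_sum fun k _ => ?_
    have hx : |a k - a i - a j| ≤ 3 * ε := by
      have := abs_sub (a k - a i) (a j)
      have := abs_sub (a k) (a i)
      linarith [haε i, haε j, haε k]
    have := le_of_abs_le (abs_exp_sub_quadratic_le hε hx)
    have h3 : Real.exp (a k - a i - a j) ≤ 1 + (1 * (a k - a j) - a i) +
        (1 / 2 + 3 * ε) * (a k - a i - a j) ^ 2 := by linarith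
    refine (mul_le_mul_of_nonneg_left h3 (hw0 i j k)).trans_eq ?_
    ring
  have h3 := sum_mul_of_sum_eq hC a
  have h4 := sum_mul_sub_eq_zero (a := a) hw fun _ => 1
  simp only [Finset.sum_add_distrib, Finset.sum_sub_distrib, ← Finset.mul_sum,
    ← Finset.sum_div] at h1 h2
  rw [h3, h4, ha] at h2
  rw [ha] at h1
  have h0 : diagScal w 0 = (1 / 2) * ∑ _i : ι, (1 : ℝ) - (1 / 4) * ∑ i, ∑ j, ∑ k, w i j k := by
    simp [diagScal]
  rw [h0, diagScal, diagHess]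
  nlinarith

end DiagScal

/-! ### The scalar curvature near a standard metric -/

theorem InnerProd.eventually_abs_form_sub_le {V : Type*} [AddCommGroup V] [Module ℝ V]
    [FiniteDimensional ℝ V] (h : InnerProd V) {δ : ℝ} (hδ : 0 < δ) :
    ∀ᶠ h' in nhds h, ∀ X, h.form X X = 1 → |InnerProd.form h' X X - 1| ≤ δ := by
  have hcont : ∀ X Y : V, Continuous fun h' : InnerProd V => h'.form X Y := fun X Y =>
    have h0 : Continuous fun (h' : InnerProd V) (X Y : V) => h'.form X Y := continuous_induced_dom
    (continuous_apply Y).comp ((continuous_apply X).comp h0)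
  set d := Module.finrank ℝ V
  -- There are `d * d` pairs of basis vectors, and unit vectors have coordinates at most one. The
  -- added one keeps the denominator positive for `d = 0`.
  have hη : 0 < δ / (d * d + 1) := by positivity
  have h1 : ∀ᶠ h' in nhds h, ∀ i j, |InnerProd.form h' (h.onb i) (h.onb j) -
      h.form (h.onb i) (h.onb j)| < δ / (d * d + 1) := by
    simp only [Filter.eventually_all]
    intro i j
    exact Metric.continuousAt_iff'.1 (hcont (h.onb i) (h.onb j)).continuousAt _ hη
  filter_upwards [h1] with h' hh' X hX
  have hv := h.onb_isOrthonormal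
  have hx : ∀ i, |h.form X (h.onb i)| ≤ 1 := by
    intro i
    rw [hv.form_eq_sum] at hX
    rw [← sq_le_one_iff_abs_le_one, sq, ← hX]
    exact Finset.single_le_sum (f := fun i => h.form X (h.onb i) * h.form X (h.onb i))
      (fun i _ => mul_self_nonneg _) (Finset.mem_univ i)
  have he : ∀ h'' : InnerProd V, h''.form X X = ∑ i, ∑ j,
      h.form X (h.onb i) * (h.form X (h.onb j) * h''.form (h.onb i) (h.onb j)) := by
    intro h''
    have : h''.form X X = h''.form (∑ i, h.form X (h.onb i) • h.onb i)
        (∑ i, h.form X (h.onb i) • h.onb i) := by rw [hv.sum_form_smul]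
    rw [this]
    simp only [map_sum, map_smul, LinearMap.sum_apply, LinearMap.smul_apply, smul_eq_mul,
      Finset.mul_sum]
    rw [Finset.sum_comm]
    exact Finset.sum_congr rfl fun i _ => Finset.sum_congr rfl fun j _ => by ring
  rw [← hX, he h', he h, ← Finset.sum_sub_distrib]
  simp only [← Finset.sum_sub_distrib, ← mul_sub]
  calc _ ≤ ∑ i, ∑ j, |h.form X (h.onb i) * (h.form X (h.onb j) *
        (h'.form (h.onb i) (h.onb j) - h.form (h.onb i) (h.onb j)))| :=
        (Finset.abs_sum_le_sum_abs _ _).trans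
          (Finset.sum_le_sum fun i _ => Finset.abs_sum_le_sum_abs _ _)
    _ ≤ ∑ _i : Fin d, ∑ _j : Fin d, δ / (d * d + 1) := by
        refine Finset.sum_le_sum fun i _ => Finset.sum_le_sum fun j _ => ?_
        rw [abs_mul, abs_mul]
        have h2 := mul_le_mul (hx j) (hh' i j).le (abs_nonneg _) zero_le_one
        have h3 := mul_le_mul (hx i) h2 (by positivity) zero_le_one
        linarith
    _ ≤ δ := by
        simp only [Finset.sum_const, Finset.card_univ, Fintype.card_fin, nsmul_eq_mul]
        rw [← mul_assoc, mul_div_assoc', div_le_iff₀ (by positivity)]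
        nlinarith

namespace ReductiveDecomp

variable {𝔤 : Type*} [LieRing 𝔤] [LieAlgebra ℝ 𝔤] [FiniteDimensional ℝ 𝔤]
  {𝔨 : LieSubalgebra ℝ 𝔤} {Φ : Set (𝔤 →ₗ[ℝ] 𝔤)}

namespace IsStandard

variable {D : ReductiveDecomp 𝔨 Φ} {gB : InnerProd D.𝔭} (H : D.IsStandard gB)
  {ι : Type*} [Fintype ι] [DecidableEq ι] {v : Module.Basis ι ℝ D.𝔭}

/-- The squared structure constants of a basis of `𝔭`. -/
def bracketSq (gB : InnerProd D.𝔭) (v : Module.Basis ι ℝ D.𝔭) (i j k : ι) : ℝ :=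
  gB.form (D.brP (v i) (v j)) (v k) ^ 2

include H

omit [Fintype ι] [DecidableEq ι] in
theorem bracketSq_comm (i j k : ι) : bracketSq gB v i j k = bracketSq gB v i k j := by
  rw [bracketSq, bracketSq, H.brP_isSkew, gB.symm, neg_sq]

theorem sum_bracketSq {ρ : ℝ} (hρ : D.IsEinstein gB ρ) (hv : gB.IsOrthonormal v) (i : ι) :
    ∑ j, ∑ k, bracketSq gB v i j k = 2 - 4 * ρ := by
  have h := H.sum_brP_of_einstein hρ hv (v i) (v i)
  rw [hv i i, if_pos rfl, mul_one] at h
  rw [← h]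
  refine Finset.sum_congr rfl fun j _ => ?_
  rw [hv.form_eq_sum]
  exact Finset.sum_congr rfl fun k _ => sq _

/-- `hcomm` makes `h` invariant under `ad(𝔨)`, because nonzero matrix entries of `ad Z` link only
equal eigenvalues. Then `scal_diag` applies with `p i = exp (a i)`. -/
theorem scal_eq_diagScal (hv : gB.IsOrthonormal v) {h : InnerProd D.𝔭} {a : ι → ℝ}
    (hp : ∀ i j, h.form (v i) (v j) = if i = j then Real.exp (a i) else 0)
    (hcomm : ∀ Z ∈ 𝔨, ∀ i j, (a i - a j) * H.negKilling.form ⁅Z, (v i : 𝔤)⁆ (v j) = 0) :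
    D.scal h = diagScal (bracketSq gB v) a := by
  have hform : ∀ U j, h.form U (v j) = Real.exp (a j) * gB.form U (v j) := by
    intro U j
    conv_lhs => rw [← hv.sum_form_smul U]
    simp only [map_sum, map_smul, LinearMap.sum_apply, LinearMap.smul_apply, smul_eq_mul, hp,
      mul_ite, mul_zero, Finset.sum_ite_eq', Finset.mem_univ, if_true]
    ring
  have hinv : ∀ Z ∈ 𝔨, ∀ X Y : D.𝔭,
      h.form (D.projP ⁅Z, (X : 𝔤)⁆) Y = -h.form X (D.projP ⁅Z, (Y : 𝔤)⁆) := by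
    intro Z hZ
    set L : Module.End ℝ D.𝔭 := D.projP ∘ₗ LieAlgebra.ad ℝ 𝔤 Z ∘ₗ D.𝔭.subtype with hL
    have hLX : ∀ X : D.𝔭, D.projP ⁅Z, (X : 𝔤)⁆ = L X := fun X => rfl
    have hB : h.form ∘ₗ L = -(h.form.compl₂ L) := by
      refine LinearMap.ext_basis v v fun i j => ?_
      change h.form (L (v i)) (v j) = -h.form (v i) (L (v j))
      rw [h.symm (v i), hform, hform, ← hLX, ← hLX, H.form_projP, H.form_projP,
        H.lie_skew_form Z (v j : 𝔤), H.negKilling.symm (v j : 𝔤)]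
      rcases mul_eq_zero.1 (hcomm Z hZ i j) with h0 | h0
      · rw [sub_eq_zero.1 h0]
        ring
      · rw [h0]
        ring
    intro X Y
    rw [hLX, hLX]
    exact LinearMap.congr_fun (LinearMap.congr_fun hB X) Y
  rw [H.scal_diag hv hp hinv, diagScal]
  simp only [← Real.exp_neg, ← Real.exp_add, bracketSq, sub_eq_add_neg]

theorem diagHess_bracketSq {ρ : ℝ} (hρ : D.IsEinstein gB ρ) (hv : gB.IsOrthonormal v)
    {A : Module.End ℝ D.𝔭} {a : ι → ℝ} (ha : ∀ i, A (v i) = a i • v i) :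
    diagHess (bracketSq gB v) a = ρ * LinearMap.trace ℝ D.𝔭 (A * A) -
      (1 / 2) * LinearMap.trace ℝ D.𝔭 (casimirP D gB A * A) := by
  rw [diagHess_eq H.bracketSq_comm (H.sum_bracketSq hρ hv), hv.trace_diag_sq ha,
    H.trace_casimirP hv ha, bracketGap]
  simp only [bracketSq]
  ring

theorem scalHess_eq {ρ : ℝ} (hρ : D.IsEinstein gB ρ) {A : Module.End ℝ D.𝔭} (hA : A ∈ D.symK gB) :
    D.scalHess gB A = ρ * LinearMap.trace ℝ D.𝔭 (A * A) -
      (1 / 2) * LinearMap.trace ℝ D.𝔭 (casimirP D gB A * A) := by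
  obtain ⟨v, a, hv, ha⟩ := InnerProd.IsSymm.exists_eigenbasis (h := gB) hA.1
  rw [← H.diagHess_bracketSq hρ hv ha, ← iteratedDeriv_diagScal, scalHess]
  congr 1
  funext t
  refine H.scal_eq_diagScal hv (fun i j => ?_) fun Z hZ i j => ?_
  · have hS : ∀ i, ((t / 2) • A) (v i) = (t / 2 * a i) • v i := fun i => by
      rw [LinearMap.smul_apply, ha, smul_smul]
    change gB.form (gB.expOp _ (v i)) (gB.expOp _ (v j)) = _
    rw [gB.expOp_apply_of_diag hS, gB.expOp_apply_of_diag hS, map_smul, map_smul,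
      LinearMap.smul_apply, hv i j]
    split_ifs with hij
    · subst hij
      rw [smul_eq_mul, smul_eq_mul, mul_one, ← Real.exp_add]
      congr 1
      ring
    · simp
  · rw [← mul_sub, mul_assoc, H.ad_comm_diag hA ha hZ, mul_zero]

/-- The comparison is with every nearby metric, not only along curves. Such a metric is diagonal
with entries `exp (a i)` in a `gB`-orthonormal basis; equal volume means `∑ a i = 0`, and its
logarithm is a TT-tensor on which the Hessian is coercive. -/
theorem isScalLocalMin {ρ M : ℝ} (hρ : D.IsEinstein gB ρ) (hM : M < 2 * ρ)
    (hspec : ∀ A ∈ D.ttG gB, LinearMap.trace ℝ D.𝔭 (casimirP D gB A * A) ≤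
      M * LinearMap.trace ℝ D.𝔭 (A * A)) : D.IsScalLocalMin gB := by
  -- The bound `1 / 3` allows the exponential estimate for exponents up to `3 * ε`. The bound `4 * ε
  -- ≤ ρ - M / 2` lets half the Hessian absorb the error `2 * ε * ∑ a i ^ 2`.
  obtain ⟨ε, hε⟩ : ∃ ε : ℝ, ε = min (1 / 3) ((ρ - M / 2) / 4) := ⟨_, rfl⟩
  have hε1 : 3 * ε ≤ 1 := by
    have := min_le_left (1 / 3) ((ρ - M / 2) / 4)
    linarith
  have hε2 : 4 * ε ≤ ρ - M / 2 := by
    have := min_le_right (1 / 3) ((ρ - M / 2) / 4)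
    linarith
  have hε0 : 0 < ε := by
    rw [hε]
    exact lt_min (by norm_num) (by linarith)
  obtain ⟨δ, hδ, hlog⟩ := Metric.continuousAt_iff.1 (Real.continuousAt_log one_ne_zero) ε hε0
  filter_upwards [mem_nhdsWithin_of_mem_nhds (gB.eventually_abs_form_sub_le (half_pos hδ)),
    self_mem_nhdsWithin] with h' hnear hmem
  obtain ⟨hinv, hvol⟩ := hmem
  set P : Module.End ℝ D.𝔭 := gB.sharp.toLinearMap ∘ₗ h'.form with hPdef
  have hP : ∀ X Y, gB.form (P X) Y = h'.form X Y := fun X Y => gB.form_sharp _ _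
  have hPφ : ∀ φ, ∀ hφ : φ ∈ Φ, P ∘ₗ D.isotropy φ hφ = D.isotropy φ hφ ∘ₗ P := by
    intro φ hφ
    refine LinearMap.ext fun X => gB.form_injective (LinearMap.ext fun Y => ?_)
    obtain ⟨Y, rfl⟩ := LinearMap.injective_iff_surjective.1 (H.isotropy_injective hφ) Y
    change gB.form (P (D.isotropy φ hφ X)) _ = gB.form (D.isotropy φ hφ (P X)) _
    rw [hP, hinv, H.isotropy_form hφ, hP]
  have hPs : P ∈ D.symK gB :=
    ⟨fun X Y => by rw [hP, gB.symm X, hP, h'.symm], hPφ⟩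
  obtain ⟨v, p, hv, hpv⟩ := InnerProd.IsSymm.exists_eigenbasis (h := gB) hPs.1
  have hform : ∀ i j, h'.form (v i) (v j) = if i = j then p i else 0 := by
    intro i j
    rw [← hP, hpv, map_smul, LinearMap.smul_apply, hv i j]
    split_ifs <;> simp
  have hp0 : ∀ i, 0 < p i := InnerProd.IsOrthonormal.pos_coeff hform
  have hprod : ∏ i, p i = 1 := by
    rw [← InnerProd.det_eq_prod_of_diag hpv]
    exact hvol
  obtain ⟨a, ha⟩ : ∃ a : Fin (Module.finrank ℝ D.𝔭) → ℝ, a = fun i => Real.log (p i) := ⟨_, rfl⟩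
  have hexp : ∀ i, Real.exp (a i) = p i := fun i => by rw [ha, Real.exp_log (hp0 i)]
  have hsum : ∑ i, a i = 0 := by
    rw [ha, ← Real.log_prod fun i _ => (hp0 i).ne', hprod, Real.log_one]
  have hsmall : ∀ i, |a i| ≤ ε := by
    intro i
    have h1 := hnear (v i) (by rw [hv i i, if_pos rfl])
    rw [hform, if_pos rfl] at h1
    have h2 := hlog (x := p i) (by rw [Real.dist_eq]; linarith)
    rw [Real.log_one, Real.dist_eq, sub_zero] at h2
    rw [ha]
    exact h2.le
  -- Commutation with a diagonal operator depends only on which eigenvalues coincide, so it passes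
  -- from `P` to its logarithm.
  have htrans : ∀ {c : ℝ} {i j}, (p i - p j) * c = 0 → (a i - a j) * c = 0 := by
    intro c i j h0
    rcases mul_eq_zero.1 h0 with h0 | h0
    · rw [ha]
      simp only [sub_eq_zero.1 h0, sub_self, zero_mul]
    · rw [h0, mul_zero]
  have hcomm : ∀ Z ∈ 𝔨, ∀ i j, (a i - a j) * H.negKilling.form ⁅Z, (v i : 𝔤)⁆ (v j) = 0 :=
    fun Z hZ i j => htrans (H.ad_comm_diag hPs hpv hZ i j)
  set A : Module.End ℝ D.𝔭 := v.constr ℝ fun i => a i • v i with hAdef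
  have hAv : ∀ i, A (v i) = a i • v i := fun i => v.constr_basis ℝ _ i
  have hAs : gB.IsSymm A := hv.isSymm_diag hAv
  have hA : A ∈ D.ttG gB := by
    refine H.mem_ttG_iff.2 ⟨⟨hAs, fun φ hφ => ?_⟩, ?_⟩
    · refine v.ext fun i => hv.ext fun j => ?_
      have h1 : gB.form (P (D.isotropy φ hφ (v i))) (v j) =
          gB.form (D.isotropy φ hφ (P (v i))) (v j) :=
        congrArg (fun T : Module.End ℝ D.𝔭 => gB.form (T (v i)) (v j)) (hPφ φ hφ)
      rw [hPs.1, hpv, hpv] at h1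
      rw [LinearMap.comp_apply, LinearMap.comp_apply, hAs, hAv, hAv]
      simp only [map_smul, LinearMap.smul_apply, smul_eq_mul] at h1 ⊢
      have h2 := htrans (c := gB.form (D.isotropy φ hφ (v i)) (v j)) (i := i) (j := j)
        (by linarith)
      linarith
    · rw [hv.trace_diag hAv, hsum]
  have hQ : (ρ - M / 2) * ∑ i, a i ^ 2 ≤ diagHess (bracketSq gB v) a := by
    have h1 := hspec A hA
    rw [H.diagHess_bracketSq hρ hv hAv]
    rw [hv.trace_diag_sq hAv] at h1 ⊢
    linarith
  have h1 : D.scal h' = diagScal (bracketSq gB v) a :=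
    H.scal_eq_diagScal hv (fun i j => by rw [hform, hexp]) hcomm
  have h2 : D.scal gB = diagScal (bracketSq gB v) 0 :=
    H.scal_eq_diagScal hv (fun i j => by rw [hv i j]; simp) fun Z hZ i j => by simp
  have h3 := diagScal_sub_ge (w := bracketSq gB v) (fun i j k => sq_nonneg _) H.bracketSq_comm (H.sum_bracketSq hρ hv)
    hsum hε1 hsmall
  have h4 : 0 ≤ ∑ i, a i ^ 2 := Finset.sum_nonneg fun i _ => sq_nonneg _
  have h5 : 4 * ε * ∑ i, a i ^ 2 ≤ diagHess (bracketSq gB v) a :=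
    (mul_le_mul_of_nonneg_right hε2 h4).trans hQ
  have h6 : 0 ≤ 3 * ε * diagHess (bracketSq gB v) a :=
    mul_nonneg (by linarith) ((by positivity : 0 ≤ 4 * ε * ∑ i, a i ^ 2).trans h5)
  rw [h1, h2]
  linarith

end IsStandard

end ReductiveDecomp

/-! ### Brackets and adjoint action of a local group. -/

section LocalGroup

open Filter Topology

variable {E : Type*} [NormedAddCommGroup E] [NormedSpace ℝ E]

theorem hasFDerivAt_partial_snd {F : E × E → E} {a : E} (hF : ContDiffAt ℝ 2 F (a, a)) (w : E) :
    HasFDerivAt (fun y => fderiv ℝ F (y, a) (0, w))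
      (((fderiv ℝ (fderiv ℝ F) (a, a)).flip (0, w)).comp (ContinuousLinearMap.inl ℝ E E)) a := by
  have h1 : DifferentiableAt ℝ (fderiv ℝ F) (a, a) :=
    (hF.fderiv_right (m := 1) (by norm_num)).differentiableAt (by norm_num)
  have h2 : HasFDerivAt (fun y : E => (y, a)) (ContinuousLinearMap.inl ℝ E E) a :=
    hasFDerivAt_prodMk_left a a
  have h3 := HasFDerivAt.comp (f := fun y : E => (y, a)) a h1.hasFDerivAt h2
  refine (h3.clm_apply (hasFDerivAt_const ((0 : E), w) a)).congr_fderiv ?_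
  ext v
  simp

theorem hasFDerivAt_partial_fst {F : E × E → E} {a : E} (hF : ContDiffAt ℝ 2 F (a, a)) :
    HasFDerivAt (fun y => (fderiv ℝ F (a, y)).comp (ContinuousLinearMap.inl ℝ E E))
      ((((ContinuousLinearMap.compL ℝ E (E × E) E).flip (ContinuousLinearMap.inl ℝ E E)).comp
        (fderiv ℝ (fderiv ℝ F) (a, a))).comp (ContinuousLinearMap.inr ℝ E E)) a := by
  have h1 : DifferentiableAt ℝ (fderiv ℝ F) (a, a) :=
    (hF.fderiv_right (m := 1) (by norm_num)).differentiableAt (by norm_num)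
  have h2 : HasFDerivAt (fun y : E => (a, y)) (ContinuousLinearMap.inr ℝ E E) a :=
    hasFDerivAt_prodMk_right a a
  have h3 := HasFDerivAt.comp (f := fun y : E => (a, y)) a h1.hasFDerivAt h2
  exact (((ContinuousLinearMap.compL ℝ E (E × E) E).flip
    (ContinuousLinearMap.inl ℝ E E)).hasFDerivAt.comp a h3)

/-- The bracket of the local group with multiplication `F` and unit `a`. -/
def localBracket (F : E × E → E) (a v w : E) : E :=
  fderiv ℝ (fderiv ℝ F) (a, a) (v, 0) (0, w) - fderiv ℝ (fderiv ℝ F) (a, a) (w, 0) (0, v)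

theorem fderiv_fderiv_swap {F : E × E → E} {a : E} (hF : ContDiffAt ℝ 2 F (a, a)) (p q : E × E) :
    fderiv ℝ (fderiv ℝ F) (a, a) p q = fderiv ℝ (fderiv ℝ F) (a, a) q p :=
  (hF.isSymmSndFDerivAt (by simp)) p q

theorem fderiv_snd_of_left_unit {F : E × E → E} {a : E} (hF : ContDiffAt ℝ 2 F (a, a))
    (hFl : ∀ᶠ y in 𝓝 a, F (a, y) = y) (w : E) : fderiv ℝ F (a, a) (0, w) = w := by
  have h := HasFDerivAt.comp (g := F) (f := fun y : E => (a, y)) a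
    (hF.differentiableAt (by norm_num)).hasFDerivAt (hasFDerivAt_prodMk_right a a)
  have h' : HasFDerivAt (fun y => F (a, y)) (ContinuousLinearMap.id ℝ E) a :=
    (hasFDerivAt_id a).congr_of_eventuallyEq hFl
  simpa using congrArg (fun T => T w) (h.unique h')

theorem fderiv_fst_of_right_unit {F : E × E → E} {a : E} (hF : ContDiffAt ℝ 2 F (a, a))
    (hFr : ∀ᶠ y in 𝓝 a, F (y, a) = y) (w : E) : fderiv ℝ F (a, a) (w, 0) = w := by
  have h := HasFDerivAt.comp (g := F) (f := fun y : E => (y, a)) a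
    (hF.differentiableAt (by norm_num)).hasFDerivAt (hasFDerivAt_prodMk_left a a)
  have h' : HasFDerivAt (fun y => F (y, a)) (ContinuousLinearMap.id ℝ E) a :=
    (hasFDerivAt_id a).congr_of_eventuallyEq hFr
  simpa using congrArg (fun T => T w) (h.unique h')

/-- The differential of a local automorphism preserves the bracket. -/
theorem localBracket_map {F : E × E → E} {a : E} (hF : ContDiffAt ℝ 2 F (a, a))
    (hFl : ∀ᶠ y in 𝓝 a, F (a, y) = y) (hFr : ∀ᶠ y in 𝓝 a, F (y, a) = y)
    {C : E → E} (hC : ContDiffAt ℝ 2 C a) (hCa : C a = a)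
    (hhom : ∀ᶠ p in 𝓝 (a, a), C (F p) = F (C p.1, C p.2)) (v w : E) :
    fderiv ℝ C a (localBracket F a v w) = localBracket F a (fderiv ℝ C a v) (fderiv ℝ C a w) := by
  have hC1 : DifferentiableAt ℝ (fderiv ℝ C) a :=
    (hC.fderiv_right (m := 1) (by norm_num)).differentiableAt (by norm_num)
  have hCd : ∀ᶠ y in 𝓝 a, DifferentiableAt ℝ C y := by
    filter_upwards [hC.eventually (by simp)] with y hy using hy.differentiableAt (by norm_num)
  have hFd : ∀ᶠ p in 𝓝 (a, a), DifferentiableAt ℝ F p := by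
    filter_upwards [hF.eventually (by simp)] with y hy using hy.differentiableAt (by norm_num)
  have t1 : Tendsto (fun y : E => (y, a)) (𝓝 a) (𝓝 (a, a)) :=
    (Continuous.prodMk_left a).tendsto a
  have t2 : Tendsto (fun y : E => (C y, a)) (𝓝 a) (𝓝 (a, a)) := by
    have := hC.continuousAt.tendsto
    rw [hCa] at this
    exact this.prodMk_nhds tendsto_const_nhds
  -- Differentiate `C (F (y, x)) = F (C y, C x)` in `x` at the unit; `second` then differentiates
  -- the result in `y`.
  have key : ∀ w, ∀ᶠ y in 𝓝 a, fderiv ℝ C y (fderiv ℝ F (y, a) (0, w)) =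
      fderiv ℝ F (C y, a) (0, fderiv ℝ C a w) := by
    intro w
    filter_upwards [hCd, t1.eventually hFd, t2.eventually hFd, hFr,
      t1.eventually hhom.eventually_nhds] with y h1 h2 h3 h4 h5
    have hin : HasFDerivAt (fun x : E => (y, x)) (ContinuousLinearMap.inr ℝ E E) a :=
      hasFDerivAt_prodMk_right y a
    have l : HasFDerivAt (fun x => C (F (y, x)))
        ((fderiv ℝ C y).comp ((fderiv ℝ F (y, a)).comp (ContinuousLinearMap.inr ℝ E E))) a := by
      refine HasFDerivAt.comp (g := C) a ?_ (HasFDerivAt.comp (g := F) a h2.hasFDerivAt hin)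
      rw [h4]
      exact h1.hasFDerivAt
    have r : HasFDerivAt (fun x => F (C y, C x))
        ((fderiv ℝ F (C y, a)).comp ((ContinuousLinearMap.inr ℝ E E).comp (fderiv ℝ C a))) a := by
      refine HasFDerivAt.comp (g := F) (f := fun x => (C y, C x)) a ?_ ?_
      · simp only [hCa]
        exact h3.hasFDerivAt
      · have : HasFDerivAt (fun x : E => (C y, x)) (ContinuousLinearMap.inr ℝ E E) (C a) :=
          hasFDerivAt_prodMk_right _ _
        exact this.comp a (hC.differentiableAt (by norm_num)).hasFDerivAt
    have h6 : (fun x => C (F (y, x))) =ᶠ[𝓝 a] fun x => F (C y, C x) := by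
      have t3 : Tendsto (fun x : E => (y, x)) (𝓝 a) (𝓝 (y, a)) :=
        (Continuous.prodMk_right y).tendsto a
      exact t3.eventually h5
    have := (r.congr_of_eventuallyEq h6).unique l
    have := congrArg (fun T => T w) this
    simpa using this.symm
  have second : ∀ v w, fderiv ℝ (fderiv ℝ C) a v w +
      fderiv ℝ C a (fderiv ℝ (fderiv ℝ F) (a, a) (v, 0) (0, w)) =
      fderiv ℝ (fderiv ℝ F) (a, a) (fderiv ℝ C a v, 0) (0, fderiv ℝ C a w) := by
    intro v w
    have hw : fderiv ℝ F (a, a) (0, w) = w := fderiv_snd_of_left_unit hF hFl w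
    have l := hC1.hasFDerivAt.clm_apply (hasFDerivAt_partial_snd hF w)
    have r0 := hasFDerivAt_partial_snd hF (fderiv ℝ C a w)
    have r : HasFDerivAt (fun y => fderiv ℝ F (C y, a) (0, fderiv ℝ C a w)) _ a :=
      HasFDerivAt.comp (f := C) (g := fun y => fderiv ℝ F (y, a) (0, fderiv ℝ C a w)) a
        (by rw [hCa]; exact r0) (hC.differentiableAt (by norm_num)).hasFDerivAt
    have := (r.congr_of_eventuallyEq (key w)).unique l
    have := congrArg (fun T => T v) this
    simp [hw] at this
    rw [this]
    abel
  -- The second derivative of `C` is symmetric, so it drops out when the identity is antisymmetrised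
  -- in `v`, `w`.
  have hs : fderiv ℝ (fderiv ℝ C) a v w = fderiv ℝ (fderiv ℝ C) a w v :=
    (hC.isSymmSndFDerivAt (by simp)) v w
  rw [localBracket, localBracket, ← second v w, ← second w v, hs, map_sub]
  abel

/-- The differential of the adjoint representation of a local group is the bracket; the curve
`U` is `t ↦ Ad(g(t)) w`. -/
theorem hasDerivAt_localAd [CompleteSpace E] {F : E × E → E} {a : E}
    (hF : ContDiffAt ℝ 2 F (a, a))
    (hFl : ∀ᶠ y in 𝓝 a, F (a, y) = y) (hFr : ∀ᶠ y in 𝓝 a, F (y, a) = y)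
    {g : ℝ → E} {z : E} (hg : HasDerivAt g z 0) (hg0 : g 0 = a) {U : ℝ → E} {w : E}
    (hU : ∀ᶠ t in 𝓝 0, fderiv ℝ F (a, g t) (U t, 0) = fderiv ℝ F (g t, a) (0, w)) :
    HasDerivAt U (localBracket F a z w) 0 := by
  subst hg0
  -- `hU` reads `N (g t) (U t) = ∂₂F(g t, a) w`. Since `N` is the identity at the unit, it is
  -- invertible nearby, and `U` can be solved for and differentiated.
  set N : E → E →L[ℝ] E := fun y => (fderiv ℝ F (g 0, y)).comp (ContinuousLinearMap.inl ℝ E E)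
    with hN
  have hNa : N (g 0) = ((1 : (E →L[ℝ] E)ˣ) : E →L[ℝ] E) := by
    ext v
    simpa [hN] using fderiv_fst_of_right_unit hF hFr v
  have hNg : HasDerivAt (fun t => N (g t)) _ 0 :=
    (hasFDerivAt_partial_fst hF).comp_hasDerivAt (0 : ℝ) hg
  have hMg : HasDerivAt (fun t => fderiv ℝ F (g t, g 0) (0, w)) _ 0 :=
    (hasFDerivAt_partial_snd hF w).comp_hasDerivAt (0 : ℝ) hg
  have hinv := hasFDerivAt_ringInverse (𝕜 := ℝ) (1 : (E →L[ℝ] E)ˣ)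
  rw [← hNa] at hinv
  have hI := HasFDerivAt.comp_hasDerivAt (f := fun t => N (g t)) (0 : ℝ) hinv hNg
  have hprod := hI.clm_apply hMg
  have hev : U =ᶠ[𝓝 0] fun t => Ring.inverse (N (g t)) (fderiv ℝ F (g t, g 0) (0, w)) := by
    have hc : ContinuousAt (fun t => N (g t)) 0 := hNg.continuousAt
    have ho : ∀ᶠ t in 𝓝 (0 : ℝ), IsUnit (N (g t)) := by
      apply hc.eventually (p := fun T => IsUnit T)
      simp only [hNa]
      exact Units.isOpen.mem_nhds (Units.isUnit 1)
    filter_upwards [hU, ho] with t h1 h2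
    rw [← h1]
    have := Ring.inverse_mul_cancel _ h2
    have := congrArg (fun T => T (U t)) this
    simpa [hN] using this.symm
  refine (hprod.congr_of_eventuallyEq hev).congr_deriv ?_
  rw [localBracket]
  simp only [Function.comp_apply, hNa]
  simp [fderiv_snd_of_left_unit hF hFl]
  rw [fderiv_fderiv_swap hF (0, z)]
  abel

end LocalGroup

/-! ### The Lie group in the chart at the identity. -/

section ChartGroup

open Filter Topology VectorField

variable {E : Type*} [NormedAddCommGroup E] [NormedSpace ℝ E] [FiniteDimensional ℝ E]
  {G : Type*} [TopologicalSpace G] [ChartedSpace E G] [Group G] [LieGroup 𝓘(ℝ, E) ∞ G]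

variable (E G) in
/-- The multiplication of a Lie group in the chart at the identity. -/
def chartMul (p : E × E) : E :=
  extChartAt 𝓘(ℝ, E) (1 : G) ((extChartAt 𝓘(ℝ, E) (1 : G)).symm p.1 *
    (extChartAt 𝓘(ℝ, E) (1 : G)).symm p.2)

variable (E G) in
/-- The identity of a Lie group in the chart at the identity. -/
def chartOne : E := extChartAt 𝓘(ℝ, E) (1 : G) 1

omit [FiniteDimensional ℝ E] [LieGroup 𝓘(ℝ, E) ∞ G] in
theorem extChartAt_symm_chartOne : (extChartAt 𝓘(ℝ, E) (1 : G)).symm (chartOne E G) = 1 :=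
  extChartAt_to_inv (1 : G)

omit [FiniteDimensional ℝ E] in
theorem contMDiffAt_extChartAt_one_symm :
    ContMDiffAt 𝓘(ℝ, E) 𝓘(ℝ, E) ∞ (extChartAt 𝓘(ℝ, E) (1 : G)).symm (chartOne E G) :=
  (contMDiffOn_extChartAt_symm (1 : G)).contMDiffAt (extChartAt_target_mem_nhds (1 : G))

omit [FiniteDimensional ℝ E] [LieGroup 𝓘(ℝ, E) ∞ G] in
theorem contMDiffAt_extChartAt_one {g : G} (hg : g = 1) :
    ContMDiffAt 𝓘(ℝ, E) 𝓘(ℝ, E) ∞ (extChartAt 𝓘(ℝ, E) (1 : G)) g := by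
  subst hg
  exact contMDiffAt_extChartAt

omit [FiniteDimensional ℝ E] in
theorem contDiffAt_chartMul : ContDiffAt ℝ 2 (chartMul E G) (chartOne E G, chartOne E G) := by
  have h : ContMDiffAt 𝓘(ℝ, E × E) 𝓘(ℝ, E) ∞ (chartMul E G) (chartOne E G, chartOne E G) := by
    have h1 : ContMDiffAt 𝓘(ℝ, E × E) 𝓘(ℝ, E) ∞
        (fun p : E × E => (extChartAt 𝓘(ℝ, E) (1 : G)).symm p.1) (chartOne E G, chartOne E G) :=
      ContMDiffAt.comp (g := (extChartAt 𝓘(ℝ, E) (1 : G)).symm) (chartOne E G, chartOne E G)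
        contMDiffAt_extChartAt_one_symm contDiff_fst.contMDiff.contMDiffAt
    have h2 : ContMDiffAt 𝓘(ℝ, E × E) 𝓘(ℝ, E) ∞
        (fun p : E × E => (extChartAt 𝓘(ℝ, E) (1 : G)).symm p.2) (chartOne E G, chartOne E G) :=
      ContMDiffAt.comp (g := (extChartAt 𝓘(ℝ, E) (1 : G)).symm) (chartOne E G, chartOne E G)
        contMDiffAt_extChartAt_one_symm contDiff_snd.contMDiff.contMDiffAt
    exact ContMDiffAt.comp (g := extChartAt 𝓘(ℝ, E) (1 : G)) (chartOne E G, chartOne E G)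
      (contMDiffAt_extChartAt_one (by simp only [extChartAt_symm_chartOne, mul_one])) (h1.mul h2)
  exact h.contDiffAt.of_le ENat.LEInfty.out

omit [FiniteDimensional ℝ E] [LieGroup 𝓘(ℝ, E) ∞ G] in
theorem chartMul_left_unit : ∀ᶠ y in 𝓝 (chartOne E G), chartMul E G (chartOne E G, y) = y := by
  filter_upwards [extChartAt_target_mem_nhds (I := 𝓘(ℝ, E)) (1 : G)] with y hy
  simp only [chartMul, extChartAt_symm_chartOne, one_mul]
  exact PartialEquiv.right_inv _ hy

omit [FiniteDimensional ℝ E] [LieGroup 𝓘(ℝ, E) ∞ G] in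
theorem chartMul_right_unit : ∀ᶠ y in 𝓝 (chartOne E G), chartMul E G (y, chartOne E G) = y := by
  filter_upwards [extChartAt_target_mem_nhds (I := 𝓘(ℝ, E)) (1 : G)] with y hy
  simp only [chartMul, extChartAt_symm_chartOne, mul_one]
  exact PartialEquiv.right_inv _ hy

omit [FiniteDimensional ℝ E] [LieGroup 𝓘(ℝ, E) ∞ G] in
theorem mfderiv_eq_fderiv_chart {f : G → G} (hf : ContMDiffAt 𝓘(ℝ, E) 𝓘(ℝ, E) ∞ f 1)
    (hf1 : f 1 = 1) :
    (show E →L[ℝ] E from mfderiv 𝓘(ℝ, E) 𝓘(ℝ, E) f 1) = fderiv ℝ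
      (fun x => extChartAt 𝓘(ℝ, E) (1 : G) (f ((extChartAt 𝓘(ℝ, E) (1 : G)).symm x)))
      (chartOne E G) := by
  have hd := hf.mdifferentiableAt (by simp)
  simp only [mfderiv, hd, writtenInExtChartAt, hf1]
  simp [fderivWithin_univ, chartOne]
  rfl

omit [FiniteDimensional ℝ E] [LieGroup 𝓘(ℝ, E) ∞ G] in
theorem deriv_chart_curve {γ : ℝ → G} (hγ : ContMDiff 𝓘(ℝ, ℝ) 𝓘(ℝ, E) ∞ γ) (h0 : γ 0 = 1) :
    HasDerivAt (fun t => extChartAt 𝓘(ℝ, E) (1 : G) (γ t))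
      (show E from mfderiv 𝓘(ℝ, ℝ) 𝓘(ℝ, E) γ 0 (1 : ℝ)) 0 := by
  have hd := hγ.contMDiffAt.mdifferentiableAt (x := 0) (by simp)
  have hc : ContMDiffAt 𝓘(ℝ, ℝ) 𝓘(ℝ, E) ∞ (fun t => extChartAt 𝓘(ℝ, E) (1 : G) (γ t)) 0 :=
    ContMDiffAt.comp (g := extChartAt 𝓘(ℝ, E) (1 : G)) 0 (contMDiffAt_extChartAt_one h0)
      hγ.contMDiffAt
  have := (hc.contDiffAt.differentiableAt (by simp)).hasDerivAt
  refine this.congr_deriv ?_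
  simp only [mfderiv, hd, writtenInExtChartAt, h0]
  simp [fderivWithin_univ]
  rfl

omit [FiniteDimensional ℝ E] [LieGroup 𝓘(ℝ, E) ∞ G] in
theorem hasMFDerivAt_extChartAt_one :
    HasMFDerivAt 𝓘(ℝ, E) 𝓘(ℝ, E) (extChartAt 𝓘(ℝ, E) (1 : G)) 1
      (ContinuousLinearMap.id ℝ E) := by
  refine ⟨continuousAt_extChartAt (1 : G), ?_⟩
  refine ((hasFDerivAt_id _).congr_of_eventuallyEq ?_).hasFDerivWithinAt
  filter_upwards [extChartAt_target_mem_nhds (I := 𝓘(ℝ, E)) (1 : G)] with x hx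
  exact PartialEquiv.right_inv _ hx

omit [FiniteDimensional ℝ E] in
-- In the chart, left translation by the point with coordinate `y` is `x ↦ chartMul (y, x)`. Its
-- derivative at the unit gives the left-invariant field, which expresses the Lie bracket through
-- second derivatives of the multiplication.
theorem mulInvariantVectorField_chart (v : GroupLieAlgebra 𝓘(ℝ, E) G) :
    ∀ᶠ y in 𝓝 (chartOne E G), (mpullbackWithin 𝓘(ℝ, E) 𝓘(ℝ, E) (extChartAt 𝓘(ℝ, E) (1 : G)).symm
      (mulInvariantVectorField v) (Set.range 𝓘(ℝ, E)) y : E) =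
      fderiv ℝ (chartMul E G) (y, chartOne E G) (0, (v : E)) := by
  have : IsManifold 𝓘(ℝ, E) 1 G := IsManifold.of_le (n := ∞) (by simp)
  have t1 : Tendsto (fun y : E => (y, chartOne E G)) (𝓝 (chartOne E G))
    (𝓝 (chartOne E G, chartOne E G)) := (Continuous.prodMk_left _).tendsto _
  have hFd : ∀ᶠ p in 𝓝 (chartOne E G, chartOne E G), DifferentiableAt ℝ (chartMul E G) p := by
    filter_upwards [(contDiffAt_chartMul (E := E) (G := G)).eventually (by simp)] with y hy
      using hy.differentiableAt (by norm_num)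
  filter_upwards [extChartAt_target_mem_nhds (I := 𝓘(ℝ, E)) (1 : G), t1.eventually hFd,
    chartMul_right_unit (E := E) (G := G)] with y hy h1 hr
  set g := (extChartAt 𝓘(ℝ, E) (1 : G)).symm y with hg
  have a2 : HasMFDerivAt 𝓘(ℝ, E) 𝓘(ℝ, E) (fun x => chartMul E G (y, x)) (chartOne E G)
      ((fderiv ℝ (chartMul E G) (y, chartOne E G)).comp (ContinuousLinearMap.inr ℝ E E)) :=
    (HasFDerivAt.comp (g := chartMul E G) (chartOne E G) h1.hasFDerivAt
      (hasFDerivAt_prodMk_right y (chartOne E G))).hasMFDerivAt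
  have a3 : HasMFDerivAt 𝓘(ℝ, E) 𝓘(ℝ, E) (extChartAt 𝓘(ℝ, E) (1 : G)).symm
      (chartMul E G (y, chartOne E G))
      (mfderiv 𝓘(ℝ, E) 𝓘(ℝ, E) (extChartAt 𝓘(ℝ, E) (1 : G)).symm y) := by
    rw [hr]
    exact (((contMDiffOn_extChartAt_symm (n := ∞) (1 : G)).contMDiffAt
      ((isOpen_extChartAt_target (1 : G)).mem_nhds hy)).mdifferentiableAt (by simp)).hasMFDerivAt
  have a4 := HasMFDerivAt.comp (g := (extChartAt 𝓘(ℝ, E) (1 : G)).symm)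
     (f := fun x => chartMul E G (y, extChartAt 𝓘(ℝ, E) (1 : G) x)) (1 : G) a3
     (HasMFDerivAt.comp (g := fun x => chartMul E G (y, x))
        (f := extChartAt 𝓘(ℝ, E) (1 : G)) (1 : G) a2 hasMFDerivAt_extChartAt_one)
  have a5 : (fun x => g * x) =ᶠ[𝓝 1] (extChartAt 𝓘(ℝ, E) (1 : G)).symm ∘
      (fun x => chartMul E G (y, extChartAt 𝓘(ℝ, E) (1 : G) x)) := by
    have hgs : g * 1 ∈ (extChartAt 𝓘(ℝ, E) (1 : G)).source := by
      rw [mul_one]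
      exact (extChartAt 𝓘(ℝ, E) (1 : G)).map_target hy
    have hmul : ContinuousAt (fun x : G => g * x) 1 :=
      (contMDiff_mul_left (I := 𝓘(ℝ, E)) (n := ∞)).continuous.continuousAt
    filter_upwards [hmul.preimage_mem_nhds ((isOpen_extChartAt_source (1 : G)).mem_nhds hgs),
      extChartAt_source_mem_nhds (I := 𝓘(ℝ, E)) (1 : G)] with x hx1 hx2
    simp only [Function.comp_apply, chartMul]
    rw [PartialEquiv.left_inv _ hx2, PartialEquiv.left_inv _ hx1]
  have a6 := (a4.congr_of_eventuallyEq a5).mfderiv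
  have a7 : (mfderiv 𝓘(ℝ, E) 𝓘(ℝ, E) (fun x => g * x) 1 v : E) =
      mfderiv 𝓘(ℝ, E) 𝓘(ℝ, E) (extChartAt 𝓘(ℝ, E) (1 : G)).symm y
        (fderiv ℝ (chartMul E G) (y, chartOne E G) (0, (v : E))) := by
    rw [a6]
    rfl
  have hinv := isInvertible_mfderivWithin_extChartAt_symm (I := 𝓘(ℝ, E)) hy
  refine hinv.inverse_apply_eq.2 (a7.trans ?_)
  rw [modelWithCornersSelf_coe, Set.range_id, mfderivWithin_univ]

omit [FiniteDimensional ℝ E] in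
theorem lieBracket_eq_localBracket {V W : E → E} {v w : E}
    (hv : ∀ᶠ y in 𝓝 (chartOne E G), V y = fderiv ℝ (chartMul E G) (y, chartOne E G) (0, v))
    (hw : ∀ᶠ y in 𝓝 (chartOne E G), W y = fderiv ℝ (chartMul E G) (y, chartOne E G) (0, w)) :
    lieBracket ℝ V W (chartOne E G) = localBracket (chartMul E G) (chartOne E G) v w := by
  have hF := contDiffAt_chartMul (E := E) (G := G)
  have hl := chartMul_left_unit (E := E) (G := G)
  rw [lieBracket_eq]
  simp only
  rw [((hasFDerivAt_partial_snd hF v).congr_of_eventuallyEq hv).fderiv,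
    ((hasFDerivAt_partial_snd hF w).congr_of_eventuallyEq hw).fderiv,
    hv.self_of_nhds, hw.self_of_nhds, fderiv_snd_of_left_unit hF hl,
    fderiv_snd_of_left_unit hF hl]
  rfl

omit [FiniteDimensional ℝ E] in
/-- The bracket of the Lie algebra of a Lie group, in the chart at the identity. -/
theorem bracket_eq_localBracket (v w : GroupLieAlgebra 𝓘(ℝ, E) G) :
    (⁅v, w⁆ : GroupLieAlgebra 𝓘(ℝ, E) G) =
      localBracket (chartMul E G) (chartOne E G) (v : E) (w : E) := by
  have hv := mulInvariantVectorField_chart v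
  have hw := mulInvariantVectorField_chart w
  rw [GroupLieAlgebra.bracket_def, mlieBracket, mlieBracketWithin_apply,
    (hasMFDerivAt_extChartAt_one (E := E) (G := G)).mfderiv]
  simp only [Set.preimage_univ, Set.univ_inter, modelWithCornersSelf_coe, Set.range_id] at hv hw ⊢
  exact (congrArg (fun T : E →L[ℝ] E => T (lieBracketWithin ℝ _ _ Set.univ (chartOne E G)))
    (ContinuousLinearMap.inverse_id (R := ℝ) (M := E))).trans
    ((congrFun lieBracketWithin_univ (chartOne E G)).trans
      (lieBracket_eq_localBracket hv hw))

omit [FiniteDimensional ℝ E] in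
theorem conj_mem_source (k : G) : ∀ᶠ x in 𝓝 (chartOne E G),
    k * (extChartAt 𝓘(ℝ, E) (1 : G)).symm x * k⁻¹ ∈ (extChartAt 𝓘(ℝ, E) (1 : G)).source := by
  have hc := (contMDiffAt_extChartAt_one_symm (E := E) (G := G)).continuousAt
  have : IsTopologicalGroup G := topologicalGroup_of_lieGroup 𝓘(ℝ, E) ∞
  have hc2 : ContinuousAt (fun x => k * (extChartAt 𝓘(ℝ, E) (1 : G)).symm x * k⁻¹)
      (chartOne E G) := (continuousAt_const.mul hc).mul continuousAt_const
  refine hc2.eventually ((isOpen_extChartAt_source (1 : G)).mem_nhds ?_)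
  simp only [extChartAt_symm_chartOne, mul_one, mul_inv_cancel]
  exact mem_extChartAt_source _

omit [FiniteDimensional ℝ E] in
theorem conj_chartMul (k : G) : ∀ᶠ p in 𝓝 (chartOne E G, chartOne E G),
    extChartAt 𝓘(ℝ, E) (1 : G) (k * (extChartAt 𝓘(ℝ, E) (1 : G)).symm (chartMul E G p) * k⁻¹) =
    chartMul E G (extChartAt 𝓘(ℝ, E) (1 : G) (k * (extChartAt 𝓘(ℝ, E) (1 : G)).symm p.1 * k⁻¹),
      extChartAt 𝓘(ℝ, E) (1 : G) (k * (extChartAt 𝓘(ℝ, E) (1 : G)).symm p.2 * k⁻¹)) := by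
  have hc := (contMDiffAt_extChartAt_one_symm (E := E) (G := G)).continuousAt
  have : IsTopologicalGroup G := topologicalGroup_of_lieGroup 𝓘(ℝ, E) ∞
  have h1 : Tendsto (fun p : E × E => p.1) (𝓝 (chartOne E G, chartOne E G)) (𝓝 (chartOne E G)) :=
    continuous_fst.tendsto _
  have h2 : Tendsto (fun p : E × E => p.2) (𝓝 (chartOne E G, chartOne E G)) (𝓝 (chartOne E G)) :=
    continuous_snd.tendsto _
  have hs : ∀ᶠ p : E × E in 𝓝 (chartOne E G, chartOne E G),
      (extChartAt 𝓘(ℝ, E) (1 : G)).symm p.1 * (extChartAt 𝓘(ℝ, E) (1 : G)).symm p.2 ∈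
        (extChartAt 𝓘(ℝ, E) (1 : G)).source := by
    have := (hc.tendsto.comp h1).mul (hc.tendsto.comp h2)
    refine this.eventually ((isOpen_extChartAt_source (1 : G)).mem_nhds ?_)
    simp only [extChartAt_symm_chartOne, mul_one]
    exact mem_extChartAt_source _
  filter_upwards [hs, h1.eventually (conj_mem_source k), h2.eventually (conj_mem_source k)]
    with p p1 p2 p3
  simp only [chartMul]
  rw [PartialEquiv.left_inv _ p1, PartialEquiv.left_inv _ p2, PartialEquiv.left_inv _ p3]
  congr 1
  group

omit [FiniteDimensional ℝ E] in
theorem contMDiff_conj (k : G) : ContMDiff 𝓘(ℝ, E) 𝓘(ℝ, E) ∞ (fun x : G => k * x * k⁻¹) :=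
  (contMDiff_const.mul contMDiff_id).mul contMDiff_const

omit [FiniteDimensional ℝ E] in
theorem contDiffAt_conj_chart (k : G) : ContDiffAt ℝ ∞ (fun x => extChartAt 𝓘(ℝ, E) (1 : G)
    (k * (extChartAt 𝓘(ℝ, E) (1 : G)).symm x * k⁻¹)) (chartOne E G) := by
  refine ContMDiffAt.contDiffAt ?_
  refine ContMDiffAt.comp (g := extChartAt 𝓘(ℝ, E) (1 : G)) (chartOne E G)
    (contMDiffAt_extChartAt_one (by simp only [extChartAt_symm_chartOne, mul_one,
      mul_inv_cancel])) ?_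
  exact ContMDiffAt.comp (g := fun x : G => k * x * k⁻¹) (chartOne E G)
    (contMDiff_conj k).contMDiffAt contMDiffAt_extChartAt_one_symm

omit [FiniteDimensional ℝ E] in
theorem adjointRep_apply_chart (k : G) (v : GroupLieAlgebra 𝓘(ℝ, E) G) :
    adjointRep k v = fderiv ℝ (fun x => extChartAt 𝓘(ℝ, E) (1 : G)
      (k * (extChartAt 𝓘(ℝ, E) (1 : G)).symm x * k⁻¹)) (chartOne E G) (v : E) := by
  rw [← mfderiv_eq_fderiv_chart (contMDiff_conj k).contMDiffAt (by simp)]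
  rfl

theorem adjointRep_lie (k : G) (v w : GroupLieAlgebra 𝓘(ℝ, E) G) :
    (adjointRep k ⁅v, w⁆ : GroupLieAlgebra 𝓘(ℝ, E) G) = ⁅adjointRep k v, adjointRep k w⁆ := by
  have := localBracket_map (contDiffAt_chartMul (E := E) (G := G)) chartMul_left_unit
    chartMul_right_unit ((contDiffAt_conj_chart k).of_le ENat.LEInfty.out)
    (by simp only [extChartAt_symm_chartOne, mul_one, mul_inv_cancel]; rfl) (conj_chartMul k) v w
  refine (adjointRep_apply_chart (E := E) k _).trans
    (Eq.trans ?_ (bracket_eq_localBracket (E := E) _ _).symm)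
  rw [adjointRep_apply_chart (E := E) k v, adjointRep_apply_chart (E := E) k w, bracket_eq_localBracket]
  exact this

omit [FiniteDimensional ℝ E] in
theorem adjointRep_inv_apply (k : G) (v : GroupLieAlgebra 𝓘(ℝ, E) G) :
    adjointRep k (adjointRep k⁻¹ v) = v := by
  refine (adjointRep_apply_chart k _).trans ?_
  rw [adjointRep_apply_chart k⁻¹ v]
  have h1 := ((contDiffAt_conj_chart (E := E) k⁻¹).differentiableAt (by simp)).hasFDerivAt
  have h2 := ((contDiffAt_conj_chart (E := E) k).differentiableAt (by simp)).hasFDerivAt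
  have e : extChartAt 𝓘(ℝ, E) (1 : G) (k⁻¹ * (extChartAt 𝓘(ℝ, E) (1 : G)).symm (chartOne E G) *
      k⁻¹⁻¹) = chartOne E G := by
    simp only [extChartAt_symm_chartOne, mul_one, mul_inv_cancel]
    rfl
  rw [← e] at h2
  have h3 := HasFDerivAt.comp (g := fun x => extChartAt 𝓘(ℝ, E) (1 : G)
    (k * (extChartAt 𝓘(ℝ, E) (1 : G)).symm x * k⁻¹)) (chartOne E G) h2 h1
  have h4 : (fun x : E => x) =ᶠ[𝓝 (chartOne E G)] ((fun x => extChartAt 𝓘(ℝ, E) (1 : G)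
        (k * (extChartAt 𝓘(ℝ, E) (1 : G)).symm x * k⁻¹)) ∘
        fun x => extChartAt 𝓘(ℝ, E) (1 : G)
          (k⁻¹ * (extChartAt 𝓘(ℝ, E) (1 : G)).symm x * k⁻¹⁻¹)) := by
    filter_upwards [conj_mem_source (E := E) k⁻¹,
      extChartAt_target_mem_nhds (I := 𝓘(ℝ, E)) (1 : G)] with x hx1 hx2
    simp only [Function.comp_apply]
    rw [PartialEquiv.left_inv _ hx1]
    have : k * (k⁻¹ * (extChartAt 𝓘(ℝ, E) (1 : G)).symm x * k⁻¹⁻¹) * k⁻¹ =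
        (extChartAt 𝓘(ℝ, E) (1 : G)).symm x := by group
    rw [this, PartialEquiv.right_inv _ hx2]
  have h5 := (h3.congr_of_eventuallyEq h4).unique (hasFDerivAt_id _)
  rw [e] at h5
  exact congrArg (fun T : E →L[ℝ] E => T v) h5

/-- Differentiating `(γ x γ⁻¹) γ = γ x` in `x` at the identity gives the implicit equation required
by `hasDerivAt_localAd`. -/
theorem hasDerivAt_adjointRep {γ : ℝ → G} (hγ : ContMDiff 𝓘(ℝ, ℝ) 𝓘(ℝ, E) ∞ γ)
    (h0 : γ 0 = 1) {Z : GroupLieAlgebra 𝓘(ℝ, E) G}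
    (hZ : Z = (show E from mfderiv 𝓘(ℝ, ℝ) 𝓘(ℝ, E) γ 0 (1 : ℝ)))
    (w : GroupLieAlgebra 𝓘(ℝ, E) G) :
    HasDerivAt (fun t => (show E from adjointRep (γ t) w)) (show E from (⁅Z, w⁆ : GroupLieAlgebra 𝓘(ℝ, E) G)) 0 := by
  have hF := contDiffAt_chartMul (E := E) (G := G)
  have hγc := deriv_chart_curve hγ h0
  have := hasDerivAt_localAd hF chartMul_left_unit
    chartMul_right_unit hγc (by rw [h0]; rfl)
    (U := fun t => (show E from adjointRep (γ t) w)) (w := w) ?_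
  · rw [bracket_eq_localBracket, hZ]
    exact this
  · have hFd : ∀ᶠ p in 𝓝 (chartOne E G, chartOne E G), DifferentiableAt ℝ (chartMul E G) p := by
      filter_upwards [hF.eventually (by simp)] with y hy using hy.differentiableAt (by norm_num)
    have tγ : Tendsto (fun t => extChartAt 𝓘(ℝ, E) (1 : G) (γ t)) (𝓝 0) (𝓝 (chartOne E G)) := by
      have := hγc.continuousAt.tendsto
      rw [h0] at this
      exact this
    have hs : ∀ᶠ t in 𝓝 (0 : ℝ), γ t ∈ (extChartAt 𝓘(ℝ, E) (1 : G)).source := by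
      refine hγ.continuous.continuousAt.eventually
        ((isOpen_extChartAt_source (1 : G)).mem_nhds ?_)
      rw [h0]
      exact mem_extChartAt_source _
    filter_upwards [(tendsto_const_nhds.prodMk_nhds tγ).eventually hFd,
      (tγ.prodMk_nhds tendsto_const_nhds).eventually hFd, hs] with t d1 d2 hts
    have hC := ((contDiffAt_conj_chart (E := E) (γ t)).differentiableAt (by simp)).hasFDerivAt
    have l := HasFDerivAt.comp (g := chartMul E G) (chartOne E G)
      (f := fun x => (extChartAt 𝓘(ℝ, E) (1 : G)
        (γ t * (extChartAt 𝓘(ℝ, E) (1 : G)).symm x * (γ t)⁻¹),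
        extChartAt 𝓘(ℝ, E) (1 : G) (γ t)))
      (by
        simp only [extChartAt_symm_chartOne, mul_one, mul_inv_cancel]
        exact d1.hasFDerivAt)
      (hC.prodMk (hasFDerivAt_const _ _))
    have r := HasFDerivAt.comp (g := chartMul E G) (chartOne E G) d2.hasFDerivAt
      (hasFDerivAt_prodMk_right (extChartAt 𝓘(ℝ, E) (1 : G) (γ t)) (chartOne E G))
    have h4 : (chartMul E G ∘ fun x => (extChartAt 𝓘(ℝ, E) (1 : G) (γ t), x))
        =ᶠ[𝓝 (chartOne E G)] (chartMul E G ∘ fun x => (extChartAt 𝓘(ℝ, E) (1 : G)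
          (γ t * (extChartAt 𝓘(ℝ, E) (1 : G)).symm x * (γ t)⁻¹),
          extChartAt 𝓘(ℝ, E) (1 : G) (γ t))) := by
      filter_upwards [conj_mem_source (E := E) (γ t)] with x hx
      simp only [Function.comp_apply, chartMul]
      rw [PartialEquiv.left_inv _ hx, PartialEquiv.left_inv _ hts, inv_mul_cancel_right]
    have h5 := congrArg (fun T : E →L[ℝ] E => T w) ((l.congr_of_eventuallyEq h4).unique r)
    rw [adjointRep_apply_chart]
    exact h5

/-- Differentiate the hypothesis at `t = 0`. Allowing different maps and vectors on the two sides
serves both the invariance of `𝔭` and the commutation with `A`. -/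
theorem linearMap_lie_eq_of_adjointRep {γ : ℝ → G} (hγ : ContMDiff 𝓘(ℝ, ℝ) 𝓘(ℝ, E) ∞ γ)
    (h0 : γ 0 = 1) {Z : GroupLieAlgebra 𝓘(ℝ, E) G}
    (hZ : Z = (show E from mfderiv 𝓘(ℝ, ℝ) 𝓘(ℝ, E) γ 0 (1 : ℝ)))
    (f g : Module.End ℝ (GroupLieAlgebra 𝓘(ℝ, E) G)) (X Y : GroupLieAlgebra 𝓘(ℝ, E) G)
    (h : ∀ t, f (adjointRep (γ t) X) = g (adjointRep (γ t) Y)) : f ⁅Z, X⁆ = g ⁅Z, Y⁆ := by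
  have key : ∀ (f : E →ₗ[ℝ] E) (X : GroupLieAlgebra 𝓘(ℝ, E) G),
      HasDerivAt (fun t => f (show E from adjointRep (γ t) X))
        (f (show E from (⁅Z, X⁆ : GroupLieAlgebra 𝓘(ℝ, E) G))) 0 := fun f X =>
    (LinearMap.toContinuousLinearMap f).hasFDerivAt.comp_hasDerivAt (0 : ℝ)
      (hasDerivAt_adjointRep hγ h0 hZ X)
  have h1 := key f X
  have h2 := key g Y
  exact (h1.congr_of_eventuallyEq (Eventually.of_forall fun t => (h t).symm)).unique h2

/-- An operator on `𝔭` that commutes with `Ad(K)` commutes with `ad(𝔨)`. -/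
theorem ad_comm_of_adjointSet_comm (K : Subgroup G)
    (D : ReductiveDecomp (subgroupLieAlgebra (E := E) K) (adjointSet (E := E) K))
    (A : Module.End ℝ D.𝔭)
    (hA : ∀ φ, ∀ hφ : φ ∈ adjointSet (E := E) K,
      A ∘ₗ D.isotropy φ hφ = D.isotropy φ hφ ∘ₗ A) :
    ∀ Z ∈ subgroupLieAlgebra (E := E) K, ∀ X : D.𝔭,
      A (D.projP ⁅Z, (X : GroupLieAlgebra 𝓘(ℝ, E) G)⁆) =
        D.projP ⁅Z, (A X : GroupLieAlgebra 𝓘(ℝ, E) G)⁆ := by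
  have hproj : ∀ X : D.𝔭, D.projP (X : GroupLieAlgebra 𝓘(ℝ, E) G) = X := fun X =>
    Submodule.projectionOnto_apply_left _ X
  set T : Module.End ℝ (GroupLieAlgebra 𝓘(ℝ, E) G) := D.𝔭.subtype ∘ₗ A ∘ₗ D.projP with hT
  have hTX : ∀ X : D.𝔭, T X = A X := fun X => by simp [hT, hproj]
  set P : Module.End ℝ (GroupLieAlgebra 𝓘(ℝ, E) G) := D.𝔭.subtype ∘ₗ D.projP with hP
  have hPm : ∀ X ∈ D.𝔭, P X = X := fun X hX => by
    have := hproj ⟨X, hX⟩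
    simp [hP, this]
  have hPr : ∀ X, P X ∈ D.𝔭 := fun X => (D.projP X).2
  -- The induction carries `⁅Z, X⁆ ∈ 𝔭` along, because the step for brackets applies the hypothesis
  -- for `Z` to `⁅W, X⁆`, and conversely. `T` is `A` extended by zero on `𝔨`.
  have main : ∀ Z ∈ subgroupLieAlgebra (E := E) K,
      ∀ X ∈ D.𝔭, ⁅Z, X⁆ ∈ D.𝔭 ∧ T ⁅Z, X⁆ = ⁅Z, T X⁆ := by
    have hTm : ∀ X, T X ∈ D.𝔭 := fun X => (A (D.projP X)).2
    intro Z hZ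
    induction hZ using LieSubalgebra.lieSpan_induction with
    | mem Z hZ =>
      obtain ⟨γ, hγ, hadd, hK, hZ⟩ := hZ
      have h0 : γ 0 = 1 := by
        have := hadd 0 0
        rw [add_zero] at this
        exact left_eq_mul.1 this
      have hmem : ∀ t, adjointRep (γ t) ∈ adjointSet (E := E) K := fun t => ⟨γ t, hK t, rfl⟩
      intro X hX
      constructor
      · have := linearMap_lie_eq_of_adjointRep hγ h0 hZ P LinearMap.id X X fun t =>
          hPm _ (D.map_mem _ (hmem t) X hX)
        rw [LinearMap.id_apply] at this
        rw [← this]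
        exact hPr _
      · refine linearMap_lie_eq_of_adjointRep hγ h0 hZ T LinearMap.id X (T X) fun t => ?_
        have := LinearMap.congr_fun (hA _ (hmem t)) ⟨X, hX⟩
        have := congrArg (Subtype.val) this
        simp only [LinearMap.comp_apply] at this
        rw [← hTX] at this
        exact this.trans (congrArg (adjointRep (γ t)) (hTX ⟨X, hX⟩).symm)
    | zero => intro X hX; simp
    | smul c Z hZ ih =>
      intro X hX
      obtain ⟨h1, h2⟩ := ih X hX
      rw [smul_lie, smul_lie, map_smul, h2]
      exact ⟨D.𝔭.smul_mem _ h1, rfl⟩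
    | add Z W hZ hW ihZ ihW =>
      intro X hX
      obtain ⟨h1, h2⟩ := ihZ X hX
      obtain ⟨h3, h4⟩ := ihW X hX
      rw [add_lie, add_lie, map_add, h2, h4]
      exact ⟨D.𝔭.add_mem h1 h3, rfl⟩
    | lie Z W hZ hW ihZ ihW =>
      intro X hX
      obtain ⟨h1, h2⟩ := ihZ X hX
      obtain ⟨h3, h4⟩ := ihW X hX
      obtain ⟨h5, h6⟩ := ihZ _ h3
      obtain ⟨h7, h8⟩ := ihW _ h1
      rw [lie_lie, lie_lie, map_sub, h6, h8, h2, h4]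
      exact ⟨D.𝔭.sub_mem h5 h7, rfl⟩
  intro Z hZ X
  obtain ⟨h1, h2⟩ := main Z hZ X X.2
  apply Subtype.ext
  have e1 : ((D.projP ⁅Z, (A X : GroupLieAlgebra 𝓘(ℝ, E) G)⁆ : D.𝔭) :
      GroupLieAlgebra 𝓘(ℝ, E) G) = ⁅Z, (A X : GroupLieAlgebra 𝓘(ℝ, E) G)⁆ :=
    hPm _ (main Z hZ _ (A X).2).1
  rw [e1, ← hTX X, ← h2]
  rfl

theorem killingForm_adjointRep (k : G) (X Y : GroupLieAlgebra 𝓘(ℝ, E) G) :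
    killingForm ℝ (GroupLieAlgebra 𝓘(ℝ, E) G) (adjointRep k X) (adjointRep k Y) =
      killingForm ℝ (GroupLieAlgebra 𝓘(ℝ, E) G) X Y := by
  let e : GroupLieAlgebra 𝓘(ℝ, E) G ≃ₗ⁅ℝ⁆ GroupLieAlgebra 𝓘(ℝ, E) G :=
    { adjointRep k with
      map_lie' := fun {X Y} => adjointRep_lie k X Y
      invFun := adjointRep k⁻¹
      left_inv := fun X => by
        have := adjointRep_inv_apply k⁻¹ X
        rwa [inv_inv] at this
      right_inv := fun X => adjointRep_inv_apply k X }
  exact LieAlgebra.killingForm_of_equiv_apply e X Y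

end ChartGroup

theorem InnerProd.IsSymm.trace_mul_self_pos {V : Type*} [AddCommGroup V] [Module ℝ V]
    [FiniteDimensional ℝ V] {h : InnerProd V} {A : Module.End ℝ V} (hA : h.IsSymm A)
    (hA0 : A ≠ 0) : 0 < LinearMap.trace ℝ V (A * A) :=
  (h.traceProd (ℝ ∙ A) fun B hB => by
    obtain ⟨c, rfl⟩ := Submodule.mem_span_singleton.1 hB
    intro X Y
    simp [hA X Y]).pos ⟨A, Submodule.mem_span_singleton_self A⟩ fun h0 =>
      hA0 (congrArg Subtype.val h0)

theorem killingForm_neg_of_orthonormal {𝔤 : Type*} [LieRing 𝔤] [LieAlgebra ℝ 𝔤] {n : ℕ}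
    {e : Module.Basis (Fin n) ℝ 𝔤}
    (he : ∀ i j, -killingForm ℝ 𝔤 (e i) (e j) = if i = j then 1 else 0) {X : 𝔤} (hX : X ≠ 0) :
    killingForm ℝ 𝔤 X X < 0 := by
  have he' : ∀ i j, killingForm ℝ 𝔤 (e i) (e j) = if i = j then -1 else 0 := by
    intro i j
    rw [← neg_inj, he]
    split_ifs <;> simp
  have h1 : killingForm ℝ 𝔤 X X = -∑ i, e.repr X i ^ 2 := by
    conv_lhs => rw [← e.sum_repr X]
    simp only [map_sum, map_smul, LinearMap.sum_apply, LinearMap.smul_apply, he', smul_eq_mul,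
      mul_ite, mul_neg, mul_one, mul_zero, Finset.sum_ite_eq', Finset.mem_univ, if_true,
      Finset.sum_neg_distrib, sq]
  rw [h1, neg_lt_zero]
  refine (Finset.sum_nonneg fun i _ => sq_nonneg _).lt_of_ne fun h0 => hX ?_
  have h2 := (Finset.sum_eq_zero_iff_of_nonneg fun i _ => sq_nonneg (e.repr X i)).1 h0.symm
  exact e.ext_elem fun i => by simpa using h2 i (Finset.mem_univ i)

/-! ### From eigenvalue bounds to stability types. -/

namespace ReductiveDecomp

variable {𝔤 : Type*} [LieRing 𝔤] [LieAlgebra ℝ 𝔤] [FiniteDimensional ℝ 𝔤]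
  {𝔨 : LieSubalgebra ℝ 𝔤} {Φ : Set (𝔤 →ₗ[ℝ] 𝔤)}

namespace IsStandard

variable {D : ReductiveDecomp 𝔨 Φ} {gB : InnerProd D.𝔭} (H : D.IsStandard gB)
  {ρ : ℝ} (hρ : D.IsEinstein gB ρ) {μ : ℝ}

include H hρ

theorem exists_eigentensor (hμ : μ ∈ D.spec gB) : ∃ A ∈ D.ttG gB, A ≠ 0 ∧
    0 < LinearMap.trace ℝ D.𝔭 (A * A) ∧
    LinearMap.trace ℝ D.𝔭 (casimirP D gB A * A) = μ * LinearMap.trace ℝ D.𝔭 (A * A) := by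
  obtain ⟨A, hA, hA0, hAμ⟩ := hμ
  refine ⟨A, hA, hA0, InnerProd.IsSymm.trace_mul_self_pos (h := gB) hA.1.1 hA0, ?_⟩
  rw [H.lichnerowicz_eq hρ hA.1] at hAμ
  rw [hAμ, smul_mul_assoc, map_smul, smul_eq_mul]

theorem isGUnstable_of_mem_spec (hμ : μ ∈ D.spec gB) (h : μ < 2 * ρ) : D.IsGUnstable gB := by
  intro hs
  obtain ⟨A, hA, -, hpos, hAμ⟩ := H.exists_eigentensor hρ hμ
  have h1 := hs A hA
  rw [H.scalHess_eq hρ hA.1, hAμ] at h1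
  nlinarith

theorem spec_casimir_bounds {n : ℕ} {e : Module.Basis (Fin n) ℝ 𝔤}
    (he : H.negKilling.IsOrthonormal e) {m M : ℝ} (hm : IsLeast (casimirSpec e) m)
    (hM : IsGreatest (casimirSpec e) M) (hμ : μ ∈ D.spec gB) :
    m ≤ 2 * μ + (4 * ρ - 1) ∧ 2 * μ + (4 * ρ - 1) ≤ M := by
  obtain ⟨A, hA, -, hpos, hAμ⟩ := H.exists_eigentensor hρ hμ
  have hb := H.casimirP_bounds he hm hM hρ hA
  rw [hAμ, ← mul_assoc, ← add_mul] at hb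
  exact ⟨le_of_mul_le_mul_right hb.1 hpos, le_of_mul_le_mul_right hb.2 hpos⟩

end IsStandard

/-- The stability theorem for standard metrics, with the Lie group replaced by the algebraic data
of `IsStandard`. -/
theorem IsStandard.stability {D : ReductiveDecomp 𝔨 Φ} {gB : InnerProd D.𝔭}
    (H : D.IsStandard gB) {ρ : ℝ} (hρ : D.IsEinstein gB ρ) (hTT : ∃ A ∈ D.ttG gB, A ≠ 0)
    {n : ℕ} {e : Module.Basis (Fin n) ℝ 𝔤} (he : H.negKilling.IsOrthonormal e)
    {m M : ℝ} (hm : IsLeast (casimirSpec e) m) (hM : IsGreatest (casimirSpec e) M)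
    {d k : ℝ} (hd : d = Module.finrank ℝ 𝔤) (hk : k = Module.finrank ℝ 𝔨) :
    ∃ l L : ℝ, IsLeast (D.spec gB) l ∧ IsGreatest (D.spec gB) L ∧
      (k < d * (m - 1) / (2 * M) → 2 * ρ < l ∧ D.IsGStable gB) ∧
      (k = d * (m - 1) / (2 * M) → 2 * ρ ≤ l ∧ D.IsGSemistable gB) ∧
      (0 < m → k > d * (M - 1) / (2 * m) →
        L < 2 * ρ ∧ D.IsGUnstable gB ∧ D.IsScalLocalMin gB) ∧
      (0 < m → k = d * (M - 1) / (2 * m) →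
        L ≤ 2 * ρ ∧ (l < L → D.IsGUnstable gB) ∧
        (l = L → (D.IsGUnstable gB ∧ D.IsScalLocalMin gB) ∨ D.IsGNeutrallyStable gB)) := by
  obtain ⟨l, L, hl, hL, hspec⟩ := H.exists_spec_bounds hρ hTT
  have : Nontrivial D.𝔭 := by
    obtain ⟨A, -, hA0⟩ := hTT
    by_contra hn
    rw [not_nontrivial_iff_subsingleton] at hn
    exact hA0 (LinearMap.ext fun X => Subsingleton.elim _ _)
  have : Nontrivial 𝔤 := Subtype.val_injective.nontrivial (α := D.𝔭)
  have hMpos := casimirTau_greatest_pos (fun X Y => H.negKilling_apply X Y) he hm hM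
  have hdpos : 0 < d := by
    rw [hd]
    exact_mod_cast Module.finrank_pos
  have hb := H.einstein_constant_bounds he hm hM hρ
  rw [← hd, ← hk] at hb
  have hlb := (H.spec_casimir_bounds hρ he hm hM hl.1).1
  have hLb := (H.spec_casimir_bounds hρ he hm hM hL.1).2
  have hhess : ∀ A ∈ D.ttG gB,
      D.scalHess gB A ≤ (ρ - l / 2) * LinearMap.trace ℝ D.𝔭 (A * A) := by
    intro A hA
    have := (hspec A hA).1
    rw [H.scalHess_eq hρ hA.1]
    linarith
  have hsemi : 2 * ρ ≤ l → D.IsGSemistable gB := by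
    intro h A hA
    refine (hhess A hA).trans ?_
    by_cases hA0 : A = 0
    · simp [hA0]
    · exact mul_nonpos_of_nonpos_of_nonneg (by linarith)
        (InnerProd.IsSymm.trace_mul_self_pos (h := gB) hA.1.1 hA0).le
  have hmin : L < 2 * ρ → D.IsScalLocalMin gB := fun h =>
    H.isScalLocalMin hρ h fun A hA => (hspec A hA).2
  refine ⟨l, L, hl, hL, fun h => ?_, fun h => ?_, fun hm0 h => ?_, fun hm0 h => ?_⟩
  · rw [lt_div_iff₀ (by positivity)] at h
    -- The bound `(4ρ - 1) d ≤ M k` and the hypothesis on `k` give this after dividing by `d`.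
    -- Together with `m ≤ 2 * l + 4ρ - 1` it yields `2ρ < l`. The other cases use the same
    -- elimination.
    have h1 : 2 * (4 * ρ - 1) < m - 1 := lt_of_mul_lt_mul_left (by linarith) hdpos.le
    have h2 : 2 * ρ < l := by linarith
    refine ⟨h2, fun A hA hA0 => (hhess A hA).trans_lt ?_⟩
    exact mul_neg_of_neg_of_pos (by linarith)
      (InnerProd.IsSymm.trace_mul_self_pos (h := gB) hA.1.1 hA0)
  · rw [eq_div_iff (by positivity)] at h
    have h1 : 2 * (4 * ρ - 1) ≤ m - 1 := le_of_mul_le_mul_left (by linarith) hdpos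
    have h2 : 2 * ρ ≤ l := by linarith
    exact ⟨h2, hsemi h2⟩
  · rw [gt_iff_lt, div_lt_iff₀ (by positivity)] at h
    have h1 : M - 1 < 2 * (4 * ρ - 1) := lt_of_mul_lt_mul_left (by linarith) hdpos.le
    have h2 : L < 2 * ρ := by linarith
    exact ⟨h2, H.isGUnstable_of_mem_spec hρ hL.1 h2, hmin h2⟩
  · rw [eq_div_iff (by positivity)] at h
    have h1 : M - 1 ≤ 2 * (4 * ρ - 1) := le_of_mul_le_mul_left (by linarith) hdpos
    have h2 : L ≤ 2 * ρ := by linarith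
    refine ⟨h2, fun h3 => H.isGUnstable_of_mem_spec hρ hl.1 (h3.trans_le h2), fun h3 => ?_⟩
    rcases h2.lt_or_eq with h4 | h4
    · exact Or.inl ⟨H.isGUnstable_of_mem_spec hρ hL.1 h4, hmin h4⟩
    -- Here `l = L = 2ρ`: the second variation is nonpositive, and it vanishes on an eigentensor.
    · refine Or.inr ⟨hsemi (by linarith), ?_⟩
      obtain ⟨A, hA, hA0, -, hAL⟩ := H.exists_eigentensor hρ hL.1
      refine ⟨A, hA, hA0, ?_⟩
      rw [H.scalHess_eq hρ hA.1, hAL, h4]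
      ring

end ReductiveDecomp

end

theorem theorem4p2
    {E : Type*} [NormedAddCommGroup E] [NormedSpace ℝ E] [FiniteDimensional ℝ E]
    {G : Type*} [TopologicalSpace G] [ChartedSpace E G] [Group G] [LieGroup 𝓘(ℝ, E) ∞ G]
    [CompactSpace G] [T2Space G]
    [LieAlgebra.IsSemisimple ℝ (GroupLieAlgebra 𝓘(ℝ, E) G)]
    (K : Subgroup G) (hK : IsClosed (K : Set G))
    -- the Killing-orthogonal reductive decomposition
    (D : ReductiveDecomp (subgroupLieAlgebra (E := E) K) (adjointSet (E := E) K))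
    (hD : ∀ Z ∈ subgroupLieAlgebra (E := E) K, ∀ X ∈ D.𝔭,
      killingForm ℝ (GroupLieAlgebra 𝓘(ℝ, E) G) Z X = 0)
    -- the standard metric
    (gB : InnerProd D.𝔭)
    (hgB : ∀ X Y : D.𝔭, gB.form X Y = -killingForm ℝ (GroupLieAlgebra 𝓘(ℝ, E) G) X Y)
    (ρ : ℝ) (hρ : D.IsEinstein gB ρ)
    -- there are nonzero `G`-invariant TT-tensors, so that the eigenvalues below make sense
    (hTT : ∃ A ∈ D.ttG gB, A ≠ 0)
    -- an orthonormal basis of the Lie algebra with respect to minus the Killing form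
    {n : ℕ} (e : Module.Basis (Fin n) ℝ (GroupLieAlgebra 𝓘(ℝ, E) G))
    (he : ∀ i j, -killingForm ℝ (GroupLieAlgebra 𝓘(ℝ, E) G) (e i) (e j) = if i = j then 1 else 0)
    (lamτ lamτmax : ℝ) (hτ : IsLeast (casimirSpec e) lamτ)
    (hτmax : IsGreatest (casimirSpec e) lamτmax)
    (dimG dimK : ℝ) (hdimG : dimG = Module.finrank ℝ (GroupLieAlgebra 𝓘(ℝ, E) G))
    (hdimK : dimK = Module.finrank ℝ (subgroupLieAlgebra (E := E) K)) :
    ∃ lamP lamPmax : ℝ, IsLeast (D.spec gB) lamP ∧ IsGreatest (D.spec gB) lamPmax ∧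
      (dimK < dimG * (lamτ - 1) / (2 * lamτmax) → 2 * ρ < lamP ∧ D.IsGStable gB) ∧
      (dimK = dimG * (lamτ - 1) / (2 * lamτmax) → 2 * ρ ≤ lamP ∧ D.IsGSemistable gB) ∧
      (0 < lamτ → dimK > dimG * (lamτmax - 1) / (2 * lamτ) →
        lamPmax < 2 * ρ ∧ D.IsGUnstable gB ∧ D.IsScalLocalMin gB) ∧
      (0 < lamτ → dimK = dimG * (lamτmax - 1) / (2 * lamτ) →
        lamPmax ≤ 2 * ρ ∧
        (lamP < lamPmax → D.IsGUnstable gB) ∧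
        (lamP = lamPmax →
          (D.IsGUnstable gB ∧ D.IsScalLocalMin gB) ∨ D.IsGNeutrallyStable gB)) := by
  have H : D.IsStandard gB :=
    { killing_neg := fun X hX => killingForm_neg_of_orthonormal he hX
      orth := hD
      form_eq := hgB
      map_lie := by
        rintro _ ⟨k, -, rfl⟩ X Y
        exact adjointRep_lie k X Y
      map_killing := by
        rintro _ ⟨k, -, rfl⟩ X Y
        exact killingForm_adjointRep k X Y
      ad_comm := ad_comm_of_adjointSet_comm K D }
  exact H.stability hρ hTT (fun i j => (H.negKilling_apply _ _).trans (he i j)) hτ hτmax hdimG hdimK
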